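/- Let $\Bbbk$ be a commutative ring of characteristic different from $2$, and let $F=\bigoplus_{i\ge 0}F_i$ be an $\mathbb N$-graded Frobenius superalgebra over $\Bbbk$: it has a finite homogeneous $\Bbbk$-basis $B$ and an even $\Bbbk$-linear trace map $\operatorname{tr}\colon F\to\Bbbk$, homogeneous of degree $-\delta$ ($\delta\in\mathbb N$), such that $f\mapsto\big(g\mapsto(-1)^{\bar f\bar g}\operatorname{tr}(gf)\big)$ is a bijection $F\to\operatorname{Hom}_\Bbbk(F,\Bbbk)$. Let $\{b^\vee\mid b\in B\}$ be the left dual basis, $\operatorname{tr}(b^\vee c)=\delta_{b,c}$, and let $\psi$ be the Nakayama automorphism, $\operatorname{tr}(fg)=(-1)^{\bar f\bar g}\operatorname{tr}(g\psi(f))$, where $\bar f$ is the parity of $f$. Assume that $\psi$ has finite order $\theta$, that the characteristic of $\Bbbk$ does not divide $\theta$, and that $\psi$ is diagonalizable. For $n\ge1$ let $\mathcal A_n(F)$ be the affine wreath product algebra, the $\mathbb Z$-graded superalgebra generated by $x_1,\dots,x_n$, the superalgebra $F^{\otimes n}$ and the group algebra $\Bbbk S_n$, subject to $x_ix_j=x_jx_i$;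 $f_ix_i=x_i\psi(f)_i$ and $f_jx_i=x_if_j$ for $i\ne j$, where $f_i$ denotes $f\in F$ in the $i$-th tensor factor; $s_ix_j=x_js_i$ for $j\ne i,i+1$; $s_ix_i=x_{i+1}s_i-t_{i,i+1}$ with $t_{i,j}=\sum_{b\in B}b_i b^\vee_j$; and $\pi f_i=f_{\pi(i)}\pi$ for $\pi\in S_n$. Here $x_i$ is even of degree $\delta$, permutations are even of degree $0$, and elements of $F^{\otimes n}$ have their own degree and parity. Let $\mathbf C$ consist of integers $e_1,\dots,e_\theta\ge0$ and even elements $c^{(k,j)}\in F$ ($1\le k\le\theta$, $1\le j\le e_k$) of degree $k\delta$ such that $\psi(c^{(k,j)})=c^{(k,j)}$ and $g\,c^{(k,j)}=c^{(k,j)}\psi^k(g)$ for all $g\in F$. Put $$\chi_{\mathbf C}=\prod_{k=1}^{\theta}\prod_{j=1}^{e_k}\big(x_1^k-c^{(k,j)}_1\big),\qquad d=\sum_{k=1}^{\theta}k\,e_k,$$ and let $\mathcal A_n^{\mathbf C}(F)$ be the quotient of $\mathcal A_n(F)$ by the two-sided ideal generated by $\chi_{\mathbf C}$, with $\mathcal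 A_0^{\mathbf C}(F)=\Bbbk$. All modules are $\mathbb Z$-graded left supermodules, with even homomorphisms of degree $0$ as morphisms; $\Pi$ is the parity shift. Let $\operatorname{Ind}_n^{n+1}=\mathcal A_{n+1}^{\mathbf C}(F)\otimes_{\mathcal A_n^{\mathbf C}(F)}-$ and $\operatorname{Res}^{n+1}_n$ be induction and restriction along the canonical homomorphism $\mathcal A_n^{\mathbf C}(F)\to\mathcal A_{n+1}^{\mathbf C}(F)$, $x_i\mapsto x_i$, $f_i\mapsto f_i$, $\pi\mapsto\pi$. **Theorem (Cyclotomic Mackey Theorem).** For every $n\ge1$ there is a natural isomorphism $$\operatorname{Res}^{n+1}_n\operatorname{Ind}_n^{n+1}\;\cong\;\operatorname{id}^{\oplus d\dim F_{\mathrm{even}}}\oplus\Pi^{\oplus d\dim F_{\mathrm{odd}}}\oplus\operatorname{Ind}_{n-1}^{n}\operatorname{Res}^{n}_{n-1}$$ of functors on graded $\mathcal A_n^{\mathbf C}(F)$-supermodules, where $F_{\mathrm{even}}$ and $F_{\mathrm{odd}}$ are the even and odd parts of $F$. Here, as degree shifts are disregarded, a natural isomorphism is a family of parity-preserving module isomorphisms,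 natural in the module, such that each of them and its inverse is a finite sum of homogeneous homomorphisms, possibly of various $\mathbb Z$-degrees. Moreover all the functors $\operatorname{Ind}_n^{n+1}$ and $\operatorname{Res}^{n+1}_n$, $n\ge0$, preserve finitely generated modules, so the isomorphism restricts to the categories of finitely generated graded supermodules. -/

import Mathlib

open CategoryTheory
open scoped TensorProduct DirectSum

universe u₁ u₂ w v

set_option linter.unusedSectionVars false

namespace AWP

/-- Bidegrees: the first component is the degree, the second one the parity. -/
abbrev Gr : Type := ℤ × ZMod 2

/-- The sign `(-1) ^ ε`. -/
def sgn (ε : ZMod 2) : ℤ := if ε = 0 then 1 else -1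

theorem sgn_zero : sgn 0 = 1 := rfl

theorem sgn_add : ∀ a b : ZMod 2, sgn (a + b) = sgn a * sgn b := by decide

section Internal

variable {Q S : Type*} [AddCommGroup Q] [SetLike S Q] [AddSubgroupClass S Q]

theorem internal_of_components (P : Gr → S) (T : Q →+ (Gr →₀ Q))
    (h1 : ∀ p, ∀ x ∈ P p, T x = Finsupp.single p x) (h2 : ∀ x p, T x p ∈ P p)
    (h3 : ∀ x, ((T x).sum fun _ y => y) = x) : DirectSum.IsInternal P := by
  constructor
  · rw [injective_iff_map_eq_zero]
    intro d hd
    have key : ∀ d : ⨁ p, P p, ∀ p, T (DirectSum.coeAddMonoidHom P d) p = (d p : Q) := by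
      intro d p
      induction d using DirectSum.induction_on with
      | zero => simp
      | of i x =>
        rw [DirectSum.coeAddMonoidHom_of, h1 i x x.2]
        by_cases hip : i = p
        · subst hip; simp
        · rw [Finsupp.single_eq_of_ne (Ne.symm hip), DirectSum.of_eq_of_ne _ _ _ (Ne.symm hip)]
          simp
      | add x y hx hy => simp [hx, hy]
    ext p
    rw [← key d p, hd]
    simp
  · intro x
    refine ⟨∑ p ∈ (T x).support, DirectSum.of (fun p => P p) p ⟨T x p, h2 x p⟩, ?_⟩
    rw [map_sum]
    simp only [DirectSum.coeAddMonoidHom_of]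
    exact h3 x

theorem internal_induction {P : Gr → S} (hP : DirectSum.IsInternal P) {motive : Q → Prop}
    (zero : motive 0) (hom : ∀ p, ∀ x ∈ P p, motive x)
    (add : ∀ x y, motive x → motive y → motive (x + y)) (x : Q) : motive x := by
  obtain ⟨d, rfl⟩ := hP.2 x
  induction d using DirectSum.induction_on with
  | zero => simpa using zero
  | of i x => rw [DirectSum.coeAddMonoidHom_of]; exact hom i x x.2
  | add x y hx hy => rw [map_add]; exact add _ _ hx hy

/-- The map sending an element to the family of its homogeneous components. -/
noncomputable def comps {P : Gr → S} (hP : DirectSum.IsInternal P) : Q →+ (Gr →₀ Q) :=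
  (DirectSum.toAddMonoid fun p =>
    (Finsupp.singleAddHom p).comp (AddSubgroupClass.subtype (P p))).comp
    (AddEquiv.ofBijective (DirectSum.coeAddMonoidHom P) hP).symm.toAddMonoidHom

theorem comps_of_mem {P : Gr → S} (hP : DirectSum.IsInternal P) {p : Gr} {x : Q}
    (hx : x ∈ P p) : comps hP x = Finsupp.single p x := by
  have : (AddEquiv.ofBijective (DirectSum.coeAddMonoidHom P) hP).symm x =
      DirectSum.of (fun p => P p) p ⟨x, hx⟩ := by
    rw [AddEquiv.symm_apply_eq]
    exact (DirectSum.coeAddMonoidHom_of P p ⟨x, hx⟩).symm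
  simp only [comps, AddMonoidHom.comp_apply, AddEquiv.coe_toAddMonoidHom, this,
    DirectSum.toAddMonoid_of]
  rfl

theorem comps_mem {P : Gr → S} (hP : DirectSum.IsInternal P) (x : Q) (p : Gr) :
    comps hP x p ∈ P p := by
  induction x using internal_induction hP with
  | zero => simp [zero_mem]
  | hom q x hx =>
    rw [comps_of_mem hP hx, Finsupp.single_apply]
    split_ifs with h
    · exact h ▸ hx
    · exact zero_mem _
  | add x y hx hy => simpa using add_mem hx hy

theorem comps_sum {P : Gr → S} (hP : DirectSum.IsInternal P) (x : Q) :
    ((comps hP x).sum fun _ y => y) = x := by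
  induction x using internal_induction hP with
  | zero => simp
  | hom q x hx => rw [comps_of_mem hP hx]; simp
  | add x y hx hy => rw [map_add, Finsupp.sum_add_index' (by simp) (by simp), hx, hy]

end Internal

section GradedModules

variable {k : Type*} [CommRing k] {A : Type w} [Ring A] [Algebra k A]

/-- A `ℤ`-graded left supermodule over the graded superalgebra `A = ⨁ p, 𝒜 p`. -/
structure GrSMod (𝒜 : Gr → Submodule k A) where
  carrier : Type v
  [grp : AddCommGroup carrier]
  [mod : Module A carrier]
  piece : Gr → AddSubgroup carrier
  internal : DirectSum.IsInternal piece
  smul_mem : ∀ {p q : Gr} {a : A} {m : carrier}, a ∈ 𝒜 p → m ∈ piece q → a • m ∈ piece (p + q)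

attribute [instance] GrSMod.grp GrSMod.mod

variable {𝒜 : Gr → Submodule k A}

/-- The maps `M → N` homogeneous of degree `i` and parity `ε` that satisfy
`α (a m) = (-1) ^ (ε ā) a (α m)`. -/
def HOM (M N : GrSMod.{w, v} 𝒜) (i : ℤ) (ε : ZMod 2) : AddSubgroup (M.carrier →+ N.carrier) where
  carrier := {α | (∀ (p : Gr) (a : A) (m : M.carrier), a ∈ 𝒜 p →
      α (a • m) = sgn (ε * p.2) • a • α m) ∧
    ∀ (q : Gr) (m : M.carrier), m ∈ M.piece q → α m ∈ N.piece ((i, ε) + q)}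
  add_mem' {α β} hα hβ := by
    refine ⟨fun p a m ha => ?_, fun q m hm => add_mem (hα.2 q m hm) (hβ.2 q m hm)⟩
    simp [hα.1 p a m ha, hβ.1 p a m ha]
  zero_mem' := ⟨by simp, fun q m _ => zero_mem _⟩
  neg_mem' {α} hα := by
    refine ⟨fun p a m ha => ?_, fun q m hm => neg_mem (hα.2 q m hm)⟩
    simp [hα.1 p a m ha]

/-- The parity-preserving part `⨁ i, HOM M N i 0` of the full homomorphism space. -/
def evenHOM (M N : GrSMod.{w, v} 𝒜) : AddSubgroup (M.carrier →+ N.carrier) :=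
  ⨆ i : ℤ, HOM M N i 0

/-- Graded supermodules form a category with the even homomorphisms of degree zero. -/
instance : Category (GrSMod.{w, v} 𝒜) where
  Hom M N := HOM M N 0 0
  id M := ⟨AddMonoidHom.id _, by
    refine ⟨fun p a m _ => ?_, fun q m hm => ?_⟩
    · simp [sgn_zero]
    · simpa [← Prod.zero_eq_mk] using hm⟩
  comp f g := ⟨g.1.comp f.1, by
    refine ⟨fun p a m ha => ?_, fun q m hm => ?_⟩
    · have h1 := f.2.1 p a m ha
      have h2 := g.2.1 p a (f.1 m) ha
      simp only [zero_mul, sgn_zero, one_smul] at h1 h2 ⊢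
      rw [AddMonoidHom.comp_apply, h1, h2, AddMonoidHom.comp_apply]
    · have h1 := g.2.2 _ _ (f.2.2 q m hm)
      simpa [← Prod.zero_eq_mk] using h1⟩

theorem hom_piece {M N : GrSMod.{w, v} 𝒜} (f : M ⟶ N) {q : Gr} {m : M.carrier}
    (hm : m ∈ M.piece q) : f.1 m ∈ N.piece q := by
  simpa [← Prod.zero_eq_mk] using f.2.2 q m hm

variable [GradedAlgebra 𝒜]

theorem hom_smul {M N : GrSMod.{w, v} 𝒜} (f : M ⟶ N) (a : A) (m : M.carrier) :
    f.1 (a • m) = a • f.1 m := by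
  induction a using DirectSum.Decomposition.inductionOn 𝒜 with
  | zero => simp
  | homogeneous a => simpa [sgn_zero] using f.2.1 _ a m a.2
  | add a b ha hb => simp [add_smul, ha, hb]

/-- An additive map that preserves the action and the pieces, as a morphism. -/
def mkHom {M N : GrSMod.{w, v} 𝒜} (f : M.carrier →+ N.carrier)
    (h1 : ∀ (a : A) (m : M.carrier), f (a • m) = a • f m)
    (h2 : ∀ (q : Gr) (m : M.carrier), m ∈ M.piece q → f m ∈ N.piece q) : M ⟶ N :=
  ⟨f, fun p a m _ => by simp [sgn_zero, h1], fun q m hm => by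
    simpa [← Prod.zero_eq_mk] using h2 q m hm⟩

/-- The parity involution `a ↦ (-1) ^ ā a`. -/
noncomputable def parityInv (𝒜 : Gr → Submodule k A) [GradedAlgebra 𝒜] : A →+* A :=
  (DirectSum.toSemiring (fun p : Gr => sgn p.2 • (𝒜 p).subtype.toAddMonoidHom)
    (by
      change sgn 0 • (1 : A) = 1
      simp [sgn_zero])
    (by
      intro p q a b
      change sgn (p.2 + q.2) • ((a : A) * (b : A)) = (sgn p.2 • (a : A)) * (sgn q.2 • (b : A))
      rw [sgn_add, smul_mul_smul_comm])).comp
    (DirectSum.decomposeRingEquiv 𝒜).toRingHom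

theorem parityInv_of_mem {p : Gr} {a : A} (ha : a ∈ 𝒜 p) : parityInv 𝒜 a = sgn p.2 • a := by
  change DirectSum.toAddMonoid (fun p : Gr => sgn p.2 • (𝒜 p).subtype.toAddMonoidHom)
    (DirectSum.decompose 𝒜 a) = _
  rw [DirectSum.decompose_of_mem 𝒜 ha, DirectSum.toAddMonoid_of]
  rfl

/-- The parity shift: the same group with `(ΠM)_{i,ε} = M_{i,ε+1}` and `a · m = (-1) ^ ā a m`. -/
noncomputable def parityShiftObj (M : GrSMod.{w, v} 𝒜) : GrSMod.{w, v} 𝒜 where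
  carrier := M.carrier
  grp := M.grp
  mod := Module.compHom M.carrier (parityInv 𝒜)
  piece := fun p => M.piece (p + (0, 1))
  internal := by
    have hb : Function.Bijective fun p : Gr => p + (0, 1) := (Equiv.addRight _).bijective
    refine internal_of_components _
      ((Finsupp.mapDomain.addMonoidHom fun p : Gr => p + (0, 1)).comp (comps M.internal))
      ?_ ?_ ?_
    · intro p x hx
      have h2 : p + (0, 1) + (0, 1) = p := by
        rw [add_assoc]
        exact (congrArg (p + ·) (by decide : ((0, 1) : Gr) + (0, 1) = 0)).trans (add_zero p)
      simp only [AddMonoidHom.comp_apply, comps_of_mem M.internal hx,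
        Finsupp.mapDomain.addMonoidHom_apply, Finsupp.mapDomain_single, h2]
    · intro x p
      have h2 : p + (0, 1) + (0, 1) = p := by
        rw [add_assoc]
        exact (congrArg (p + ·) (by decide : ((0, 1) : Gr) + (0, 1) = 0)).trans (add_zero p)
      have := Finsupp.mapDomain_apply hb.1 (comps M.internal x) (p + (0, 1))
      rw [h2] at this
      simp only [AddMonoidHom.comp_apply, Finsupp.mapDomain.addMonoidHom_apply, this]
      exact comps_mem M.internal x _
    · intro x
      simp only [AddMonoidHom.comp_apply, Finsupp.mapDomain.addMonoidHom_apply]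
      rw [Finsupp.sum_mapDomain_index (by simp) (by simp)]
      exact comps_sum M.internal x
  smul_mem := by
    intro p q a m ha hm
    change parityInv 𝒜 a • m ∈ _
    rw [parityInv_of_mem ha, smul_assoc, add_assoc]
    exact zsmul_mem (M.smul_mem ha hm) _

/-- The parity shift functor `Π`. -/
noncomputable def parityShift : GrSMod.{w, v} 𝒜 ⥤ GrSMod.{w, v} 𝒜 where
  obj M := parityShiftObj M
  map {M N} f := mkHom (M := parityShiftObj M) (N := parityShiftObj N) f.1
    (fun a m => hom_smul f (parityInv 𝒜 a) m) (fun q m hm => hom_piece f hm)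

/-- The direct sum of a finite family. -/
noncomputable def dsum {ι : Type} [Fintype ι] (M : ι → GrSMod.{w, v} 𝒜) : GrSMod.{w, v} 𝒜 where
  carrier := ∀ i, (M i).carrier
  piece p := AddSubgroup.pi Set.univ fun i => (M i).piece p
  internal := by
    classical
    refine internal_of_components _ (∑ i, (Finsupp.mapRange.addMonoidHom
      (AddMonoidHom.single (fun i => (M i).carrier) i)).comp
      ((comps (M i).internal).comp (Pi.evalAddMonoidHom (fun i => (M i).carrier) i))) ?_ ?_ ?_
    · intro p x hx
      rw [AddMonoidHom.finsetSum_apply]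
      have : ∀ i, comps (M i).internal (x i) = Finsupp.single p (x i) := fun i =>
        comps_of_mem _ (hx i trivial)
      simp only [AddMonoidHom.comp_apply, Pi.evalAddMonoidHom_apply, this,
        Finsupp.mapRange.addMonoidHom_apply, Finsupp.mapRange_single]
      rw [← Finsupp.single_finsetSum]
      congr 1
      exact Finset.univ_sum_single x
    · intro x p
      rw [AddMonoidHom.finsetSum_apply, Finsupp.finsetSum_apply]
      refine sum_mem fun i _ => ?_
      intro j _
      simp only [AddMonoidHom.comp_apply, Finsupp.mapRange.addMonoidHom_apply,
        Finsupp.mapRange_apply, AddMonoidHom.single_apply]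
      by_cases h : j = i
      · subst h
        simpa using comps_mem (M j).internal (x j) p
      · simp [Pi.single_eq_of_ne h, zero_mem]
    · intro x
      rw [AddMonoidHom.finsetSum_apply]
      have : ∀ f : ι → (Gr →₀ ∀ i, (M i).carrier),
          ((∑ i, f i).sum fun _ y => y) = ∑ i, (f i).sum fun _ y => y := fun f =>
        (Finsupp.sum_finsetSum_index (by simp) (by simp)).symm
      rw [this]
      conv_rhs => rw [← Finset.univ_sum_single x]
      refine Finset.sum_congr rfl fun i _ => ?_
      simp only [AddMonoidHom.comp_apply, Finsupp.mapRange.addMonoidHom_apply]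
      rw [Finsupp.sum_mapRange_index (by simp)]
      conv_rhs => rw [← comps_sum (M i).internal (x i)]
      exact (map_finsuppSum (AddMonoidHom.single (fun i => (M i).carrier) i) _ _).symm
  smul_mem ha hm := fun i _ => (M i).smul_mem ha (hm i trivial)

/-- The direct sum of a finite family of functors. -/
noncomputable def dsumFunctor {C : Type*} [Category C] {ι : Type} [Fintype ι]
    (T : ι → C ⥤ GrSMod.{w, v} 𝒜) : C ⥤ GrSMod.{w, v} 𝒜 where
  obj X := dsum fun i => (T i).obj X
  map {X Y} f := mkHom (M := dsum fun i => (T i).obj X) (N := dsum fun i => (T i).obj Y)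
    { toFun := fun x i => ((T i).map f).1 (x i)
      map_zero' := funext fun i => map_zero ((T i).map f).1
      map_add' := fun x y => funext fun i => map_add ((T i).map f).1 (x i) (y i) }
    (fun a x => by funext i; exact hom_smul ((T i).map f) a (x i))
    (fun q x hx i _ => hom_piece ((T i).map f) (hx i trivial))
  map_id X := by
    apply Subtype.ext
    ext x
    funext i
    change ((T i).map (𝟙 X)).1 (x i) = x i
    rw [CategoryTheory.Functor.map_id]
    rfl
  map_comp f g := by
    apply Subtype.ext
    ext x
    funext i
    change ((T i).map (f ≫ g)).1 (x i) = _
    rw [CategoryTheory.Functor.map_comp]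
    rfl

end GradedModules

section ResInd

variable {k : Type*} [CommRing k] {A B : Type w} [Ring A] [Algebra k A] [Ring B] [Algebra k B]
  {𝒜 : Gr → Submodule k A} {ℬ : Gr → Submodule k B} [GradedAlgebra 𝒜] [GradedAlgebra ℬ]

/-- Restriction along `φ`. -/
def resObj (φ : 𝒜 →+*ᵍ ℬ) (M : GrSMod.{w, v} ℬ) : GrSMod.{w, v} 𝒜 where
  carrier := M.carrier
  grp := M.grp
  mod := Module.compHom M.carrier φ.toRingHom
  piece := M.piece
  internal := M.internal
  smul_mem ha hm := M.smul_mem (φ.map_mem ha) hm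

/-- The restriction functor along `φ`. -/
def res (φ : 𝒜 →+*ᵍ ℬ) : GrSMod.{w, v} ℬ ⥤ GrSMod.{w, v} 𝒜 where
  obj M := resObj φ M
  map {M N} f := mkHom (M := resObj φ M) (N := resObj φ N) f.1
    (fun a m => hom_smul f (φ a) m) (fun _ _ hm => hom_piece f hm)

/-- The submodule of `B ⊗[ℤ] M` of the elements that vanish in `B ⊗ M` over `A`. -/
def balanced (φ : 𝒜 →+*ᵍ ℬ) (M : GrSMod.{w, v} 𝒜) : Submodule B (B ⊗[ℤ] M.carrier) :=
  Submodule.span B {z | ∃ (b : B) (a : A) (m : M.carrier),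
    z = (b * φ a) ⊗ₜ[ℤ] m - b ⊗ₜ[ℤ] (a • m)}

/-- The tensor product of `B` and `M` over `A`, where `A` acts on the right of `B` through `φ`. -/
abbrev IndCarrier (φ : 𝒜 →+*ᵍ ℬ) (M : GrSMod.{w, v} 𝒜) : Type (max w v) :=
  (B ⊗[ℤ] M.carrier) ⧸ balanced φ M

/-- The class of `b ⊗ m`. -/
def indMk (φ : 𝒜 →+*ᵍ ℬ) (M : GrSMod.{w, v} 𝒜) (b : B) (m : M.carrier) : IndCarrier φ M :=
  (balanced φ M).mkQ (b ⊗ₜ[ℤ] m)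

/-- The homogeneous pieces of the induced module, spanned by the `b ⊗ m` of the given bidegree. -/
def indPiece (φ : 𝒜 →+*ᵍ ℬ) (M : GrSMod.{w, v} 𝒜) (r : Gr) : AddSubgroup (IndCarrier φ M) :=
  AddSubgroup.closure {z | ∃ (p q : Gr) (b : B) (m : M.carrier),
    p + q = r ∧ b ∈ ℬ p ∧ m ∈ M.piece q ∧ z = indMk φ M b m}

section

variable (φ : 𝒜 →+*ᵍ ℬ) (M : GrSMod.{w, v} 𝒜)

theorem indMk_add_left (b b' : B) (m : M.carrier) :
    indMk φ M (b + b') m = indMk φ M b m + indMk φ M b' m := by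
  simp [indMk, TensorProduct.add_tmul]

theorem indMk_add_right (b : B) (m m' : M.carrier) :
    indMk φ M b (m + m') = indMk φ M b m + indMk φ M b m' := by
  simp [indMk, TensorProduct.tmul_add]

theorem smul_indMk (c b : B) (m : M.carrier) : c • indMk φ M b m = indMk φ M (c * b) m := by
  rw [indMk, ← map_smul]; rfl

theorem indMk_mul (b : B) (a : A) (m : M.carrier) :
    indMk φ M (b * φ a) m = indMk φ M b (a • m) := by
  rw [indMk, indMk, ← sub_eq_zero, ← map_sub]
  exact (Submodule.Quotient.mk_eq_zero _).2 (Submodule.subset_span ⟨b, a, m, rfl⟩)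

/-- `b` times `m`, as an additive map in both variables. -/
def indMkHom : B →+ M.carrier →+ IndCarrier φ M :=
  AddMonoidHom.mk' (fun b => AddMonoidHom.mk' (indMk φ M b) (indMk_add_right φ M b))
    (fun b b' => by ext m; exact indMk_add_left φ M b b' m)

theorem ind_induction {motive : IndCarrier φ M → Prop} (zero : motive 0)
    (mk : ∀ (p q : Gr) (b : B) (m : M.carrier), b ∈ ℬ p → m ∈ M.piece q → motive (indMk φ M b m))
    (add : ∀ x y, motive x → motive y → motive (x + y)) (x : IndCarrier φ M) : motive x := by
  obtain ⟨x, rfl⟩ := (balanced φ M).mkQ_surjective x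
  induction x using TensorProduct.induction_on with
  | zero => simpa using zero
  | add x y hx hy => rw [map_add]; exact add _ _ hx hy
  | tmul b m =>
    change motive (indMk φ M b m)
    induction b using DirectSum.Decomposition.inductionOn ℬ with
    | zero => simpa [indMk] using zero
    | add b b' h h' => rw [indMk_add_left]; exact add _ _ h h'
    | homogeneous b =>
      induction m using internal_induction M.internal with
      | zero => simpa [indMk] using zero
      | add m m' h h' => rw [indMk_add_right]; exact add _ _ h h'
      | hom q m hm => exact mk _ q _ m b.2 hm

/-- The homogeneous components of `b ⊗ m`. -/
noncomputable def indCompsAux : B →+ M.carrier →+ (Gr →₀ IndCarrier φ M) :=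
  (Finsupp.liftAddHom fun p : Gr => AddMonoidHom.mk'
    (fun b : B => (Finsupp.liftAddHom fun q : Gr =>
      (Finsupp.singleAddHom (p + q)).comp (indMkHom φ M b)).comp (comps M.internal))
    (fun b b' => by
      ext1 m
      simp only [AddMonoidHom.comp_apply, AddMonoidHom.add_apply]
      induction m using internal_induction M.internal with
      | zero => simp
      | hom q m hm => simp [comps_of_mem M.internal hm]
      | add x y hx hy =>
        simp only [map_add] at hx hy ⊢
        rw [hx, hy]
        abel)).comp
    (comps (DirectSum.Decomposition.isInternal ℬ))

theorem indCompsAux_of_mem {p q : Gr} {b : B} {m : M.carrier} (hb : b ∈ ℬ p)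
    (hm : m ∈ M.piece q) :
    indCompsAux φ M b m = Finsupp.single (p + q) (indMk φ M b m) := by
  rw [indCompsAux, AddMonoidHom.comp_apply, comps_of_mem _ hb, Finsupp.liftAddHom_apply_single]
  simp only [AddMonoidHom.mk'_apply, AddMonoidHom.comp_apply]
  rw [comps_of_mem _ hm, Finsupp.liftAddHom_apply_single]
  rfl

theorem indCompsAux_balanced (b : B) (a : A) (m : M.carrier) :
    indCompsAux φ M (b * φ a) m = indCompsAux φ M b (a • m) := by
  induction b using DirectSum.Decomposition.inductionOn ℬ with
  | zero => simp
  | add b b' h h' => simp only [add_mul, map_add, AddMonoidHom.add_apply, h, h']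
  | homogeneous b =>
    induction a using DirectSum.Decomposition.inductionOn 𝒜 with
    | zero => simp
    | add a a' h h' => simp only [mul_add, map_add, AddMonoidHom.add_apply, h, h', add_smul]
    | homogeneous a =>
      induction m using internal_induction M.internal with
      | zero => simp
      | add m m' h h' => simp only [map_add, h, h', smul_add]
      | hom q m hm =>
        have ha : φ (a : A) ∈ ℬ _ := φ.map_mem a.2
        rw [indCompsAux_of_mem φ M (SetLike.mul_mem_graded b.2 ha) hm,
          indCompsAux_of_mem φ M b.2 (M.smul_mem a.2 hm), add_assoc]
        exact congrArg _ (indMk_mul φ M _ _ _)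

/-- The homogeneous components of an element of `B ⊗[ℤ] M`, as classes. -/
noncomputable def indCompsTensor : B ⊗[ℤ] M.carrier →+ (Gr →₀ IndCarrier φ M) :=
  TensorProduct.liftAddHom (R := ℤ) (indCompsAux φ M)
    (fun r b m => by rw [map_zsmul, map_zsmul, AddMonoidHom.smul_apply])

theorem indCompsTensor_balanced {x : B ⊗[ℤ] M.carrier} (hx : x ∈ balanced φ M) (c : B) :
    indCompsTensor φ M (c • x) = 0 := by
  induction hx using Submodule.span_induction generalizing c with
  | mem x hx =>
    obtain ⟨b, a, m, rfl⟩ := hx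
    rw [smul_sub, map_sub, TensorProduct.smul_tmul', TensorProduct.smul_tmul', smul_eq_mul,
      smul_eq_mul, ← mul_assoc]
    exact sub_eq_zero.2 (indCompsAux_balanced φ M (c * b) a m)
  | zero => simp
  | add x y _ _ hx hy => rw [smul_add, map_add, hx, hy, add_zero]
  | smul d x _ hx => rw [smul_smul]; exact hx _

/-- The homogeneous components of an element of the induced module. -/
noncomputable def indComps : IndCarrier φ M →+ (Gr →₀ IndCarrier φ M) :=
  QuotientAddGroup.lift (balanced φ M).toAddSubgroup (indCompsTensor φ M)
    (fun x hx => by simpa using indCompsTensor_balanced φ M hx 1)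

theorem indComps_of_mem {p q : Gr} {b : B} {m : M.carrier} (hb : b ∈ ℬ p)
    (hm : m ∈ M.piece q) :
    indComps φ M (indMk φ M b m) = Finsupp.single (p + q) (indMk φ M b m) :=
  indCompsAux_of_mem φ M hb hm

theorem ind_internal : DirectSum.IsInternal (indPiece φ M) := by
  refine internal_of_components _ (indComps φ M) ?_ ?_ ?_
  · intro r x hx
    induction hx using AddSubgroup.closure_induction with
    | mem x hx =>
      obtain ⟨p, q, b, m, rfl, hb, hm, rfl⟩ := hx
      exact indComps_of_mem φ M hb hm
    | zero => simp
    | add x y _ _ hx hy => simp [hx, hy]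
    | neg x _ hx => simp [hx]
  · intro x r
    induction x using ind_induction φ M with
    | zero => simp [zero_mem]
    | add x y hx hy => simpa using add_mem hx hy
    | mk p q b m hb hm =>
      rw [indComps_of_mem φ M hb hm, Finsupp.single_apply]
      split_ifs with h
      · exact AddSubgroup.subset_closure ⟨p, q, b, m, h, hb, hm, rfl⟩
      · exact zero_mem _
  · intro x
    induction x using ind_induction φ M with
    | zero => simp
    | add x y hx hy => rw [map_add, Finsupp.sum_add_index' (by simp) (by simp), hx, hy]
    | mk p q b m hb hm => rw [indComps_of_mem φ M hb hm]; simp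

end

/-- Induction along `φ`. -/
def indObj (φ : 𝒜 →+*ᵍ ℬ) (M : GrSMod.{w, v} 𝒜) : GrSMod.{w, max w v} ℬ where
  carrier := IndCarrier φ M
  piece := indPiece φ M
  internal := ind_internal φ M
  smul_mem {p q c x} hc hx := by
    induction hx using AddSubgroup.closure_induction with
    | mem x hx =>
      obtain ⟨p', q', b, m, rfl, hb, hm, rfl⟩ := hx
      rw [smul_indMk]
      exact AddSubgroup.subset_closure
        ⟨p + p', q', c * b, m, add_assoc _ _ _, SetLike.mul_mem_graded hc hb, hm, rfl⟩
    | zero => rw [smul_zero]; exact zero_mem _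
    | add x y _ _ hx hy => rw [smul_add]; exact add_mem hx hy
    | neg x _ hx => rw [smul_neg]; exact neg_mem hx

/-- The map `b ⊗ m ↦ b ⊗ f m`. -/
noncomputable def indMap (φ : 𝒜 →+*ᵍ ℬ) {M N : GrSMod.{w, v} 𝒜} (f : M ⟶ N) :
    IndCarrier φ M →ₗ[B] IndCarrier φ N :=
  (balanced φ M).mapQ (balanced φ N)
    (TensorProduct.AlgebraTensorModule.map (LinearMap.id : B →ₗ[B] B) f.1.toIntLinearMap)
    (Submodule.span_le.2 (by
      rintro _ ⟨b, a, m, rfl⟩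
      refine Submodule.subset_span ⟨b, a, f.1 m, ?_⟩
      rw [map_sub, TensorProduct.AlgebraTensorModule.map_tmul,
        TensorProduct.AlgebraTensorModule.map_tmul, ← hom_smul f a m]
      rfl))

theorem indMap_mk (φ : 𝒜 →+*ᵍ ℬ) {M N : GrSMod.{w, v} 𝒜} (f : M ⟶ N) (b : B) (m : M.carrier) :
    indMap φ f (indMk φ M b m) = indMk φ N b (f.1 m) := rfl

theorem indMap_mem (φ : 𝒜 →+*ᵍ ℬ) {M N : GrSMod.{w, v} 𝒜} (f : M ⟶ N) {q : Gr}
    {x : IndCarrier φ M} (hx : x ∈ indPiece φ M q) : indMap φ f x ∈ indPiece φ N q := by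
  induction hx using AddSubgroup.closure_induction with
  | mem x hx =>
    obtain ⟨p', q', b, m, rfl, hb, hm, rfl⟩ := hx
    rw [indMap_mk]
    exact AddSubgroup.subset_closure ⟨p', q', b, f.1 m, rfl, hb, hom_piece f hm, rfl⟩
  | zero => rw [map_zero]; exact zero_mem _
  | add x y _ _ hx hy => rw [map_add]; exact add_mem hx hy
  | neg x _ hx => rw [map_neg]; exact neg_mem hx

/-- The induction functor along `φ`, taking `M` to the tensor product of `B` and `M` over `A`. -/
noncomputable def ind (φ : 𝒜 →+*ᵍ ℬ) : GrSMod.{w, v} 𝒜 ⥤ GrSMod.{w, max w v} ℬ where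
  obj M := indObj φ M
  map {M N} f := mkHom (M := indObj φ M) (N := indObj φ N) (indMap φ f).toAddMonoidHom
    (fun a m => map_smul (indMap φ f) a m)
    (fun _ _ hx => indMap_mem φ f hx)
  map_id M := by
    apply Subtype.ext
    ext x
    change indMap φ (𝟙 M) x = x
    induction x using ind_induction φ M with
    | zero => simp
    | add x y hx hy => rw [map_add, hx, hy]
    | mk p q b m hb hm => rfl
  map_comp {L M N} f g := by
    apply Subtype.ext
    ext x
    change indMap φ (f ≫ g) x = indMap φ g (indMap φ f x)
    induction x using ind_induction φ L with
    | zero => simp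
    | add x y hx hy => rw [map_add, hx, hy, map_add, map_add]
    | mk p q b m hb hm => rfl

end ResInd

section NatIso

variable {k : Type*} [CommRing k] {A : Type w} [Ring A] [Algebra k A]
  {𝒜 : Gr → Submodule k A}

/-- Natural isomorphism `S ≅ T` whose components are invertible elements of the homomorphism
spaces `evenHOM`: parity-preserving module isomorphisms that are finite sums of homogeneous maps
of arbitrary degrees, as are their inverses. -/
def NatIsoHOM {C : Type*} [Category C] (S T : C ⥤ GrSMod.{w, v} 𝒜) : Prop :=
  ∃ (η : ∀ M : C, (S.obj M).carrier →+ (T.obj M).carrier)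
    (θ : ∀ M : C, (T.obj M).carrier →+ (S.obj M).carrier),
    (∀ M, η M ∈ evenHOM (S.obj M) (T.obj M)) ∧ (∀ M, θ M ∈ evenHOM (T.obj M) (S.obj M)) ∧
    (∀ M x, θ M (η M x) = x) ∧ (∀ M y, η M (θ M y) = y) ∧
    ∀ {M N : C} (f : M ⟶ N) (x : (S.obj M).carrier),
      (T.map f).1 (η M x) = η N ((S.map f).1 x)

end NatIso

section Algebras

variable {k : Type u₁} [CommRing k] {F : Type u₂} [Ring F] [Algebra k F]

/-- An `ℕ`-graded Frobenius superalgebra `F` with its trace map `tr`, its Nakayama automorphism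
`ψ`, its top degree `δ`, a homogeneous basis `B` and the left dual basis. -/
structure FrobeniusSuperalgebra (𝒻 : Gr → Submodule k F) [GradedAlgebra 𝒻] where
  nonneg : ∀ p : Gr, p.1 < 0 → 𝒻 p = ⊥
  δ : ℕ
  tr : F →ₗ[k] k
  tr_homogeneous : ∀ (p : Gr) (a : F), a ∈ 𝒻 p → p ≠ ((δ : ℤ), 0) → tr a = 0
  /-- `a ↦ (g ↦ tr (g a))` is bijective. (The map with the sign `(-1) ^ (ā ḡ)` is obtained from
  this one by composing with the parity involution of `F`.) -/
  nondegenerate : Function.Bijective fun a : F => tr ∘ₗ LinearMap.mulRight k a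
  ψ : F ≃ₐ[k] F
  ψ_mem : ∀ (p : Gr) (a : F), a ∈ 𝒻 p → ψ a ∈ 𝒻 p
  nakayama : ∀ (p q : Gr) (a b : F), a ∈ 𝒻 p → b ∈ 𝒻 q →
    tr (a * b) = sgn (p.2 * q.2) • tr (b * ψ a)
  dim : ℕ
  B : Module.Basis (Fin dim) k F
  deg : Fin dim → Gr
  B_mem : ∀ b, B b ∈ 𝒻 (deg b)
  dual : Fin dim → F
  tr_dual : ∀ b c, tr (dual b * B c) = if b = c then 1 else 0

variable {𝒻 : Gr → Submodule k F} [GradedAlgebra 𝒻]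

namespace FrobeniusSuperalgebra

theorem eq_zero_of_tr (D : FrobeniusSuperalgebra 𝒻) {p : Gr} {a : F} (ha : a ∈ 𝒻 p)
    (h : ∀ b, tr D (a * D.B b) = 0) : a = 0 := by
  have h2 : ∀ g : F, D.tr (a * g) = 0 := by
    intro g
    have : D.tr ∘ₗ LinearMap.mulLeft k a = 0 := D.B.ext fun b => by simpa using h b
    simpa using congrArg (fun f => f g) this
  have h3 : D.ψ a = 0 := by
    apply D.nondegenerate.1
    ext g
    simp only [LinearMap.comp_apply, LinearMap.mulRight_apply, mul_zero, map_zero]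
    induction g using DirectSum.Decomposition.inductionOn 𝒻 with
    | zero => simp
    | add x y hx hy => rw [add_mul, map_add, hx, hy, add_zero]
    | @homogeneous q g =>
      have h4 := D.nakayama p q a g ha g.2
      rw [h2] at h4
      have h5 : sgn (p.2 * q.2) * sgn (p.2 * q.2) = 1 := by
        generalize p.2 * q.2 = e
        revert e; decide
      have := congrArg (fun z => sgn (p.2 * q.2) • z) h4
      rw [smul_smul, h5, one_smul, smul_zero] at this
      exact this.symm
  simpa using h3

theorem dual_mem (D : FrobeniusSuperalgebra 𝒻) (b : Fin D.dim) :
    D.dual b ∈ 𝒻 (((D.δ : ℤ), 0) - D.deg b) := by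
  have hI : DirectSum.IsInternal 𝒻 := DirectSum.Decomposition.isInternal 𝒻
  have key : ∀ (a : F) (r : Gr) (c : Fin D.dim), D.tr (comps hI a r * D.B c) =
      if r + D.deg c = ((D.δ : ℤ), 0) then D.tr (a * D.B c) else 0 := by
    intro a r c
    induction a using internal_induction hI with
    | zero => simp
    | add x y hx hy =>
      simp only [map_add, Finsupp.add_apply, add_mul, hx, hy]
      split_ifs <;> simp
    | hom q a ha =>
      rw [comps_of_mem hI ha, Finsupp.single_apply]
      have hm : a * D.B c ∈ 𝒻 (q + D.deg c) := SetLike.mul_mem_graded ha (D.B_mem c)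
      by_cases hq : q = r
      · subst hq
        rw [if_pos rfl]
        split_ifs with h
        · rfl
        · exact D.tr_homogeneous _ _ hm h
      · rw [if_neg hq, zero_mul, map_zero]
        split_ifs with h
        · refine (D.tr_homogeneous _ _ hm fun h' => hq ?_).symm
          exact add_right_cancel (h'.trans h.symm)
        · rfl
  have hz : ∀ r, r ≠ ((D.δ : ℤ), 0) - D.deg b → comps hI (D.dual b) r = 0 := by
    intro r hr
    refine D.eq_zero_of_tr (comps_mem hI _ r) fun c => ?_
    rw [key, D.tr_dual]
    split_ifs with h h'
    · subst h'; exact absurd (eq_sub_of_add_eq h) hr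
    · rfl
    · rfl
  have hs := comps_sum hI (D.dual b)
  rw [← hs]
  refine sum_mem fun r hr => ?_
  by_cases h : r = ((D.δ : ℤ), 0) - D.deg b
  · rw [← h]; exact comps_mem hI _ r
  · exact absurd (hz r h) (Finsupp.mem_support_iff.1 hr)

end FrobeniusSuperalgebra

/-- Generators of the affine wreath product algebra: `x i`, the element `f i a` which is `a` in
the `i`-th tensor factor of `F^{⊗ n}`, and the permutations. -/
inductive Gen (F : Type u₂) (n : ℕ) : Type u₂
  | x (i : Fin n) : Gen F n
  | f (i : Fin n) (a : F) : Gen F n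
  | s (π : Equiv.Perm (Fin n)) : Gen F n

variable (D : FrobeniusSuperalgebra 𝒻) (n : ℕ)

/-- The element `t i j`, the sum of the `b_i b^∨_j` over the basis, formed in any algebra with
given images `f i a` of the generators. -/
noncomputable def tElt {n : ℕ} {A : Type*} [Ring A] (f : Fin n → F → A) (i j : Fin n) : A :=
  ∑ b, f i (D.B b) * f j (D.dual b)

/-- The defining relations of the affine wreath product algebra. The relations `f_*` present the
tensor power `F^{⊗ n}` of the superalgebra `F`, the relations `s_*` the group algebra of the
symmetric group; the relation `sf` is `π 𝐟 = ^π𝐟 π`, and `fx_same`, `fx_ne` are `𝐟 x_i = x_i ψ_i(𝐟)`,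
each for the generators `𝐟 = a_i` of `F^{⊗ n}`. -/
inductive AffRel : FreeAlgebra k (Gen F n) → FreeAlgebra k (Gen F n) → Prop
  | x_comm (i j : Fin n) :
      AffRel (.ι k (.x i) * .ι k (.x j)) (.ι k (.x j) * .ι k (.x i))
  | f_add (i : Fin n) (a b : F) :
      AffRel (.ι k (.f i (a + b))) (.ι k (.f i a) + .ι k (.f i b))
  | f_smul (i : Fin n) (c : k) (a : F) :
      AffRel (.ι k (.f i (c • a))) (c • .ι k (.f i a))
  | f_one (i : Fin n) : AffRel (.ι k (.f i 1)) 1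
  | f_mul (i : Fin n) (a b : F) :
      AffRel (.ι k (.f i (a * b))) (.ι k (.f i a) * .ι k (.f i b))
  | f_comm (i j : Fin n) (hij : i ≠ j) (p q : Gr) (a b : F) (ha : a ∈ 𝒻 p) (hb : b ∈ 𝒻 q) :
      AffRel (.ι k (.f i a) * .ι k (.f j b))
        (sgn (p.2 * q.2) • (.ι k (.f j b) * .ι k (.f i a)))
  | s_one : AffRel (.ι k (.s 1)) 1
  | s_mul (π σ : Equiv.Perm (Fin n)) :
      AffRel (.ι k (.s (π * σ))) (.ι k (.s π) * .ι k (.s σ))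
  | fx_same (i : Fin n) (a : F) :
      AffRel (.ι k (.f i a) * .ι k (.x i)) (.ι k (.x i) * .ι k (.f i (D.ψ a)))
  | fx_ne (i j : Fin n) (hij : i ≠ j) (a : F) :
      AffRel (.ι k (.f j a) * .ι k (.x i)) (.ι k (.x i) * .ι k (.f j a))
  | sx_ne (i i' j : Fin n) (hi : (i : ℕ) + 1 = i') (hj : j ≠ i) (hj' : j ≠ i') :
      AffRel (.ι k (.s (Equiv.swap i i')) * .ι k (.x j))
        (.ι k (.x j) * .ι k (.s (Equiv.swap i i')))
  | sx (i i' : Fin n) (hi : (i : ℕ) + 1 = i') :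
      AffRel (.ι k (.s (Equiv.swap i i')) * .ι k (.x i))
        (.ι k (.x i') * .ι k (.s (Equiv.swap i i')) - tElt D (fun j a => .ι k (.f j a)) i i')
  | sf (π : Equiv.Perm (Fin n)) (i : Fin n) (a : F) :
      AffRel (.ι k (.s π) * .ι k (.f i a)) (.ι k (.f (π i) a) * .ι k (.s π))

/-- The affine wreath product algebra; it is `k` for `n = 0`. -/
def Aff : Type (max u₁ u₂) := RingQuot (AffRel D n)

noncomputable instance : Ring (Aff D n) := inferInstanceAs (Ring (RingQuot (AffRel D n)))

noncomputable instance : Algebra k (Aff D n) :=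
  inferInstanceAs (Algebra k (RingQuot (AffRel D n)))

/-- The quotient map. -/
noncomputable def affMk : FreeAlgebra k (Gen F n) →ₐ[k] Aff D n := RingQuot.mkAlgHom k (AffRel D n)

/-- The generators as elements of the affine wreath product algebra. -/
noncomputable def affGen (u : Gen F n) : Aff D n := affMk D n (.ι k u)

/-- The parameters `𝐂`: for `1 ≤ l ≤ θ`, where `θ` is the order of `ψ`, even elements
`c^{(l,1)}, …, c^{(l,e_l)}` of `F` of degree `l δ` that are fixed by `ψ` and satisfy
`g c = c ψ^l(g)`. The index `l : Fin θ` stands for `l + 1`. -/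
structure CycParam where
  e : Fin (orderOf D.ψ) → ℕ
  c : ∀ l, Fin (e l) → F
  c_mem : ∀ (l : Fin (orderOf D.ψ)) (j : Fin (e l)), c l j ∈ 𝒻 ((((l : ℕ) + 1) * D.δ : ℤ), 0)
  c_fixed : ∀ l j, D.ψ (c l j) = c l j
  c_comm : ∀ (l : Fin (orderOf D.ψ)) (j : Fin (e l)) (g : F), g * c l j = c l j * (D.ψ ^ ((l : ℕ) + 1)) g

variable {D}

/-- The level of `𝐂`. -/
noncomputable def CycParam.level (C : CycParam D) : ℕ := ∑ l : Fin (orderOf D.ψ), ((l : ℕ) + 1) * C.e l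

variable (C : CycParam D)

/-- The ordered product of the elements `x ^ l - f (c^{(l,j)})`. -/
noncomputable def chiElt {A : Type*} [Ring A] (x : A) (f : F → A) : A :=
  (List.ofFn fun l : Fin (orderOf D.ψ) => (List.ofFn fun j => x ^ ((l : ℕ) + 1) - f (C.c l j)).prod).prod

/-- The relation `χ = 0`, where `χ` is formed in the first variable (if there is one). -/
def CycRel (a b : Aff D n) : Prop :=
  ∃ h : 0 < n, a = chiElt C (affGen D n (.x ⟨0, h⟩)) (fun y => affGen D n (.f ⟨0, h⟩ y)) ∧ b = 0

/-- The cyclotomic wreath product algebra, the quotient of the affine wreath product algebra by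
the two-sided ideal generated by `χ`; it is `k` for `n = 0`. -/
def Cyc : Type (max u₁ u₂) := RingQuot (CycRel n C)

noncomputable instance : Ring (Cyc n C) := inferInstanceAs (Ring (RingQuot (CycRel n C)))

noncomputable instance : Algebra k (Cyc n C) :=
  inferInstanceAs (Algebra k (RingQuot (CycRel n C)))

/-- The quotient map. -/
noncomputable def cycMk : Aff D n →ₐ[k] Cyc n C := RingQuot.mkAlgHom k (CycRel n C)

/-- The generators as elements of the cyclotomic wreath product algebra. -/
noncomputable def gen (u : Gen F n) : Cyc n C := cycMk n C (affGen D n u)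

variable {n}

/-- The homogeneous generators and their bidegrees. -/
inductive HomGen (D : FrobeniusSuperalgebra 𝒻) : Gen F n → Gr → Prop
  | x (i : Fin n) : HomGen D (.x i) ((D.δ : ℤ), 0)
  | f (i : Fin n) (p : Gr) (a : F) (ha : a ∈ 𝒻 p) : HomGen D (.f i a) p
  | s (π : Equiv.Perm (Fin n)) : HomGen D (.s π) 0

/-- Products of homogeneous generators and their bidegrees. -/
inductive IsWord : Cyc n C → Gr → Prop
  | one : IsWord 1 0
  | mul {u : Gen F n} {p q : Gr} {y : Cyc n C} (hu : HomGen D u p) (hy : IsWord y q) :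
      IsWord (gen n C u * y) (p + q)

variable (n) in
/-- The grading of the cyclotomic wreath product algebra. -/
noncomputable def cycPiece (p : Gr) : Submodule k (Cyc n C) := Submodule.span k {y | IsWord C y p}

/-- Elements of an algebra that satisfy the defining relations of the affine wreath product
algebra. -/
structure IsRep (D : FrobeniusSuperalgebra 𝒻) {A : Type*} [Ring A] [Algebra k A]
    (g : Gen F n → A) : Prop where
  x_comm : ∀ i j, g (.x i) * g (.x j) = g (.x j) * g (.x i)
  f_add : ∀ i a b, g (.f i (a + b)) = g (.f i a) + g (.f i b)
  f_smul : ∀ i (c : k) a, g (.f i (c • a)) = c • g (.f i a)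
  f_one : ∀ i, g (.f i 1) = 1
  f_mul : ∀ i a b, g (.f i (a * b)) = g (.f i a) * g (.f i b)
  f_comm : ∀ i j, i ≠ j → ∀ p q a b, a ∈ 𝒻 p → b ∈ 𝒻 q →
    g (.f i a) * g (.f j b) = sgn (p.2 * q.2) • (g (.f j b) * g (.f i a))
  s_one : g (.s 1) = 1
  s_mul : ∀ π σ, g (.s (π * σ)) = g (.s π) * g (.s σ)
  fx_same : ∀ i a, g (.f i a) * g (.x i) = g (.x i) * g (.f i (D.ψ a))
  fx_ne : ∀ i j, i ≠ j → ∀ a, g (.f j a) * g (.x i) = g (.x i) * g (.f j a)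
  sx_ne : ∀ i i' j : Fin n, (i : ℕ) + 1 = i' → j ≠ i → j ≠ i' →
    g (.s (Equiv.swap i i')) * g (.x j) = g (.x j) * g (.s (Equiv.swap i i'))
  sx : ∀ i i' : Fin n, (i : ℕ) + 1 = i' → g (.s (Equiv.swap i i')) * g (.x i) =
    g (.x i') * g (.s (Equiv.swap i i')) - tElt D (fun j a => g (.f j a)) i i'
  sf : ∀ π i a, g (.s π) * g (.f i a) = g (.f (π i) a) * g (.s π)

theorem map_tElt {A A' : Type*} [Ring A] [Ring A'] (Φ : A →+* A') (f : Fin n → F → A)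
    (i j : Fin n) : Φ (tElt D f i j) = tElt D (fun i a => Φ (f i a)) i j := by
  simp [tElt]

theorem map_chiElt {A A' : Type*} [Ring A] [Ring A'] (Φ : A →+* A') (x : A) (f : F → A) :
    Φ (chiElt C x f) = chiElt C (Φ x) (fun a => Φ (f a)) := by
  simp only [chiElt, map_list_prod, List.map_ofFn, Function.comp_def, map_sub, map_pow]

theorem isRep_map {A A' : Type*} [Ring A] [Algebra k A] [Ring A'] [Algebra k A']
    (Φ : A →ₐ[k] A') {g : Gen F n → A} (h : IsRep D g) : IsRep D fun u => Φ (g u) where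
  x_comm i j := by rw [← map_mul, h.x_comm, map_mul]
  f_add i a b := by rw [h.f_add, map_add]
  f_smul i c a := by rw [h.f_smul, map_smul]
  f_one i := by rw [h.f_one, map_one]
  f_mul i a b := by rw [h.f_mul, map_mul]
  f_comm i j hij p q a b ha hb := by
    rw [← map_mul, h.f_comm i j hij p q a b ha hb, map_zsmul, map_mul]
  s_one := by rw [h.s_one, map_one]
  s_mul π σ := by rw [h.s_mul, map_mul]
  fx_same i a := by rw [← map_mul, h.fx_same, map_mul]
  fx_ne i j hij a := by rw [← map_mul, h.fx_ne i j hij, map_mul]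
  sx_ne i i' j hi hj hj' := by rw [← map_mul, h.sx_ne i i' j hi hj hj', map_mul]
  sx i i' hi := by
    rw [← map_mul, h.sx i i' hi, map_sub, map_mul]
    congr 1
    exact map_tElt (Φ : A →+* A') _ i i'
  sf π i a := by rw [← map_mul, h.sf, map_mul]

theorem lift_rel {A : Type*} [Ring A] [Algebra k A] {g : Gen F n → A} (h : IsRep D g)
    ⦃a b : FreeAlgebra k (Gen F n)⦄ (hab : AffRel D n a b) :
    FreeAlgebra.lift k g a = FreeAlgebra.lift k g b := by
  have ht : ∀ i j, FreeAlgebra.lift k g (tElt D (fun j a => .ι k (.f j a)) i j) =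
      tElt D (fun j a => g (.f j a)) i j := fun i j =>
    (map_tElt (FreeAlgebra.lift k g : FreeAlgebra k (Gen F n) →+* A) _ i j).trans
      (by simp)
  cases hab with
  | x_comm i j => simpa using h.x_comm i j
  | f_add i a b => simpa using h.f_add i a b
  | f_smul i c a => simpa using h.f_smul i c a
  | f_one i => simpa using h.f_one i
  | f_mul i a b => simpa using h.f_mul i a b
  | f_comm i j hij p q a b ha hb =>
    simpa [-zsmul_eq_mul] using h.f_comm i j hij p q a b ha hb
  | s_one => simpa using h.s_one
  | s_mul π σ => simpa using h.s_mul π σ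
  | fx_same i a => simpa using h.fx_same i a
  | fx_ne i j hij a => simpa using h.fx_ne i j hij a
  | sx_ne i i' j hi hj hj' => simpa using h.sx_ne i i' j hi hj hj'
  | sx i i' hi => simpa [ht] using h.sx i i' hi
  | sf π i a => simpa using h.sf π i a

theorem isRep_affGen : IsRep D (affGen D n) := by
  have key : ∀ {a b : FreeAlgebra k (Gen F n)}, AffRel D n a b → affMk D n a = affMk D n b :=
    fun h => RingQuot.mkAlgHom_rel k h
  have ht : ∀ i j, affMk D n (tElt D (fun j a => .ι k (.f j a)) i j) =
      tElt D (fun j a => affGen D n (.f j a)) i j := fun i j =>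
    map_tElt (affMk D n : FreeAlgebra k (Gen F n) →+* Aff D n) _ i j
  exact
  { x_comm := fun i j => by simpa [affGen] using key (.x_comm i j)
    f_add := fun i a b => by simpa [affGen] using key (.f_add i a b)
    f_smul := fun i c a => by simpa [affGen] using key (.f_smul i c a)
    f_one := fun i => by simpa [affGen] using key (.f_one i)
    f_mul := fun i a b => by simpa [affGen] using key (.f_mul i a b)
    f_comm := fun i j hij p q a b ha hb => by
      simpa [affGen, -zsmul_eq_mul] using key (.f_comm i j hij p q a b ha hb)
    s_one := by simpa [affGen] using key .s_one
    s_mul := fun π σ => by simpa [affGen] using key (.s_mul π σ)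
    fx_same := fun i a => by simpa [affGen] using key (.fx_same i a)
    fx_ne := fun i j hij a => by simpa [affGen] using key (.fx_ne i j hij a)
    sx_ne := fun i i' j hi hj hj' => by simpa [affGen] using key (.sx_ne i i' j hi hj hj')
    sx := fun i i' hi => by
      have := key (.sx i i' hi)
      rw [map_sub, ht] at this
      simpa [affGen] using this
    sf := fun π i a => by simpa [affGen] using key (.sf π i a) }

theorem isRep_gen : IsRep D (gen n C) := isRep_map (cycMk n C) isRep_affGen

theorem chi_gen (h : 0 < n) :
    chiElt C (gen n C (.x ⟨0, h⟩)) (fun y => gen n C (.f ⟨0, h⟩ y)) = 0 := by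
  have : cycMk n C (chiElt C (affGen D n (.x ⟨0, h⟩)) (fun y => affGen D n (.f ⟨0, h⟩ y))) =
      cycMk n C 0 := RingQuot.mkAlgHom_rel k (s := CycRel n C) ⟨h, rfl, rfl⟩
  rw [map_zero] at this
  rw [← this]
  exact (map_chiElt C (cycMk n C : Aff D n →+* Cyc n C) _ _).symm

/-- The homomorphism from the affine wreath product algebra with given values on the generators. -/
noncomputable def affLift {A : Type*} [Ring A] [Algebra k A] (g : Gen F n → A) (h : IsRep D g) :
    Aff D n →ₐ[k] A :=
  RingQuot.liftAlgHom k ⟨FreeAlgebra.lift k g, lift_rel h⟩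

theorem affLift_gen {A : Type*} [Ring A] [Algebra k A] (g : Gen F n → A) (h : IsRep D g)
    (u : Gen F n) : affLift g h (affGen D n u) = g u :=
  (RingQuot.liftAlgHom_mkAlgHom_apply k (FreeAlgebra.lift k g) (lift_rel h) (.ι k u)).trans
    (FreeAlgebra.lift_ι_apply g u)

/-- The homomorphism from the cyclotomic wreath product algebra with given values on the
generators. -/
noncomputable def cycLift {A : Type*} [Ring A] [Algebra k A] (g : Gen F n → A) (h : IsRep D g)
    (hχ : ∀ h : 0 < n, chiElt C (g (.x ⟨0, h⟩)) (fun y => g (.f ⟨0, h⟩ y)) = 0) :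
    Cyc n C →ₐ[k] A :=
  RingQuot.liftAlgHom k ⟨affLift g h, by
    rintro _ _ ⟨h0, rfl, rfl⟩
    rw [map_zero, ← hχ h0]
    refine (map_chiElt C (affLift g h : Aff D n →+* A) _ _).trans ?_
    simp [affLift_gen]⟩

theorem cycLift_gen {A : Type*} [Ring A] [Algebra k A] (g : Gen F n → A) (h : IsRep D g)
    (hχ : ∀ h : 0 < n, chiElt C (g (.x ⟨0, h⟩)) (fun y => g (.f ⟨0, h⟩ y)) = 0) (u : Gen F n) :
    cycLift C g h hχ (gen n C u) = g u :=
  (RingQuot.liftAlgHom_mkAlgHom_apply k (affLift g h) _ (affGen D n u)).trans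
    (affLift_gen g h u)

section Grading

theorem gen_f_zero (i : Fin n) : gen n C (.f i 0) = 0 := by
  have := (isRep_gen (n := n) C).f_add i 0 0
  rw [add_zero] at this
  exact left_eq_add.1 this

/-- The element `a` in the `i`-th tensor factor, split into homogeneous components. -/
noncomputable def splitF (i : Fin n) : F →+ AddMonoidAlgebra (Cyc n C) Gr :=
  (Finsupp.liftAddHom fun p : Gr => (AddMonoidAlgebra.singleAddHom p).comp
    (AddMonoidHom.mk' (fun a => gen n C (.f i a)) ((isRep_gen C).f_add i))).comp
    (comps (DirectSum.Decomposition.isInternal 𝒻))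

theorem splitF_of_mem (i : Fin n) {p : Gr} {a : F} (ha : a ∈ 𝒻 p) :
    splitF C i a = AddMonoidAlgebra.single p (gen n C (.f i a)) := by
  rw [splitF, AddMonoidHom.comp_apply, comps_of_mem _ ha, Finsupp.liftAddHom_apply_single]
  rfl

/-- Each homogeneous generator `u` of bidegree `p` is sent to `u` times the monomial `p`. -/
noncomputable def splitGen : Gen F n → AddMonoidAlgebra (Cyc n C) Gr
  | .x i => AddMonoidAlgebra.single ((D.δ : ℤ), 0) (gen n C (.x i))
  | .f i a => splitF C i a
  | .s π => AddMonoidAlgebra.single 0 (gen n C (.s π))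

theorem splitGen_of_hom {u : Gen F n} {p : Gr} (hu : HomGen D u p) :
    splitGen C u = AddMonoidAlgebra.single p (gen n C u) := by
  cases hu with
  | x i => rfl
  | f i p a ha => exact splitF_of_mem C i ha
  | s π => rfl

theorem split_tElt (i j : Fin n) : tElt D (fun j a => splitGen C (.f j a)) i j =
    AddMonoidAlgebra.single ((D.δ : ℤ), 0) (tElt D (fun j a => gen n C (.f j a)) i j) := by
  have : AddMonoidAlgebra.single ((D.δ : ℤ), (0 : ZMod 2))
      (tElt D (fun j a => gen n C (.f j a)) i j) = ∑ b, AddMonoidAlgebra.single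
        ((D.δ : ℤ), 0) (gen n C (.f i (D.B b)) * gen n C (.f j (D.dual b))) :=
    map_sum (AddMonoidAlgebra.singleAddHom ((D.δ : ℤ), (0 : ZMod 2))) _ _
  rw [this]
  refine Finset.sum_congr rfl fun b _ => ?_
  change splitGen C (.f i (D.B b)) * splitGen C (.f j (D.dual b)) = _
  rw [splitGen_of_hom C (.f i _ _ (D.B_mem b)), splitGen_of_hom C (.f j _ _ (D.dual_mem b)),
    AddMonoidAlgebra.single_mul_single, add_sub_cancel]

theorem isRep_splitGen : IsRep D (splitGen (n := n) C) := by
  have H := isRep_gen (n := n) C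
  have hx : ∀ i : Fin n, splitGen C (.x i) =
    AddMonoidAlgebra.single ((D.δ : ℤ), 0) (gen n C (.x i)) := fun i => rfl
  have hs : ∀ π : Equiv.Perm (Fin n), splitGen C (.s π) =
    AddMonoidAlgebra.single 0 (gen n C (.s π)) := fun i => rfl
  have hf : ∀ (i : Fin n) {p : Gr} {a : F}, a ∈ 𝒻 p → splitGen C (.f i a) =
    AddMonoidAlgebra.single p (gen n C (.f i a)) := fun i _ _ ha => splitF_of_mem C i ha
  have hadd : ∀ (i : Fin n) (a b : F), splitGen C (.f i (a + b)) =
    splitGen C (.f i a) + splitGen C (.f i b) := fun i a b => map_add (splitF C i) a b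
  have hzero : ∀ (i : Fin n), splitGen C (.f i 0) = 0 := fun i => map_zero (splitF C i)
  exact
  { x_comm := fun i j => by
      rw [hx, hx, AddMonoidAlgebra.single_mul_single, AddMonoidAlgebra.single_mul_single, H.x_comm]
    f_add := hadd
    f_smul := fun i c a => by
      induction a using DirectSum.Decomposition.inductionOn 𝒻 with
      | zero => rw [smul_zero, hzero, smul_zero]
      | add a b ha hb => rw [smul_add, hadd, hadd, ha, hb, smul_add]
      | homogeneous a =>
        rw [hf i (Submodule.smul_mem _ c a.2), hf i a.2, H.f_smul, AddMonoidAlgebra.smul_single]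
    f_one := fun i => by
      rw [hf i (SetLike.one_mem_graded 𝒻), H.f_one]; rfl
    f_mul := fun i a b => by
      induction a using DirectSum.Decomposition.inductionOn 𝒻 with
      | zero => rw [zero_mul, hzero, zero_mul]
      | add a a' h h' => rw [add_mul, hadd, h, h', hadd, add_mul]
      | homogeneous a =>
        induction b using DirectSum.Decomposition.inductionOn 𝒻 with
        | zero => rw [mul_zero, hzero, mul_zero]
        | add b b' h h' => rw [mul_add, hadd, h, h', hadd, mul_add]
        | homogeneous b =>
          rw [hf i (SetLike.mul_mem_graded a.2 b.2), hf i a.2, hf i b.2,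
            AddMonoidAlgebra.single_mul_single, H.f_mul]
    f_comm := fun i j hij p q a b ha hb => by
      rw [hf i ha, hf j hb, AddMonoidAlgebra.single_mul_single,
        AddMonoidAlgebra.single_mul_single, H.f_comm i j hij p q a b ha hb,
        AddMonoidAlgebra.smul_single, add_comm p q]
    s_one := by rw [hs, H.s_one]; rfl
    s_mul := fun π σ => by
      rw [hs, hs, hs, AddMonoidAlgebra.single_mul_single, H.s_mul, add_zero]
    fx_same := fun i a => by
      induction a using DirectSum.Decomposition.inductionOn 𝒻 with
      | zero => rw [map_zero, hzero, zero_mul, mul_zero]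
      | add a a' h h' => rw [map_add, hadd, hadd, add_mul, h, h', mul_add]
      | homogeneous a =>
        rw [hf i a.2, hf i (D.ψ_mem _ _ a.2), hx, AddMonoidAlgebra.single_mul_single,
          AddMonoidAlgebra.single_mul_single, H.fx_same, add_comm]
    fx_ne := fun i j hij a => by
      induction a using DirectSum.Decomposition.inductionOn 𝒻 with
      | zero => rw [hzero, zero_mul, mul_zero]
      | add a a' h h' => rw [hadd, add_mul, h, h', mul_add]
      | homogeneous a =>
        rw [hf j a.2, hx, AddMonoidAlgebra.single_mul_single,
          AddMonoidAlgebra.single_mul_single, H.fx_ne i j hij, add_comm]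
    sx_ne := fun i i' j hi hj hj' => by
      rw [hs, hx, AddMonoidAlgebra.single_mul_single, AddMonoidAlgebra.single_mul_single,
        H.sx_ne i i' j hi hj hj', add_comm]
    sx := fun i i' hi => by
      rw [hs, hx, hx, AddMonoidAlgebra.single_mul_single, AddMonoidAlgebra.single_mul_single,
        H.sx i i' hi, split_tElt, add_comm, AddMonoidAlgebra.single_sub, add_zero]
    sf := fun π i a => by
      induction a using DirectSum.Decomposition.inductionOn 𝒻 with
      | zero => rw [hzero, hzero, zero_mul, mul_zero]
      | add a a' h h' => rw [hadd, hadd, mul_add, h, h', add_mul]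
      | homogeneous a =>
        rw [hf i a.2, hf (π i) a.2, hs, AddMonoidAlgebra.single_mul_single,
          AddMonoidAlgebra.single_mul_single, H.sf, add_comm] }

theorem prod_ofFn_single {A : Type*} [Ring A] {m : ℕ} (d : Fin m → Gr) (y : Fin m → A) :
    (List.ofFn fun j => AddMonoidAlgebra.single (d j) (y j)).prod =
      AddMonoidAlgebra.single (∑ j, d j) (List.ofFn y).prod := by
  induction m with
  | zero => simp; rfl
  | succ m ih =>
    rw [List.ofFn_succ, List.prod_cons, ih, AddMonoidAlgebra.single_mul_single, Fin.sum_univ_succ,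
      List.ofFn_succ, List.prod_cons]

theorem single_npow {A : Type*} [Ring A] (d : Gr) (y : A) (m : ℕ) :
    (AddMonoidAlgebra.single d y) ^ m = AddMonoidAlgebra.single (m • d) (y ^ m) := by
  induction m with
  | zero => simp; rfl
  | succ m ih => rw [pow_succ, ih, AddMonoidAlgebra.single_mul_single, succ_nsmul, pow_succ]

theorem chi_splitGen (h : 0 < n) :
    chiElt C (splitGen C (.x ⟨0, h⟩)) (fun y => splitGen C (.f ⟨0, h⟩ y)) = 0 := by
  have h1 : ∀ (l : Fin (orderOf D.ψ)) (j : Fin (C.e l)),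
      splitGen C (.x ⟨0, h⟩) ^ ((l : ℕ) + 1) - splitGen C (.f ⟨0, h⟩ (C.c l j)) =
      AddMonoidAlgebra.single (((l : ℕ) + 1) • ((D.δ : ℤ), (0 : ZMod 2)))
        (gen n C (.x ⟨0, h⟩) ^ ((l : ℕ) + 1) - gen n C (.f ⟨0, h⟩ (C.c l j))) := by
    intro l j
    rw [splitGen_of_hom C (.f _ _ _ (C.c_mem l j)), splitGen_of_hom C (.x _), single_npow,
      AddMonoidAlgebra.single_sub]
    congr 2
    ext <;> simp
  unfold chiElt
  simp only [h1, prod_ofFn_single]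
  have := chi_gen (n := n) C h
  unfold chiElt at this
  rw [this, AddMonoidAlgebra.single_zero]

/-- The homomorphism sending each homogeneous generator `u` of bidegree `p` to `u` times the
monomial `p`. -/
noncomputable def split : Cyc n C →ₐ[k] AddMonoidAlgebra (Cyc n C) Gr :=
  cycLift C (splitGen C) (isRep_splitGen C) (chi_splitGen C)

theorem split_word {y : Cyc n C} {p : Gr} (hy : IsWord C y p) :
    split C y = AddMonoidAlgebra.single p y := by
  induction hy with
  | one => rw [map_one]; rfl
  | @mul u p q y hu hy ih =>
    rw [map_mul, ih, split, cycLift_gen, splitGen_of_hom C hu, AddMonoidAlgebra.single_mul_single]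

theorem word_mul {y z : Cyc n C} {p q : Gr} (hy : IsWord C y p) (hz : IsWord C z q) :
    IsWord C (y * z) (p + q) := by
  induction hy with
  | one => simpa using hz
  | mul hu hy ih => rw [mul_assoc, add_assoc]; exact .mul hu ih

theorem cycPiece_mul {y z : Cyc n C} {p q : Gr} (hy : y ∈ cycPiece n C p)
    (hz : z ∈ cycPiece n C q) : y * z ∈ cycPiece n C (p + q) := by
  refine Submodule.span_induction₂ (p := fun y z _ _ => y * z ∈ cycPiece n C (p + q))
    ?_ ?_ ?_ ?_ ?_ ?_ ?_ hy hz
  · exact fun y z hy hz => Submodule.subset_span (word_mul C hy hz)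
  · intro y _; rw [zero_mul]; exact zero_mem _
  · intro y _; rw [mul_zero]; exact zero_mem _
  · intro x y z _ _ _ hx hy; rw [add_mul]; exact add_mem hx hy
  · intro x y z _ _ _ hx hy; rw [mul_add]; exact add_mem hx hy
  · intro r x y _ _ h; rw [smul_mul_assoc]; exact Submodule.smul_mem _ r h
  · intro r x y _ _ h; rw [mul_smul_comm]; exact Submodule.smul_mem _ r h

theorem gen_hom_mem {u : Gen F n} {p : Gr} (hu : HomGen D u p) : gen n C u ∈ cycPiece n C p := by
  have := IsWord.mul (C := C) hu .one
  rw [mul_one, add_zero] at this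
  exact Submodule.subset_span this

theorem cycPiece_induction {motive : Cyc n C → Prop} (zero : motive 0)
    (hom : ∀ p, ∀ y ∈ cycPiece n C p, motive y)
    (add : ∀ x y, motive x → motive y → motive (x + y)) (y : Cyc n C) : motive y := by
  let S : Subalgebra k (Cyc n C) :=
    { carrier := ((⨆ p, cycPiece n C p : Submodule k (Cyc n C)) : Set (Cyc n C))
      mul_mem' := by
        intro a b ha hb
        refine Submodule.iSup_induction _ (motive := fun a => a * b ∈ ⨆ p, cycPiece n C p) ha ?_ ?_ ?_
        · intro p a ha
          refine Submodule.iSup_induction _ (motive := fun b => a * b ∈ ⨆ p, cycPiece n C p) hb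
            ?_ ?_ ?_
          · exact fun q b hb => Submodule.mem_iSup_of_mem (p + q) (cycPiece_mul C ha hb)
          · rw [mul_zero]; exact zero_mem _
          · intro b b' h h'; rw [mul_add]; exact add_mem h h'
        · rw [zero_mul]; exact zero_mem _
        · intro a a' h h'; rw [add_mul]; exact add_mem h h'
      add_mem' := fun ha hb => (⨆ p, cycPiece n C p).add_mem ha hb
      algebraMap_mem' := fun r => by
        rw [Algebra.algebraMap_eq_smul_one]
        exact Submodule.smul_mem _ r (Submodule.mem_iSup_of_mem (p := cycPiece n C) 0
          (Submodule.subset_span .one)) }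
  have hf : ∀ (i : Fin n) (a : F), gen n C (.f i a) ∈ S := by
    intro i a
    induction a using DirectSum.Decomposition.inductionOn 𝒻 with
    | zero => rw [gen_f_zero]; exact zero_mem _
    | add a b ha hb => rw [(isRep_gen C).f_add]; exact add_mem ha hb
    | homogeneous a => exact Submodule.mem_iSup_of_mem _ (gen_hom_mem C (.f i _ _ a.2))
  have hS : y ∈ S := by
    obtain ⟨y, rfl⟩ : ∃ z, cycMk n C z = y := RingQuot.mkAlgHom_surjective k (CycRel n C) y
    obtain ⟨y, rfl⟩ : ∃ z, affMk D n z = y := RingQuot.mkAlgHom_surjective k (AffRel D n) y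
    induction y using FreeAlgebra.induction with
    | grade0 r => rw [AlgHom.commutes, AlgHom.commutes]; exact S.algebraMap_mem r
    | grade1 u =>
      change gen n C u ∈ S
      cases u with
      | x i => exact Submodule.mem_iSup_of_mem _ (gen_hom_mem C (.x i))
      | f i a => exact hf i a
      | s π => exact Submodule.mem_iSup_of_mem _ (gen_hom_mem C (.s π))
    | mul a b ha hb => rw [map_mul, map_mul]; exact S.mul_mem ha hb
    | add a b ha hb => rw [map_add, map_add]; exact S.add_mem ha hb
  exact Submodule.iSup_induction _ (motive := motive) hS hom zero add

theorem split_of_mem {y : Cyc n C} {p : Gr} (hy : y ∈ cycPiece n C p) :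
    split C y = AddMonoidAlgebra.single p y := by
  induction hy using Submodule.span_induction with
  | mem y hy => exact split_word C hy
  | zero => simp
  | add x y _ _ hx hy => rw [map_add, hx, hy, AddMonoidAlgebra.single_add]
  | smul r x _ hx => rw [map_smul, hx, AddMonoidAlgebra.smul_single]

variable (n) in
theorem cyc_internal : DirectSum.IsInternal (cycPiece n C) := by
  refine internal_of_components _
    ((AddMonoidAlgebra.coeffAddEquiv).toAddMonoidHom.comp (split C).toRingHom.toAddMonoidHom)
    ?_ ?_ ?_
  · intro p y hy
    change (split C y).coeff = _
    rw [split_of_mem C hy]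
    rfl
  · intro y p
    change (split C y).coeff p ∈ _
    induction y using cycPiece_induction C with
    | zero => simp
    | hom q y hy =>
      rw [split_of_mem C hy, AddMonoidAlgebra.coeff_single, Finsupp.single_apply]
      split_ifs with h
      · exact h ▸ hy
      · exact zero_mem _
    | add x y hx hy => rw [map_add]; exact add_mem hx hy
  · intro y
    change ((split C y).coeff.sum fun _ y => y) = y
    induction y using cycPiece_induction C with
    | zero => simp
    | hom q y hy => rw [split_of_mem C hy]; simp
    | add x y hx hy =>
      rw [map_add, AddMonoidAlgebra.coeff_add, Finsupp.sum_add_index' (by simp) (by simp), hx, hy]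

noncomputable instance : GradedAlgebra (cycPiece n C) where
  one_mem := Submodule.subset_span .one
  mul_mem _ _ _ _ hy hz := cycPiece_mul C hy hz
  toDecomposition := (cyc_internal n C).chooseDecomposition

/-- The permutation of `Fin (n + 1)` that extends `π` and fixes the last element. -/
noncomputable def extPerm (π : Equiv.Perm (Fin n)) : Equiv.Perm (Fin (n + 1)) :=
  π.viaEmbedding Fin.castSuccEmb

theorem extPerm_castSucc (π : Equiv.Perm (Fin n)) (i : Fin n) :
    extPerm π i.castSucc = (π i).castSucc :=
  π.viaEmbedding_apply Fin.castSuccEmb i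

theorem extPerm_last (π : Equiv.Perm (Fin n)) : extPerm π (Fin.last n) = Fin.last n := by
  refine π.viaEmbedding_apply_of_notMem Fin.castSuccEmb _ ?_
  rintro ⟨i, hi⟩
  exact (Fin.castSucc_lt_last i).ne hi

theorem extPerm_one : extPerm (1 : Equiv.Perm (Fin n)) = 1 :=
  map_one (Equiv.Perm.viaEmbeddingHom Fin.castSuccEmb)

theorem extPerm_mul (π σ : Equiv.Perm (Fin n)) : extPerm (π * σ) = extPerm π * extPerm σ :=
  map_mul (Equiv.Perm.viaEmbeddingHom Fin.castSuccEmb) π σ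

theorem extPerm_swap (i j : Fin n) :
    extPerm (Equiv.swap i j) = Equiv.swap i.castSucc j.castSucc := by
  ext a : 1
  induction a using Fin.lastCases with
  | last =>
    rw [extPerm_last, Equiv.swap_apply_of_ne_of_ne] <;>
      exact (Fin.castSucc_lt_last _).ne'
  | cast a =>
    rw [extPerm_castSucc]
    exact (Function.Injective.swap_apply (Fin.castSucc_injective n) i j a).symm

/-- The values on generators of the map from level `n` to level `n + 1`. -/
noncomputable def inclGen : Gen F n → Cyc (n + 1) C
  | .x i => gen (n + 1) C (.x i.castSucc)
  | .f i a => gen (n + 1) C (.f i.castSucc a)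
  | .s π => gen (n + 1) C (.s (extPerm π))

theorem isRep_inclGen : IsRep D (inclGen (n := n) C) := by
  have H := isRep_gen (n := n + 1) C
  have hne : ∀ {i j : Fin n}, i ≠ j → i.castSucc ≠ j.castSucc := fun h h' =>
    h (Fin.castSucc_injective n h')
  exact
  { x_comm := fun i j => H.x_comm _ _
    f_add := fun i => H.f_add _
    f_smul := fun i => H.f_smul _
    f_one := fun i => H.f_one _
    f_mul := fun i => H.f_mul _
    f_comm := fun i j hij => H.f_comm _ _ (hne hij)
    s_one := by
      change gen (n + 1) C (.s (extPerm 1)) = 1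
      rw [extPerm_one, H.s_one]
    s_mul := fun π σ => by
      change gen (n + 1) C (.s (extPerm (π * σ))) = _
      rw [extPerm_mul, H.s_mul]
      rfl
    fx_same := fun i => H.fx_same _
    fx_ne := fun i j hij => H.fx_ne _ _ (hne hij)
    sx_ne := fun i i' j hi hj hj' => by
      change gen (n + 1) C (.s (extPerm (Equiv.swap i i'))) * _ =
        _ * gen (n + 1) C (.s (extPerm (Equiv.swap i i')))
      rw [extPerm_swap]
      exact H.sx_ne _ _ _ hi (hne hj) (hne hj')
    sx := fun i i' hi => by
      change gen (n + 1) C (.s (extPerm (Equiv.swap i i'))) * _ =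
        _ * gen (n + 1) C (.s (extPerm (Equiv.swap i i'))) - _
      rw [extPerm_swap]
      exact H.sx _ _ hi
    sf := fun π i a => by
      change gen (n + 1) C (.s (extPerm π)) * gen (n + 1) C (.f i.castSucc a) =
        gen (n + 1) C (.f (π i).castSucc a) * gen (n + 1) C (.s (extPerm π))
      rw [H.sf, extPerm_castSucc] }

variable (n) in
/-- The homomorphism from level `n` to level `n + 1` sending `x_i`, `a_i`, `π` to `x_i`, `a_i`,
`π`. -/
noncomputable def inclAlg : Cyc n C →ₐ[k] Cyc (n + 1) C :=
  cycLift C (inclGen C) (isRep_inclGen C) (fun _ => chi_gen (n := n + 1) C n.succ_pos)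

theorem inclAlg_gen (u : Gen F n) : inclAlg n C (gen n C u) = inclGen C u :=
  cycLift_gen C _ _ _ u

theorem inclAlg_mem {p : Gr} {y : Cyc n C} (hy : y ∈ cycPiece n C p) :
    inclAlg n C y ∈ cycPiece (n + 1) C p := by
  induction hy using Submodule.span_induction with
  | zero => rw [map_zero]; exact zero_mem _
  | add x y _ _ hx hy => rw [map_add]; exact add_mem hx hy
  | smul r x _ hx => rw [map_smul]; exact Submodule.smul_mem _ r hx
  | mem y hy =>
    induction hy with
    | one => rw [map_one]; exact Submodule.subset_span .one
    | @mul u p q y hu hy ih =>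
      rw [map_mul]
      refine cycPiece_mul C ?_ ih
      rw [inclAlg_gen]
      cases hu with
      | x i => exact gen_hom_mem C (.x _)
      | f i p a ha => exact gen_hom_mem C (.f _ _ _ ha)
      | s π => exact gen_hom_mem C (.s _)

variable (n) in
/-- The homomorphism from level `n` to level `n + 1` as a homomorphism of graded superalgebras. -/
noncomputable def incl : cycPiece n C →+*ᵍ cycPiece (n + 1) C where
  toRingHom := (inclAlg n C).toRingHom
  map_mem hy := inclAlg_mem C hy

end Grading

section Functors

/-- Graded supermodules over the cyclotomic wreath product algebra. -/
abbrev CycMod (n : ℕ) (C : CycParam D) : Type (max u₁ u₂ v + 1) :=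
  GrSMod.{max u₁ u₂, max u₁ u₂ v} (cycPiece n C)

/-- Restriction from level `n + 1` to level `n`. -/
noncomputable def cycRes (n : ℕ) (C : CycParam D) :
    CycMod.{u₁, u₂, v} (n + 1) C ⥤ CycMod.{u₁, u₂, v} n C :=
  res (incl n C)

/-- Induction from level `n` to level `n + 1`. -/
noncomputable def cycInd (n : ℕ) (C : CycParam D) :
    CycMod.{u₁, u₂, v} n C ⥤ CycMod.{u₁, u₂, v} (n + 1) C :=
  ind (incl n C)

/-- The functor `id^{⊕ a} ⊕ Π^{⊕ b} ⊕ T`. -/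
noncomputable def mackeySum {n : ℕ} {C : CycParam D} (a b : ℕ)
    (T : CycMod.{u₁, u₂, v} n C ⥤ CycMod.{u₁, u₂, v} n C) :
    CycMod.{u₁, u₂, v} n C ⥤ CycMod.{u₁, u₂, v} n C :=
  dsumFunctor (Sum.elim (fun _ : Fin a => 𝟭 _)
    (Sum.elim (fun _ : Fin b => parityShift) (fun _ : Unit => T)))

end Functors

end Algebras

end AWP

open AWP

namespace AWP

/-! ### Dual bases and the elements `t i j`. -/

section FrobeniusIdentities

variable {k : Type u₁} [CommRing k] {F : Type u₂} [Ring F] [Algebra k F]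
  {𝒻 : Gr → Submodule k F} [GradedAlgebra 𝒻]

/-! Write A_n for the cyclotomic algebra on n letters and d for the level. Everything follows from
one statement about bimodules: as a right A_n-module, A_{n+1} is free on the elements x^a b with a <
d and b in B, formed in the last letter, together with the elements g s, where s is the last simple
transposition and g runs over a generating family of the right A_{n-1}-module A_n
(`rightComb_mackeyElt_bijective`). After tensoring with M, each x^a b contributes one copy of M.
Since x^a b commutes with A_n up to the sign given by the parity of b, this copy is M or ΠM
according to that parity. Since s commutes with A_{n-1}, the elements g s contribute the image of u
⊗ m ↦ u s ⊗ m, defined on Ind Res M. The components are homogeneous, of the degrees of x^a b and of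
s, and so are the components of the inverse.

Generation of A_{n+1} by the family is a rewriting argument (`swapDeg_level_eq_top`,
`cosetSpan_eq_top`, `rightComb_mackeyElt_surjective`): permutations and elements of A_n are moved
past x^a b, and the relation χ = 0 removes the powers of x from exponent d on.

Independence is obtained by counting. Every A_n is a finite k-module, and a surjective endomorphism
of a finite module is injective. Hence it suffices that A_{n+1} maps k-linearly onto a power of A_n
with as many factors as the family has members, namely (n+1) d dim F (`exists_surjective_cyc`). No
basis of the affine algebra is needed.

That map is the orbit map of a cyclic module. The elements y_i = x_i - J_i, with J_i the
Jucys–Murphy elements, are permuted by the symmetric group, and commutativity of the x_i becomes a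
relation for [y_i, y_j] (`YRep.isRep`, `IsRep.yRep`). A_n and the affine algebra of one letter act
on the polynomials E in one variable X with coefficients in F ⊗ A_n. The equivariant functions from
S_{n+1} to E carry an action of the affine algebra on n+1 letters (`coind_yRep`). The values of all
χ(y_j) form the image of a single operator (`chiElt_mem_range`), which agrees with X^d up to lower
degree. Division with remainder (`isCompl_range_of_filtration`) identifies the quotient by this
image with the functions whose values have degree below d, and these amount to (n+1) d dim F copies
of A_n. -/

theorem sgn_mul_self : ∀ a : ZMod 2, sgn a * sgn a = 1 := by decide

namespace FrobeniusSuperalgebra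

variable (D : FrobeniusSuperalgebra 𝒻)

/-- The vectors of traces against the basis exhaust k^dim, since the dual basis gives the unit
vectors; a surjective endomorphism of k^dim is injective. In contrast to `eq_zero_of_tr`,
homogeneity of `a` plays no role. -/
theorem eq_zero_of_tr_mul_basis {a : F} (h : ∀ b, D.tr (a * D.B b) = 0) : a = 0 := by
  let Λ : F →ₗ[k] (Fin D.dim → k) := LinearMap.pi fun b => D.tr ∘ₗ LinearMap.mulRight k (D.B b)
  have hsurj : Function.Surjective Λ := by
    intro v
    refine ⟨∑ c, v c • D.dual c, ?_⟩
    funext b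
    simp [Λ, D.tr_dual]
  have hinj : Function.Injective (Λ ∘ₗ D.B.equivFun.symm.toLinearMap) :=
    OrzechProperty.injective_of_surjective_endomorphism _
      (hsurj.comp D.B.equivFun.symm.surjective)
  have h0 : Λ a = 0 := funext h
  have h1 : D.B.equivFun a = 0 := by
    apply hinj
    rw [map_zero]
    simpa using h0
  simpa using h1

theorem sum_tr_dual_smul (a : F) : ∑ c, D.tr (D.dual c * a) • D.B c = a := by
  have h : ∀ c, D.tr (D.dual c * a) = D.B.repr a c := by
    intro c
    conv_lhs => rw [← D.B.sum_repr a]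
    simp only [Finset.mul_sum, mul_smul_comm, map_sum, map_smul, D.tr_dual, smul_eq_mul,
      mul_ite, mul_one, mul_zero, Finset.sum_ite_eq, Finset.mem_univ, if_true]
  simp only [h, D.B.sum_repr]

theorem sum_tr_basis_smul (a : F) : ∑ c, D.tr (a * D.B c) • D.dual c = a := by
  rw [← sub_eq_zero]
  refine D.eq_zero_of_tr_mul_basis fun b => ?_
  simp [sub_mul, Finset.sum_mul, D.tr_dual]

theorem tr_eq_zero_of_parity {p : Gr} {a : F} (ha : a ∈ 𝒻 p) (h : p.2 ≠ 0) : D.tr a = 0 :=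
  D.tr_homogeneous p a ha fun h' => h (by rw [h'])

/-- The trace is even, so b^∨ has the parity of b, and the Nakayama sign depends only on the
parities of a, b and c. -/
theorem dual_mul_basis_parity (b c : Fin D.dim) (a : F) {p : Gr} (ha : a ∈ 𝒻 p) :
    D.tr (a * (D.dual b * D.B c)) =
      sgn (p.2 * ((D.deg b).2 + (D.deg c).2)) • D.tr (D.dual b * (D.B c * D.ψ a)) := by
  rw [D.nakayama _ _ _ _ ha (SetLike.mul_mem_graded (D.dual_mem b) (D.B_mem c)), mul_assoc]
  congr 3
  simp [sub_eq_add_neg]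

end FrobeniusSuperalgebra

variable {A : Type*} [Ring A] [Algebra k A]

/-- Images of the elements `a` in the tensor factors, satisfying the relations of the
super tensor power of `F`. -/
structure FRep (𝒻 : Gr → Submodule k F) {ι : Type*} (f : ι → F → A) : Prop where
  f_add : ∀ i a b, f i (a + b) = f i a + f i b
  f_smul : ∀ i (c : k) a, f i (c • a) = c • f i a
  f_one : ∀ i, f i 1 = 1
  f_mul : ∀ i a b, f i (a * b) = f i a * f i b
  f_comm : ∀ i j, i ≠ j → ∀ p q a b, a ∈ 𝒻 p → b ∈ 𝒻 q →
    f i a * f j b = sgn (p.2 * q.2) • (f j b * f i a)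

namespace FRep

variable {n : ℕ} {f : Fin n → F → A}

/-- The `i`-th factor as an algebra homomorphism. -/
def hom (H : FRep 𝒻 f) (i : Fin n) : F →ₐ[k] A :=
  AlgHom.ofLinearMap ⟨⟨f i, H.f_add i⟩, H.f_smul i⟩ (H.f_one i) (H.f_mul i)

theorem f_sum (H : FRep 𝒻 f) (i : Fin n) {κ : Type*} (s : Finset κ) (a : κ → F) :
    f i (∑ b ∈ s, a b) = ∑ b ∈ s, f i (a b) := map_sum (H.hom i) a s

/-- A relation that is linear in `a` may be checked on homogeneous elements. -/
theorem ext_homogeneous {M : Type*} [AddCommGroup M] [Module k M] {φ χ : F →ₗ[k] M}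
    (h : ∀ p, ∀ a ∈ 𝒻 p, φ a = χ a) (a : F) : φ a = χ a := by
  induction a using DirectSum.Decomposition.inductionOn 𝒻 with
  | zero => simp
  | add a b ha hb => rw [map_add, map_add, ha, hb]
  | homogeneous a => exact h _ _ a.2

variable (D : FrobeniusSuperalgebra 𝒻) (H : FRep 𝒻 f) {i j l : Fin n}
include H

/-- Expanding a b in the basis on the left and c^∨ a in the dual basis on the right gives the same
coefficient tr(c^∨ a b) at c_i b^∨_j. -/
theorem f_mul_tElt_left (a : F) : f i a * tElt D f i j = tElt D f i j * f j a := by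
  simp only [tElt, Finset.mul_sum, Finset.sum_mul]
  have h1 : ∀ b, f i a * (f i (D.B b) * f j (D.dual b)) =
      ∑ c, D.tr (D.dual c * (a * D.B b)) • (f i (D.B c) * f j (D.dual b)) := by
    intro b
    rw [← mul_assoc, ← H.f_mul]
    conv_lhs => rw [← D.sum_tr_dual_smul (a * D.B b)]
    simp only [H.f_sum, H.f_smul, Finset.sum_mul, smul_mul_assoc]
  have h2 : ∀ c, f i (D.B c) * f j (D.dual c) * f j a =
      ∑ b, D.tr (D.dual c * (a * D.B b)) • (f i (D.B c) * f j (D.dual b)) := by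
    intro c
    rw [mul_assoc, ← H.f_mul]
    conv_lhs => rw [← D.sum_tr_basis_smul (D.dual c * a)]
    simp only [H.f_sum, H.f_smul, Finset.mul_sum, mul_smul_comm, mul_assoc]
  simp only [h1, h2]
  exact Finset.sum_comm

/-- The same comparison of coefficients, with the Nakayama automorphism carrying a around b^∨ c
under the trace. Its sign and the sign of moving a past b combine to the sign of moving ψ(a) past
c^∨ on the other side. -/
theorem f_mul_tElt_right (hij : i ≠ j) (a : F) :
    f j a * tElt D f i j = tElt D f i j * f i (D.ψ a) := by
  refine ext_homogeneous (𝒻 := 𝒻)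
    (φ := LinearMap.mulRight k (tElt D f i j) ∘ₗ (H.hom j).toLinearMap)
    (χ := LinearMap.mulLeft k (tElt D f i j) ∘ₗ (H.hom i).toLinearMap ∘ₗ D.ψ.toLinearMap)
    (fun p a ha => ?_) a
  change f j a * tElt D f i j = tElt D f i j * f i (D.ψ a)
  simp only [tElt, Finset.mul_sum, Finset.sum_mul]
  have hs : ∀ (b c : Fin D.dim), sgn (p.2 * (D.deg b).2) *
      sgn (p.2 * ((D.deg b).2 + (D.deg c).2)) = sgn (p.2 * (D.deg c).2) := by
    intro b c
    generalize (D.deg b).2 = x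
    generalize (D.deg c).2 = y
    generalize p.2 = z
    revert x y z
    decide
  have h1 : ∀ b, f j a * (f i (D.B b) * f j (D.dual b)) =
      ∑ c, sgn (p.2 * (D.deg c).2) • D.tr (D.dual b * (D.B c * D.ψ a)) •
        (f i (D.B b) * f j (D.dual c)) := by
    intro b
    rw [← mul_assoc, H.f_comm j i hij.symm _ _ _ _ ha (D.B_mem b), smul_mul_assoc, mul_assoc,
      ← H.f_mul]
    conv_lhs => rw [← D.sum_tr_basis_smul (a * D.dual b)]
    simp only [H.f_sum, H.f_smul, Finset.mul_sum, mul_smul_comm, mul_assoc, Finset.smul_sum]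
    refine Finset.sum_congr rfl fun c _ => ?_
    rw [D.dual_mul_basis_parity b c a ha, smul_assoc, smul_smul, hs]
  have h2 : ∀ c, f i (D.B c) * f j (D.dual c) * f i (D.ψ a) =
      ∑ b, sgn (p.2 * (D.deg c).2) • D.tr (D.dual b * (D.B c * D.ψ a)) •
        (f i (D.B b) * f j (D.dual c)) := by
    intro c
    rw [mul_assoc, H.f_comm j i hij.symm _ _ _ _ (D.dual_mem c) (D.ψ_mem _ _ ha), mul_smul_comm,
      ← mul_assoc, ← H.f_mul]
    conv_lhs => rw [← D.sum_tr_dual_smul (D.B c * D.ψ a)]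
    simp only [H.f_sum, H.f_smul, Finset.sum_mul, smul_mul_assoc, Finset.smul_sum]
    refine Finset.sum_congr rfl fun b _ => ?_
    congr 2
    simp [mul_comm]
  simp only [h1, h2]
  exact Finset.sum_comm

/-- b and b^∨ have the same parity, so the two signs cancel in each summand. -/
theorem f_mul_tElt (hi : l ≠ i) (hj : l ≠ j) (a : F) :
    f l a * tElt D f i j = tElt D f i j * f l a := by
  refine ext_homogeneous (𝒻 := 𝒻)
    (φ := LinearMap.mulRight k (tElt D f i j) ∘ₗ (H.hom l).toLinearMap)
    (χ := LinearMap.mulLeft k (tElt D f i j) ∘ₗ (H.hom l).toLinearMap)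
    (fun p a ha => ?_) a
  change f l a * tElt D f i j = tElt D f i j * f l a
  simp only [tElt, Finset.mul_sum, Finset.sum_mul]
  refine Finset.sum_congr rfl fun b _ => ?_
  rw [← mul_assoc, H.f_comm l i hi _ _ _ _ ha (D.B_mem b), smul_mul_assoc, mul_assoc,
    H.f_comm l j hj _ _ _ _ ha (D.dual_mem b), mul_smul_comm, smul_smul, mul_assoc]
  have : sgn (p.2 * (D.deg b).2) * sgn (p.2 * (((D.δ : ℤ), 0) - D.deg b : Gr).2) = 1 := by
    simp [sub_eq_add_neg, sgn_mul_self]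
  rw [this, one_smul]

/-- The image of `t i j` under `ψ` in the `j`-th factor is `t j i`. -/
theorem sum_f_psi_dual (hij : i ≠ j) :
    ∑ b, f i (D.B b) * f j (D.ψ (D.dual b)) = tElt D f j i := by
  have h1 : ∀ c, f i (D.B c) * f j (D.ψ (D.dual c)) = ∑ b, D.tr (D.dual b * D.ψ (D.dual c)) •
      (f i (D.B c) * f j (D.B b)) := by
    intro c
    conv_lhs => rw [← D.sum_tr_dual_smul (D.ψ (D.dual c))]
    simp only [H.f_sum, H.f_smul, Finset.mul_sum, mul_smul_comm]
  have h2 : ∀ b, f j (D.B b) * f i (D.dual b) = ∑ c, D.tr (D.dual b * D.ψ (D.dual c)) •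
      (f i (D.B c) * f j (D.B b)) := by
    intro b
    rw [H.f_comm j i hij.symm _ _ _ _ (D.B_mem b) (D.dual_mem b)]
    conv_lhs => rw [← D.sum_tr_dual_smul (D.dual b)]
    simp only [H.f_sum, H.f_smul, Finset.sum_mul, smul_mul_assoc, Finset.smul_sum]
    refine Finset.sum_congr rfl fun c _ => ?_
    have h3 := D.nakayama _ _ _ _ (D.dual_mem c) (D.dual_mem b)
    rw [← smul_assoc]
    congr 1
    -- The trace is even, so for b and c of different parities both coefficients vanish; otherwise
    -- the Nakayama sign and the commutation sign are equal.
    by_cases hbc : (D.deg b).2 = (D.deg c).2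
    · rw [h3, smul_smul, hbc]
      simp [sub_eq_add_neg, hbc, sgn_mul_self]
    · have hp : ((((D.δ : ℤ), 0) - D.deg c : Gr) + (((D.δ : ℤ), 0) - D.deg b)).2 ≠ 0 := by
        simp only [Prod.snd_add, Prod.snd_sub]
        generalize (D.deg b).2 = x at *
        generalize (D.deg c).2 = y at *
        revert x y; decide
      have hp' : ((((D.δ : ℤ), 0) - D.deg b : Gr) + (((D.δ : ℤ), 0) - D.deg c)).2 ≠ 0 := by
        rwa [add_comm]
      rw [D.tr_eq_zero_of_parity (SetLike.mul_mem_graded (D.dual_mem c) (D.dual_mem b)) hp,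
        D.tr_eq_zero_of_parity (SetLike.mul_mem_graded (D.dual_mem b)
          (D.ψ_mem _ _ (D.dual_mem c))) hp', smul_zero]
  simp only [tElt, h1, h2]
  exact Finset.sum_comm

/-- The components b^∨_i of the first factor pass through `t i j` into the tensor factor j, while
b_l commutes with it. Together with the next two lemmas this covers all products needed for the
commutation of the Jucys–Murphy elements. -/
theorem tElt_mul_tElt_left (hi : l ≠ i) (hj : l ≠ j) :
    tElt D f l i * tElt D f i j = tElt D f i j * tElt D f l j := by
  conv_lhs => rw [tElt.eq_def D f l i, Finset.sum_mul]
  conv_rhs => rw [tElt.eq_def D f l j, Finset.mul_sum]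
  refine Finset.sum_congr rfl fun b _ => ?_
  have h := H.f_mul_tElt_left D (i := i) (j := j) (D.dual b)
  have h' := H.f_mul_tElt D (l := l) hi hj (D.B b)
  rw [mul_assoc, h, ← mul_assoc, h', mul_assoc]

theorem tElt_mul_tElt_right (hl : i ≠ l) (hj : i ≠ j) :
    tElt D f l j * tElt D f j i = tElt D f l i * tElt D f l j := by
  conv_lhs => rw [tElt.eq_def D f j i, Finset.mul_sum]
  conv_rhs => rw [tElt.eq_def D f l i, Finset.sum_mul]
  refine Finset.sum_congr rfl fun b _ => ?_
  have h := H.f_mul_tElt_left D (i := l) (j := j) (D.B b)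
  have h' := H.f_mul_tElt D (l := i) hl hj (D.dual b)
  rw [← mul_assoc, ← h, mul_assoc, mul_assoc, h']

theorem tElt_comm {i' j' : Fin n} (h1 : i ≠ i') (h2 : i ≠ j') (h3 : j ≠ i') (h4 : j ≠ j') :
    tElt D f i j * tElt D f i' j' = tElt D f i' j' * tElt D f i j := by
  conv_lhs => rw [tElt.eq_def D f i j, Finset.sum_mul]
  conv_rhs => rw [tElt.eq_def D f i j, Finset.mul_sum]
  refine Finset.sum_congr rfl fun b _ => ?_
  rw [mul_assoc, H.f_mul_tElt D h3 h4, ← mul_assoc, H.f_mul_tElt D h1 h2, mul_assoc]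

end FRep

end FrobeniusIdentities

/-! ### Jucys–Murphy elements and generators permuted by the symmetric group. -/

section EquivariantGenerators

variable {k : Type u₁} [CommRing k] {F : Type u₂} [Ring F] [Algebra k F]
  {𝒻 : Gr → Submodule k F} [GradedAlgebra 𝒻] {A : Type*} [Ring A] [Algebra k A] {n : ℕ}

/-- Elements satisfying the relations of the semidirect product of `F^{⊗ n}` and the symmetric
group. -/
structure WreathRep (𝒻 : Gr → Submodule k F) (f : Fin n → F → A) (s : Equiv.Perm (Fin n) → A) :
    Prop extends FRep 𝒻 f where
  s_one : s 1 = 1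
  s_mul : ∀ π σ, s (π * σ) = s π * s σ
  sf : ∀ π i a, s π * f i a = f (π i) a * s π

/-- The Jucys–Murphy elements. -/
noncomputable def jm (D : FrobeniusSuperalgebra 𝒻) (f : Fin n → F → A)
    (s : Equiv.Perm (Fin n) → A) (i : Fin n) : A :=
  ∑ l ∈ Finset.Iio i, tElt D f l i * s (Equiv.swap l i)

namespace WreathRep

variable {f : Fin n → F → A} {s : Equiv.Perm (Fin n) → A} (D : FrobeniusSuperalgebra 𝒻)
  (H : WreathRep 𝒻 f s)
include H

theorem s_mul_tElt (π : Equiv.Perm (Fin n)) (i j : Fin n) :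
    s π * tElt D f i j = tElt D f (π i) (π j) * s π := by
  simp only [tElt, Finset.mul_sum, Finset.sum_mul]
  refine Finset.sum_congr rfl fun b _ => ?_
  rw [← mul_assoc, H.sf, mul_assoc, H.sf, mul_assoc]

theorem s_swap_mul_self (i j : Fin n) : s (Equiv.swap i j) * s (Equiv.swap i j) = 1 := by
  rw [← H.s_mul, Equiv.swap_mul_self, H.s_one]

theorem s_conj_swap (π : Equiv.Perm (Fin n)) (i j : Fin n) :
    s π * s (Equiv.swap i j) = s (Equiv.swap (π i) (π j)) * s π := by
  rw [← H.s_mul, ← H.s_mul, Equiv.mul_swap_eq_swap_mul]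

theorem s_mul_term (π : Equiv.Perm (Fin n)) (i j : Fin n) :
    s π * (tElt D f i j * s (Equiv.swap i j)) =
      tElt D f (π i) (π j) * s (Equiv.swap (π i) (π j)) * s π := by
  rw [← mul_assoc, H.s_mul_tElt, mul_assoc, H.s_conj_swap, mul_assoc]

/-- In each summand `t l i` turns a_i into ψ(a)_l, and the transposition of l and i moves it back to
the factor i. -/
theorem f_mul_jm_same (i : Fin n) (a : F) : f i a * jm D f s i = jm D f s i * f i (D.ψ a) := by
  simp only [jm, Finset.mul_sum, Finset.sum_mul]
  refine Finset.sum_congr rfl fun l hl => ?_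
  rw [← mul_assoc, H.f_mul_tElt_right D (Finset.mem_Iio.1 hl).ne, mul_assoc, mul_assoc, H.sf,
    Equiv.swap_apply_right]

theorem f_mul_jm_ne {i j : Fin n} (hij : i ≠ j) (a : F) :
    f j a * jm D f s i = jm D f s i * f j a := by
  simp only [jm, Finset.mul_sum, Finset.sum_mul]
  refine Finset.sum_congr rfl fun l hl => ?_
  by_cases h : l = j
  · subst h
    rw [← mul_assoc, H.f_mul_tElt_left D, mul_assoc, mul_assoc, H.sf, Equiv.swap_apply_left]
  · rw [← mul_assoc, H.f_mul_tElt D (Ne.symm h) hij.symm, mul_assoc, mul_assoc, H.sf,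
      Equiv.swap_apply_of_ne_of_ne (Ne.symm h) hij.symm]

/-- Conjugation by the adjacent transposition permutes the summands: since j is neither i nor i',
these two are both below j or both above it. -/
theorem swap_mul_jm_ne {i i' j : Fin n} (hi : (i : ℕ) + 1 = i') (hj : j ≠ i) (hj' : j ≠ i') :
    s (Equiv.swap i i') * jm D f s j = jm D f s j * s (Equiv.swap i i') := by
  simp only [jm, Finset.mul_sum, Finset.sum_mul]
  refine Finset.sum_equiv (Equiv.swap i i') (fun l => ?_) (fun l _ => ?_)
  · rw [Finset.mem_Iio, Finset.mem_Iio]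
    rw [Equiv.swap_apply_def]
    split_ifs with h h'
    · subst h
      rw [Fin.lt_def, Fin.lt_def]
      have := Fin.val_ne_of_ne hj'
      omega
    · subst h'
      rw [Fin.lt_def, Fin.lt_def]
      have := Fin.val_ne_of_ne hj
      omega
    · rfl
  · rw [H.s_mul_term, Equiv.swap_apply_of_ne_of_ne hj hj']

/-- Conjugating the summands for i gives those for i' except the one with l = i, which leaves t
after multiplication by the transposition. This is the relation `sx`, so the correction cancels in x
- J. -/
theorem swap_mul_jm {i i' : Fin n} (hi : (i : ℕ) + 1 = i') :
    s (Equiv.swap i i') * jm D f s i = jm D f s i' * s (Equiv.swap i i') - tElt D f i i' := by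
  have hI : Finset.Iio i' = insert i (Finset.Iio i) := by
    ext l
    simp only [Finset.mem_Iio, Finset.mem_insert, Fin.lt_def, Fin.ext_iff]
    omega
  rw [jm, jm, hI, Finset.sum_insert (by simp), add_mul, mul_assoc, H.s_swap_mul_self, mul_one,
    add_sub_cancel_left, Finset.mul_sum, Finset.sum_mul]
  refine Finset.sum_congr rfl fun l hl => ?_
  have h1 : l ≠ i := (Finset.mem_Iio.1 hl).ne
  have h2 : l ≠ i' := by
    have := Finset.mem_Iio.1 hl
    rw [Fin.lt_def] at this
    intro h
    subst h
    omega
  rw [H.s_mul_term, Equiv.swap_apply_of_ne_of_ne h1 h2, Equiv.swap_apply_left]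

/-- Conjugation by the transposition of m and i relabels l. What remains is an identity between
products of two t's, with one case each for l = m, l = i and l different from both. -/
theorem term_mul_term {m i j l : Fin n} (hmi : m ≠ i) (hmj : m ≠ j) (hij : i ≠ j) (hl : l ≠ j) :
    (tElt D f m i * s (Equiv.swap m i)) * (tElt D f l j * s (Equiv.swap l j)) =
      (tElt D f (Equiv.swap m i l) j * s (Equiv.swap (Equiv.swap m i l) j)) *
        (tElt D f m i * s (Equiv.swap m i)) := by
  have hj : Equiv.swap m i j = j := Equiv.swap_apply_of_ne_of_ne hmj.symm hij.symm
  have key : tElt D f m i * tElt D f (Equiv.swap m i l) j =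
      tElt D f (Equiv.swap m i l) j * tElt D f (Equiv.swap (Equiv.swap m i l) j m)
        (Equiv.swap (Equiv.swap m i l) j i) := by
    by_cases h1 : l = m
    · subst h1
      rw [Equiv.swap_apply_left, Equiv.swap_apply_left, Equiv.swap_apply_of_ne_of_ne hmi hmj]
      exact H.tElt_mul_tElt_left D hmi hmj
    · by_cases h2 : l = i
      · subst h2
        rw [Equiv.swap_apply_right, Equiv.swap_apply_left,
          Equiv.swap_apply_of_ne_of_ne hmi.symm hl]
        exact (H.tElt_mul_tElt_right D hmi.symm hl).symm
      · rw [Equiv.swap_apply_of_ne_of_ne h1 h2,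
          Equiv.swap_apply_of_ne_of_ne (Ne.symm h1) hmj,
          Equiv.swap_apply_of_ne_of_ne (Ne.symm h2) hij]
        exact H.tElt_comm D (Ne.symm h1) hmj (Ne.symm h2) hij
  rw [mul_assoc, H.s_mul_term, hj, ← mul_assoc, ← mul_assoc, key, mul_assoc _ (s _) (tElt D f m i * _),
    ← mul_assoc (s _) (tElt D f m i) _, H.s_mul_tElt, mul_assoc, mul_assoc, mul_assoc]

/-- Already every single summand of the smaller Jucys–Murphy element commutes with the larger one:
moving it across permutes the summands of the latter by the transposition of m and i, both of which
are below j. -/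
theorem jm_comm {i j : Fin n} (hij : i < j) : jm D f s i * jm D f s j = jm D f s j * jm D f s i := by
  conv_lhs => rw [jm, Finset.sum_mul]
  conv_rhs => rw [jm.eq_def D f s i, Finset.mul_sum]
  refine Finset.sum_congr rfl fun m hm => ?_
  have hmi : m < i := Finset.mem_Iio.1 hm
  conv_lhs => rw [jm, Finset.mul_sum]
  conv_rhs => rw [jm.eq_def D f s j, Finset.sum_mul]
  refine Finset.sum_equiv (Equiv.swap m i) (fun l => ?_) (fun l hl => ?_)
  · rw [Finset.mem_Iio, Finset.mem_Iio, Equiv.swap_apply_def]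
    split_ifs with h h'
    · subst h; exact iff_of_true (hmi.trans hij) hij
    · subst h'; exact iff_of_true hij (hmi.trans hij)
    · rfl
  · exact H.term_mul_term D hmi.ne (hmi.trans hij).ne hij.ne (Finset.mem_Iio.1 hl).ne

end WreathRep

/-- The relations involving at most one of the elements `y i`. -/
structure PreYRep (D : FrobeniusSuperalgebra 𝒻) (y : Fin n → A) (f : Fin n → F → A)
    (s : Equiv.Perm (Fin n) → A) : Prop extends WreathRep 𝒻 f s where
  fy_same : ∀ i a, f i a * y i = y i * f i (D.ψ a)
  fy_ne : ∀ i j, i ≠ j → ∀ a, f j a * y i = y i * f j a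
  sy : ∀ π i, s π * y i = y (π i) * s π

/-- The defining relations of the affine wreath product algebra in terms of generators `y i` that
are permuted by the symmetric group. -/
structure YRep (D : FrobeniusSuperalgebra 𝒻) (y : Fin n → A) (f : Fin n → F → A)
    (s : Equiv.Perm (Fin n) → A) : Prop extends PreYRep D y f s where
  yy : ∀ i j, i ≠ j → y i * y j - y j * y i =
    (y j * tElt D f j i - y i * tElt D f i j) * s (Equiv.swap i j)

namespace PreYRep

variable {D : FrobeniusSuperalgebra 𝒻} {y : Fin n → A} {f : Fin n → F → A}
  {s : Equiv.Perm (Fin n) → A} (H : PreYRep D y f s)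
include H

/-- Moving y_j to the left applies ψ to b^∨_j, which turns `t i j` into `t j i` by `sum_f_psi_dual`.
-/
theorem tElt_mul_y {i j : Fin n} (hij : i ≠ j) : tElt D f i j * y j = y j * tElt D f j i := by
  rw [← H.sum_f_psi_dual D hij, tElt, Finset.sum_mul, Finset.mul_sum]
  refine Finset.sum_congr rfl fun b _ => ?_
  rw [mul_assoc, H.fy_same, ← mul_assoc, H.fy_ne j i hij.symm, mul_assoc]

theorem tElt_mul_y_of_ne {i j l : Fin n} (hi : l ≠ i) (hj : l ≠ j) :
    tElt D f i j * y l = y l * tElt D f i j := by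
  rw [tElt, Finset.sum_mul, Finset.mul_sum]
  refine Finset.sum_congr rfl fun b _ => ?_
  rw [mul_assoc, H.fy_ne _ _ hj, ← mul_assoc, H.fy_ne _ _ hi, mul_assoc]

theorem y_mul_term {i j l : Fin n} (hl : i ≠ l) (hj : i ≠ j) :
    y i * (tElt D f l j * s (Equiv.swap l j)) = tElt D f l j * s (Equiv.swap l j) * y i := by
  rw [mul_assoc, H.sy, Equiv.swap_apply_of_ne_of_ne hl hj, ← mul_assoc, ← mul_assoc,
    H.tElt_mul_y_of_ne hl hj]

theorem y_mul_jm_of_gt {i j : Fin n} (hij : i < j) : jm D f s i * y j = y j * jm D f s i := by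
  rw [jm, Finset.sum_mul, Finset.mul_sum]
  refine Finset.sum_congr rfl fun l hl => ?_
  exact (H.y_mul_term ((Finset.mem_Iio.1 hl).trans hij).ne' hij.ne').symm

/-- Only the summand of J_j with l = i fails to commute with y_i, because its transposition moves
the letter i. -/
theorem y_mul_jm_of_lt {i j : Fin n} (hij : i < j) : y i * jm D f s j - jm D f s j * y i =
    (y i * tElt D f i j - y j * tElt D f j i) * s (Equiv.swap i j) := by
  rw [jm, Finset.sum_mul, Finset.mul_sum, ← Finset.sum_sub_distrib,
    Finset.sum_eq_single_of_mem i (Finset.mem_Iio.2 hij)]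
  · rw [mul_assoc, H.sy, Equiv.swap_apply_left, ← mul_assoc, ← mul_assoc, H.tElt_mul_y hij.ne,
      sub_mul]
  · intro l _ hl
    rw [H.y_mul_term hl.symm hij.ne, sub_self]

/-- This is the origin of the relation `yy`: its right side is the defect produced by the
Jucys–Murphy elements, so the sums y + J commute exactly when `yy` holds. Both directions are used,
to pass between the two presentations. -/
theorem comm_add_jm {i j : Fin n} (hij : i < j) :
    (y i + jm D f s i) * (y j + jm D f s j) - (y j + jm D f s j) * (y i + jm D f s i) =
      (y i * y j - y j * y i) -
        (y j * tElt D f j i - y i * tElt D f i j) * s (Equiv.swap i j) := by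
  have h1 := H.y_mul_jm_of_gt hij
  have h2 := H.y_mul_jm_of_lt hij
  have h3 := H.jm_comm D hij
  rw [← neg_sub (y i * _) (y j * _), neg_mul, ← h2]
  simp only [add_mul, mul_add, h1, h3]
  abel

end PreYRep

/-- A map on the generators from its values. -/
def genElim {X : Type*} (x : Fin n → X) (f : Fin n → F → X) (s : Equiv.Perm (Fin n) → X) :
    Gen F n → X
  | .x i => x i
  | .f i a => f i a
  | .s π => s π

variable {D : FrobeniusSuperalgebra 𝒻}

theorem YRep.isRep {y : Fin n → A} {f : Fin n → F → A} {s : Equiv.Perm (Fin n) → A}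
    (H : YRep D y f s) : IsRep D (genElim (fun i => y i + jm D f s i) f s) where
  x_comm i j := by
    change (y i + jm D f s i) * (y j + jm D f s j) = (y j + jm D f s j) * (y i + jm D f s i)
    rcases lt_trichotomy i j with h | h | h
    · rw [← sub_eq_zero, H.comm_add_jm h, H.yy i j h.ne, sub_self]
    · rw [h]
    · rw [eq_comm, ← sub_eq_zero, H.comm_add_jm h, H.yy j i h.ne, sub_self]
  f_add := H.f_add
  f_smul := H.f_smul
  f_one := H.f_one
  f_mul := H.f_mul
  f_comm := H.f_comm
  s_one := H.s_one
  s_mul := H.s_mul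
  fx_same i a := by
    change f i a * (y i + jm D f s i) = (y i + jm D f s i) * f i (D.ψ a)
    rw [mul_add, add_mul, H.fy_same, H.f_mul_jm_same]
  fx_ne i j hij a := by
    change f j a * (y i + jm D f s i) = (y i + jm D f s i) * f j a
    rw [mul_add, add_mul, H.fy_ne i j hij, H.f_mul_jm_ne D hij]
  sx_ne i i' j hi hj hj' := by
    change s _ * (y j + jm D f s j) = (y j + jm D f s j) * s _
    rw [mul_add, add_mul, H.sy, H.swap_mul_jm_ne D hi hj hj', Equiv.swap_apply_of_ne_of_ne hj hj']
  sx i i' hi := by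
    change s _ * (y i + jm D f s i) = (y i' + jm D f s i') * s _ - tElt D f i i'
    rw [mul_add, add_mul, H.sy, H.swap_mul_jm D hi, Equiv.swap_apply_left, add_sub_assoc]
  sf := H.sf

namespace IsRep

variable {g : Gen F n → A} (H : IsRep D g)
include H

theorem wreathRep : WreathRep 𝒻 (fun i a => g (.f i a)) (fun π => g (.s π)) where
  f_add := H.f_add
  f_smul := H.f_smul
  f_one := H.f_one
  f_mul := H.f_mul
  f_comm := H.f_comm
  s_one := H.s_one
  s_mul := H.s_mul
  sf := H.sf

end IsRep

/-- The generators `y i` that are permuted by the symmetric group. -/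
noncomputable def yElt (D : FrobeniusSuperalgebra 𝒻) (g : Gen F n → A) (i : Fin n) : A :=
  g (.x i) - jm D (fun i a => g (.f i a)) (fun π => g (.s π)) i

namespace IsRep

variable {g : Gen F n → A} (H : IsRep D g)
include H

/-- x_i and J_i satisfy the relation `sx` with the same term t, which cancels in the difference. The
case of the letter i' follows by conjugating that of i. -/
theorem swap_mul_yElt {i i' : Fin n} (hi : (i : ℕ) + 1 = i') (j : Fin n) :
    g (.s (Equiv.swap i i')) * yElt D g j = yElt D g (Equiv.swap i i' j) *
      g (.s (Equiv.swap i i')) := by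
  have W := H.wreathRep
  have h1 : g (.s (Equiv.swap i i')) * yElt D g i = yElt D g i' * g (.s (Equiv.swap i i')) := by
    simp only [yElt]
    rw [mul_sub, sub_mul, H.sx i i' hi, W.swap_mul_jm D hi]
    abel
  by_cases hj : j = i
  · subst hj
    rw [Equiv.swap_apply_left, h1]
  · by_cases hj' : j = i'
    · subst hj'
      have h2 := W.s_swap_mul_self i j
      rw [Equiv.swap_apply_right]
      calc g (.s (Equiv.swap i j)) * yElt D g j
          = g (.s (Equiv.swap i j)) * (yElt D g j * g (.s (Equiv.swap i j))) *
              g (.s (Equiv.swap i j)) := by rw [mul_assoc, mul_assoc, h2, mul_one]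
        _ = _ := by rw [← h1, ← mul_assoc, h2, one_mul]
    · rw [Equiv.swap_apply_of_ne_of_ne hj hj']
      simp only [yElt]
      rw [mul_sub, sub_mul, H.sx_ne i i' j hi hj hj', W.swap_mul_jm_ne D hi hj hj']

theorem s_mul_yElt (π : Equiv.Perm (Fin n)) :
    ∀ i, g (.s π) * yElt D g i = yElt D g (π i) * g (.s π) := by
  cases n with
  | zero => exact fun i => i.elim0
  | succ n =>
    have hπ : π ∈ Submonoid.closure (Set.range fun i : Fin n => Equiv.swap i.castSucc i.succ) := by
      rw [Equiv.Perm.mclosure_swap_castSucc_succ]; trivial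
    induction hπ using Submonoid.closure_induction with
    | mem π hπ =>
      obtain ⟨i, rfl⟩ := hπ
      exact H.swap_mul_yElt (by simp)
    | one => simp [H.s_one]
    | mul π σ _ _ h1 h2 =>
      intro i
      rw [H.s_mul, mul_assoc, h2, ← mul_assoc, h1, mul_assoc, Equiv.Perm.mul_apply]

theorem yRep : YRep D (yElt D g) (fun i a => g (.f i a)) (fun π => g (.s π)) := by
  have W := H.wreathRep
  have P : PreYRep D (yElt D g) (fun i a => g (.f i a)) (fun π => g (.s π)) :=
    { W with
      fy_same := fun i a => by
        simp only [yElt]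
        rw [mul_sub, sub_mul, H.fx_same, W.f_mul_jm_same]
      fy_ne := fun i j hij a => by
        simp only [yElt]
        rw [mul_sub, sub_mul, H.fx_ne i j hij, W.f_mul_jm_ne D hij]
      sy := H.s_mul_yElt }
  have key : ∀ i j, i < j → yElt D g i * yElt D g j - yElt D g j * yElt D g i =
    (yElt D g j * tElt D (fun i a => g (.f i a)) j i -
      yElt D g i * tElt D (fun i a => g (.f i a)) i j) * g (.s (Equiv.swap i j)) := by
    intro i j h
    have h1 := P.comm_add_jm h
    simp only [yElt, sub_add_cancel] at h1 ⊢
    rw [H.x_comm i j, sub_self] at h1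
    exact (sub_eq_zero.1 h1.symm)
  refine { P with yy := fun i j hij => ?_ }
  rcases hij.lt_or_gt with h | h
  · exact key i j h
  · rw [← neg_sub, key j i h, Equiv.swap_comm, ← neg_mul, neg_sub]

end IsRep

end EquivariantGenerators

/-! ### Commutation rules and leading term of χ. -/

section CyclotomicPolynomial

variable {k : Type u₁} [CommRing k] {F : Type u₂} [Ring F] [Algebra k F]
  {𝒻 : Gr → Submodule k F} [GradedAlgebra 𝒻] {D : FrobeniusSuperalgebra 𝒻} (C : CycParam D)
  {A : Type*} [Ring A]

theorem prod_ofFn_induction {P : A → ℕ → Prop} (one : P 1 0)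
    (mul : ∀ u v m n, P u m → P v n → P (u * v) (m + n)) {N : ℕ} {u : Fin N → A} {m : Fin N → ℕ}
    (h : ∀ i, P (u i) (m i)) : P (List.ofFn u).prod (∑ i, m i) := by
  induction N with
  | zero => simpa using one
  | succ N ih =>
    rw [List.ofFn_succ, List.prod_cons, Fin.sum_univ_succ]
    exact mul _ _ _ _ (h 0) (ih fun i => h i.succ)

/-- Induction over the factors of `χ`, keeping track of their degrees. -/
theorem chiElt_induction {x : A} {f : F → A} {P : A → ℕ → Prop} (one : P 1 0)
    (mul : ∀ u v m n, P u m → P v n → P (u * v) (m + n))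
    (factor : ∀ (l : Fin (orderOf D.ψ)) j, P (x ^ ((l : ℕ) + 1) - f (C.c l j)) ((l : ℕ) + 1)) :
    P (chiElt C x f) C.level := by
  unfold chiElt CycParam.level
  refine prod_ofFn_induction one mul fun l => ?_
  have h := prod_ofFn_induction one mul fun j => factor l j
  simpa [mul_comm] using h

theorem chiElt_mem (S : Subring A) {x : A} {f : F → A} (hx : x ∈ S) (hf : ∀ l j, f (C.c l j) ∈ S) :
    chiElt C x f ∈ S :=
  chiElt_induction C (P := fun u _ => u ∈ S) S.one_mem (fun _ _ _ _ h h' => S.mul_mem h h')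
    (fun l j => S.sub_mem (S.pow_mem hx _) (hf l j))

/-- The subring of the pairs `(u, v)` with `s * u = v * s`. -/
def intertwiner (s : A) : Subring (A × A) where
  carrier := {u | s * u.1 = u.2 * s}
  mul_mem' {u v} hu hv := by
    simp only [Set.mem_ofPred_eq, Prod.fst_mul, Prod.snd_mul] at hu hv ⊢
    rw [← mul_assoc, hu, mul_assoc, hv, mul_assoc]
  one_mem' := by simp
  add_mem' {u v} hu hv := by
    simp only [Set.mem_ofPred_eq, Prod.fst_add, Prod.snd_add] at hu hv ⊢
    rw [mul_add, add_mul, hu, hv]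
  zero_mem' := by simp
  neg_mem' {u} hu := by
    simp only [Set.mem_ofPred_eq, Prod.fst_neg, Prod.snd_neg] at hu ⊢
    rw [mul_neg, neg_mul, hu]

/-- Evaluating χ in A × A' treats two evaluations at once: a multiplicative relation between them
becomes membership in a subring of the product, to be checked on the arguments of χ only. -/
theorem chiElt_prod {A' : Type*} [Ring A'] (x : A) (x' : A') (f : F → A) (f' : F → A') :
    chiElt C (x, x') (fun a => (f a, f' a)) = (chiElt C x f, chiElt C x' f') :=
  Prod.ext (map_chiElt C (RingHom.fst A A') _ _) (map_chiElt C (RingHom.snd A A') _ _)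

theorem intertwine_chiElt {s x x' : A} {f f' : F → A} (hx : s * x = x' * s)
    (hf : ∀ l j, s * f (C.c l j) = f' (C.c l j) * s) :
    s * chiElt C x f = chiElt C x' f' * s := by
  have h := chiElt_mem C (intertwiner s) (x := (x, x')) (f := fun a => (f a, f' a)) hx hf
  rw [chiElt_prod] at h
  exact h

/-- The subring of the pairs `(u, v)` with `s * u = v * s` and `[y, u] = (u t - t v) s`. -/
def twistedDer (y t s : A) : Subring (A × A) where
  carrier := {u | s * u.1 = u.2 * s ∧ y * u.1 - u.1 * y = (u.1 * t - t * u.2) * s}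
  mul_mem' {u v} hu hv := by
    obtain ⟨hu, hu'⟩ := hu
    obtain ⟨hv, hv'⟩ := hv
    refine ⟨(intertwiner s).mul_mem hu hv, ?_⟩
    simp only [Prod.fst_mul, Prod.snd_mul]
    -- Leibniz rule: s v.1 = v.2 s, and the two terms u.1 t v.2 s cancel.
    calc y * (u.1 * v.1) - u.1 * v.1 * y
        = (y * u.1 - u.1 * y) * v.1 + u.1 * (y * v.1 - v.1 * y) := by noncomm_ring
      _ = (u.1 * t - t * u.2) * (s * v.1) + u.1 * ((v.1 * t - t * v.2) * s) := by
        rw [hu', hv', mul_assoc]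
      _ = _ := by rw [hv]; noncomm_ring
  one_mem' := by simp
  add_mem' {u v} hu hv := by
    refine ⟨(intertwiner s).add_mem hu.1 hv.1, ?_⟩
    have h : y * (u.1 + v.1) - (u.1 + v.1) * y =
        (y * u.1 - u.1 * y) + (y * v.1 - v.1 * y) := by noncomm_ring
    simp only [Prod.fst_add, Prod.snd_add]
    rw [h, hu.2, hv.2]
    noncomm_ring
  zero_mem' := by simp
  neg_mem' {u} hu := by
    refine ⟨(intertwiner s).neg_mem hu.1, ?_⟩
    have h : y * (-u.1) - (-u.1) * y = -(y * u.1 - u.1 * y) := by noncomm_ring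
    simp only [Prod.fst_neg, Prod.snd_neg]
    rw [h, hu.2]
    noncomm_ring

variable [Algebra k A] {n : ℕ}

theorem FRep.f_comm_of_even {f : Fin n → F → A} (H : FRep 𝒻 f) {i j : Fin n} (hij : i ≠ j) {r : ℤ}
    {c : F} (hc : c ∈ 𝒻 (r, 0)) (a : F) : f i a * f j c = f j c * f i a := by
  refine FRep.ext_homogeneous (𝒻 := 𝒻)
    (φ := LinearMap.mulRight k (f j c) ∘ₗ (H.hom i).toLinearMap)
    (χ := LinearMap.mulLeft k (f j c) ∘ₗ (H.hom i).toLinearMap) (fun p a ha => ?_) a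
  change f i a * f j c = f j c * f i a
  rw [H.f_comm i j hij _ _ _ _ ha hc, mul_zero, sgn_zero, one_smul]

namespace PreYRep

variable {y : Fin n → A} {f : Fin n → F → A} {s : Equiv.Perm (Fin n) → A}
  (H : PreYRep D y f s)
include H

theorem s_mul_chiElt (π : Equiv.Perm (Fin n)) (i : Fin n) :
    s π * chiElt C (y i) (f i) = chiElt C (y (π i)) (f (π i)) * s π :=
  intertwine_chiElt C (H.sy π i) fun _ _ => H.sf π i _

/-- The values of χ at different letters are conjugate under transpositions. -/
theorem chiElt_eq_zero (i : Fin n) (h : chiElt C (y i) (f i) = 0) (j : Fin n) :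
    chiElt C (y j) (f j) = 0 := by
  have h1 := H.s_mul_chiElt C (Equiv.swap i j) i
  rw [h, mul_zero, Equiv.swap_apply_left] at h1
  have h2 := congrArg (· * s (Equiv.swap i j)) h1
  simp only [zero_mul, mul_assoc, H.s_swap_mul_self, mul_one] at h2
  exact h2.symm

theorem f_mul_y_pow (i : Fin n) (a : F) (m : ℕ) : f i a * y i ^ m = y i ^ m * f i ((D.ψ ^ m) a) := by
  induction m generalizing a with
  | zero => simp
  | succ m ih =>
    rw [pow_succ', ← mul_assoc, H.fy_same, mul_assoc, ih, ← mul_assoc, pow_succ]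
    rfl

/-- A factor of degree l twists a by ψ^l: for the power of y by l applications of the relation
`fy_same`, for the constant term by `c_comm`. The twists add up to the level. -/
theorem f_mul_chiElt_same (i : Fin n) (a : F) :
    f i a * chiElt C (y i) (f i) = chiElt C (y i) (f i) * f i ((D.ψ ^ C.level) a) := by
  refine chiElt_induction C (P := fun u m => ∀ a, f i a * u = u * f i ((D.ψ ^ m) a)) ?_ ?_ ?_ a
  · simp
  · intro u v m n hu hv a
    rw [← mul_assoc, hu, mul_assoc, hv, mul_assoc, add_comm m n, pow_add]
    rfl
  · intro l j a
    rw [mul_sub, sub_mul, H.f_mul_y_pow, ← H.f_mul, ← H.f_mul, C.c_comm]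

theorem f_mul_chiElt_ne {i j : Fin n} (hij : i ≠ j) (a : F) :
    f j a * chiElt C (y i) (f i) = chiElt C (y i) (f i) * f j a :=
  intertwine_chiElt C (H.fy_ne i j hij a) fun l j => H.f_comm_of_even hij.symm (C.c_mem l j) a

theorem y_mul_chiElt_same (i : Fin n) :
    y i * chiElt C (y i) (f i) = chiElt C (y i) (f i) * y i :=
  intertwine_chiElt C rfl fun l j => by rw [H.fy_same, C.c_fixed]

end PreYRep

/-- The pair of values of χ at j and i lies in `twistedDer`: the pair (y_j, y_i) does by `yy`, and
for the constants c both sides of the second condition vanish. The lemma serves to show that the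
values of χ span a submodule stable under the y_i. -/
theorem YRep.y_mul_chiElt_ne {y : Fin n → A} {f : Fin n → F → A} {s : Equiv.Perm (Fin n) → A}
    (H : YRep D y f s) {i j : Fin n} (hij : i ≠ j) :
    y i * chiElt C (y j) (f j) - chiElt C (y j) (f j) * y i =
      (chiElt C (y j) (f j) * tElt D f j i - tElt D f j i * chiElt C (y i) (f i)) *
        s (Equiv.swap i j) := by
  have h := chiElt_mem C (twistedDer (y i) (tElt D f j i) (s (Equiv.swap i j)))
    (x := (y j, y i)) (f := fun a => (f j a, f i a)) ?_ ?_
  · rw [chiElt_prod] at h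
    exact h.2
  · refine ⟨?_, ?_⟩
    · change s _ * y j = y i * s _
      rw [H.sy, Equiv.swap_apply_right]
    · change y i * y j - y j * y i = (y j * tElt D f j i - tElt D f j i * y i) * s _
      rw [H.yy i j hij, H.tElt_mul_y hij.symm]
  · intro l m
    refine ⟨?_, ?_⟩
    · change s _ * f j _ = f i _ * s _
      rw [H.sf, Equiv.swap_apply_right]
    · change y i * f j (C.c l m) - f j (C.c l m) * y i =
        (f j (C.c l m) * tElt D f j i - tElt D f j i * f i (C.c l m)) * s _
      rw [H.fy_ne i j hij, H.f_mul_tElt_left D, sub_self, sub_self, zero_mul]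

/-- If `Y` agrees with `X` up to terms of lower degree, then `χ` evaluated at `Y` agrees with the
power of `X` whose exponent is the level, up to terms of lower degree. -/
theorem chiElt_sub_pow_mem {L : Type*} [AddCommGroup L] [Module k L] {X Y : Module.End k L}
    {f : F → Module.End k L} {E W : ℕ → Submodule k L} (hEW : ∀ c, E c ≤ W (c + 1))
    (hW : Monotone W) (hX : ∀ c, ∀ e ∈ E c, X e ∈ E (c + 1))
    (hXY : ∀ c, ∀ e ∈ E c, Y e - X e ∈ W (c + 1)) (hY : ∀ c, ∀ e ∈ W c, Y e ∈ W (c + 1))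
    (hf : ∀ l j c, ∀ e ∈ W c, f (C.c l j) e ∈ W c) {c : ℕ} {e : L} (he : e ∈ E c) :
    chiElt C Y f e - (X ^ C.level) e ∈ W (c + C.level) := by
  have hXpow : ∀ m c, ∀ e ∈ E c, (X ^ m) e ∈ E (c + m) := by
    intro m
    induction m with
    | zero => intro c e he; simpa using he
    | succ m ih => intro c e he; rw [pow_succ']; exact hX _ _ (ih c e he)
  have hYpow : ∀ m c, ∀ e ∈ W c, (Y ^ m) e ∈ W (c + m) := by
    intro m
    induction m with
    | zero => intro c e he; simpa using he
    | succ m ih => intro c e he; rw [pow_succ']; exact hY _ _ (ih c e he)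
  have hXYpow : ∀ m c, ∀ e ∈ E c, (Y ^ m) e - (X ^ m) e ∈ W (c + m) := by
    intro m
    induction m with
    | zero => intro c e he; simp
    | succ m ih =>
      intro c e he
      rw [pow_succ', pow_succ', Module.End.mul_apply, Module.End.mul_apply]
      have h1 := hY _ _ (ih c e he)
      have h2 := hXY _ _ (hXpow m c e he)
      rw [map_sub] at h1
      simpa [add_assoc] using add_mem h1 h2
  refine (chiElt_induction C (P := fun (u : Module.End k L) m => (∀ c, ∀ e ∈ W c, u e ∈ W (c + m)) ∧
    ∀ c, ∀ e ∈ E c, u e - (X ^ m) e ∈ W (c + m)) ?_ ?_ ?_).2 c e he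
  · exact ⟨fun c e he => by simpa using he, fun c e he => by simp⟩
  · intro u v m n hu hv
    refine ⟨fun c e he => ?_, fun c e he => ?_⟩
    · rw [Module.End.mul_apply, add_comm m n, ← add_assoc]
      exact hu.1 _ _ (hv.1 c e he)
    · have h1 := hu.1 _ _ (hv.2 c e he)
      have h2 := hu.2 _ _ (hXpow n c e he)
      rw [pow_add, Module.End.mul_apply, Module.End.mul_apply, add_comm m n, ← add_assoc]
      rw [map_sub] at h1
      simpa using add_mem h1 h2
  · intro l j
    refine ⟨fun c e he => ?_, fun c e he => ?_⟩
    · exact sub_mem (hYpow _ c e he) (hW (Nat.le_add_right _ _) (hf l j c e he))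
    · have h1 := hXYpow ((l : ℕ) + 1) c e he
      have h2 := hW (Nat.add_le_add_left (Nat.le_add_left 1 (l : ℕ)) c) (hf l j _ e (hEW c he))
      have h3 := sub_mem h1 h2
      rw [LinearMap.sub_apply, sub_right_comm]
      exact h3

end CyclotomicPolynomial

/-! ### The coinduced module of equivariant functions on the symmetric group. -/

section Coinduction

variable {k : Type u₁} [CommRing k] {F : Type u₂} [Ring F] [Algebra k F]
  {𝒻 : Gr → Submodule k F} [GradedAlgebra 𝒻] {D : FrobeniusSuperalgebra 𝒻} {n : ℕ}

/-- The relations of the affine wreath product algebra of `n` letters together with those of one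
letter, the latter supercommuting with the former. -/
structure ExtRep (D : FrobeniusSuperalgebra 𝒻) {A : Type*} [Ring A] [Algebra k A]
    (z : Fin (n + 1) → A) (f : Fin (n + 1) → F → A) (s : Equiv.Perm (Fin n) → A) : Prop
    extends FRep 𝒻 f where
  s_one : s 1 = 1
  s_mul : ∀ π σ, s (π * σ) = s π * s σ
  sf : ∀ π i a, s π * f i a = f (extPerm π i) a * s π
  fz_same : ∀ i a, f i a * z i = z i * f i (D.ψ a)
  fz_ne : ∀ i j, i ≠ j → ∀ a, f j a * z i = z i * f j a
  sz : ∀ π i, s π * z i = z (extPerm π i) * s π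
  zz : ∀ i j : Fin n, i ≠ j →
    z i.castSucc * z j.castSucc - z j.castSucc * z i.castSucc =
      (z j.castSucc * tElt D f j.castSucc i.castSucc -
        z i.castSucc * tElt D f i.castSucc j.castSucc) * s (Equiv.swap i j)
  zz_last : ∀ i : Fin n, z i.castSucc * z (Fin.last n) = z (Fin.last n) * z i.castSucc

variable {E : Type*} [AddCommGroup E] [Module k E]
  {z : Fin (n + 1) → Module.End k E} {f : Fin (n + 1) → F → Module.End k E}
  {s : Equiv.Perm (Fin n) → Module.End k E}

/-- The equivariant functions on the symmetric group. -/
def Coind (s : Equiv.Perm (Fin n) → Module.End k E) :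
    Submodule k (Equiv.Perm (Fin (n + 1)) → E) where
  carrier := {v | ∀ σ τ, s τ (v (σ * extPerm τ)) = v σ}
  add_mem' hu hv σ τ := by simp [hu σ τ, hv σ τ]
  zero_mem' σ τ := by simp
  smul_mem' c v hv σ τ := by simp [hv σ τ]

namespace ExtRep

variable (H : ExtRep D z f s)
include H

theorem s_mul_tElt (π : Equiv.Perm (Fin n)) (i j : Fin (n + 1)) :
    s π * tElt D f i j = tElt D f (extPerm π i) (extPerm π j) * s π := by
  simp only [tElt, Finset.mul_sum, Finset.sum_mul]
  refine Finset.sum_congr rfl fun b _ => ?_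
  rw [← mul_assoc, H.sf, mul_assoc, H.sf, mul_assoc]

theorem tElt_mul_z {i j : Fin (n + 1)} (hij : i ≠ j) :
    tElt D f i j * z j = z j * tElt D f j i := by
  rw [← H.sum_f_psi_dual D hij, tElt, Finset.sum_mul, Finset.mul_sum]
  refine Finset.sum_congr rfl fun b _ => ?_
  rw [mul_assoc, H.fz_same, ← mul_assoc, H.fz_ne j i hij.symm, mul_assoc]

theorem tElt_mul_z_of_ne {i j l : Fin (n + 1)} (hi : l ≠ i) (hj : l ≠ j) :
    tElt D f i j * z l = z l * tElt D f i j := by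
  rw [tElt, Finset.sum_mul, Finset.mul_sum]
  refine Finset.sum_congr rfl fun b _ => ?_
  rw [mul_assoc, H.fz_ne _ _ hj, ← mul_assoc, H.fz_ne _ _ hi, mul_assoc]

end ExtRep

/-- The element `t n a`, or zero if `a` is the last letter. -/
noncomputable def tLast (D : FrobeniusSuperalgebra 𝒻) {A : Type*} [Ring A]
    (f : Fin (n + 1) → F → A) (a : Fin (n + 1)) : A :=
  if a = Fin.last n then 0 else tElt D f (Fin.last n) a

theorem tLast_last {A : Type*} [Ring A] (f : Fin (n + 1) → F → A) :
    tLast D f (Fin.last n) = 0 := if_pos rfl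

theorem tLast_of_ne {A : Type*} [Ring A] (f : Fin (n + 1) → F → A) {a : Fin (n + 1)}
    (h : a ≠ Fin.last n) : tLast D f a = tElt D f (Fin.last n) a := if_neg h

/-- The action of the permutations on the equivariant functions. -/
def coindS (s : Equiv.Perm (Fin n) → Module.End k E) (π : Equiv.Perm (Fin (n + 1))) :
    Module.End k (Coind s) where
  toFun v := ⟨fun σ => v.1 (π⁻¹ * σ), fun σ τ => by
    change s τ (v.1 (π⁻¹ * (σ * extPerm τ))) = v.1 (π⁻¹ * σ)
    rw [← mul_assoc]
    exact v.2 _ τ⟩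
  map_add' _ _ := rfl
  map_smul' _ _ := rfl

theorem coindS_apply (π : Equiv.Perm (Fin (n + 1))) (v : Coind s) (σ : Equiv.Perm (Fin (n + 1))) :
    (coindS s π v).1 σ = v.1 (π⁻¹ * σ) := rfl

namespace ExtRep

variable (H : ExtRep D z f s)

/-- The action of `F` on the equivariant functions. -/
def coindF (i : Fin (n + 1)) (a : F) : Module.End k (Coind s) where
  toFun v := ⟨fun σ => f (σ⁻¹ i) a (v.1 σ), fun σ τ => by
    have h1 : extPerm τ ((σ * extPerm τ)⁻¹ i) = σ⁻¹ i := by simp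
    have h2 := congrArg (fun T => T (v.1 (σ * extPerm τ))) (H.sf τ ((σ * extPerm τ)⁻¹ i) a)
    simp only [Module.End.mul_apply] at h2
    rw [h2, h1, v.2]⟩
  map_add' u v := Subtype.ext (funext fun σ => map_add (f (σ⁻¹ i) a) (u.1 σ) (v.1 σ))
  map_smul' c v := Subtype.ext (funext fun σ => map_smul (f (σ⁻¹ i) a) c (v.1 σ))

theorem coindF_apply (i : Fin (n + 1)) (a : F) (v : Coind s) (σ : Equiv.Perm (Fin (n + 1))) :
    (H.coindF i a v).1 σ = f (σ⁻¹ i) a (v.1 σ) := rfl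

theorem extPerm_eq_last {τ : Equiv.Perm (Fin n)} {a : Fin (n + 1)} :
    extPerm τ a = Fin.last n ↔ a = Fin.last n := by
  rw [← extPerm_last τ, (extPerm τ).injective.eq_iff, extPerm_last]

include H in
theorem s_mul_tLast (τ : Equiv.Perm (Fin n)) (a : Fin (n + 1)) :
    s τ * tLast D f a = tLast D f (extPerm τ a) * s τ := by
  unfold tLast
  simp only [extPerm_eq_last]
  split_ifs with h
  · simp
  · rw [H.s_mul_tElt, extPerm_last]

/-- The action of the elements `y i` on the equivariant functions. -/
noncomputable def coindY (i : Fin (n + 1)) : Module.End k (Coind s) where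
  -- The correction term is the negative of a Jucys–Murphy contribution. It is chosen so that the
  -- sum of the last y and the last Jucys–Murphy element acts through the last z alone on functions
  -- supported on the permutations fixing the last letter (`coindX_coindOne`).
  toFun v := ⟨fun σ => z (σ⁻¹ i) (v.1 σ) -
      tLast D f (σ⁻¹ i) (v.1 (σ * Equiv.swap (σ⁻¹ i) (Fin.last n))), fun σ τ => by
    have h1 : extPerm τ ((σ * extPerm τ)⁻¹ i) = σ⁻¹ i := by simp
    have h2 := congrArg (fun T => T (v.1 (σ * extPerm τ))) (H.sz τ ((σ * extPerm τ)⁻¹ i))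
    have h3 := congrArg (fun T => T (v.1 (σ * extPerm τ *
      Equiv.swap ((σ * extPerm τ)⁻¹ i) (Fin.last n)))) (H.s_mul_tLast τ ((σ * extPerm τ)⁻¹ i))
    simp only [Module.End.mul_apply] at h2 h3
    rw [map_sub, h2, h3, h1, v.2, mul_assoc, Equiv.mul_swap_eq_swap_mul, h1, extPerm_last,
      ← mul_assoc, v.2]⟩
  map_add' u v := by
    ext σ
    change z _ (u.1 σ + v.1 σ) - tLast D f _ (u.1 _ + v.1 _) = (_ - _) + (_ - _)
    rw [map_add, map_add]
    abel
  map_smul' c v := by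
    ext σ
    change z _ (c • v.1 σ) - tLast D f _ (c • v.1 _) = c • (_ - _)
    rw [map_smul, map_smul, smul_sub]

theorem coindY_apply (i : Fin (n + 1)) (v : Coind s) (σ : Equiv.Perm (Fin (n + 1))) :
    (H.coindY i v).1 σ = z (σ⁻¹ i) (v.1 σ) -
      tLast D f (σ⁻¹ i) (v.1 (σ * Equiv.swap (σ⁻¹ i) (Fin.last n))) := rfl

theorem tElt_coindF_apply (i j : Fin (n + 1)) (v : Coind s) (σ : Equiv.Perm (Fin (n + 1))) :
    (tElt D H.coindF i j v).1 σ = tElt D f (σ⁻¹ i) (σ⁻¹ j) (v.1 σ) := by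
  simp only [tElt, LinearMap.sum_apply, Module.End.mul_apply, Submodule.coe_sum,
    Finset.sum_apply]
  rfl

theorem coind_wreathRep : WreathRep 𝒻 H.coindF (coindS s) where
  f_add i a b := by
    ext v σ; exact congrArg (fun T => T (v.1 σ)) (H.f_add (σ⁻¹ i) a b)
  f_smul i c a := by
    ext v σ; exact congrArg (fun T => T (v.1 σ)) (H.f_smul (σ⁻¹ i) c a)
  f_one i := by
    ext v σ; exact congrArg (fun T => T (v.1 σ)) (H.f_one (σ⁻¹ i))
  f_mul i a b := by
    ext v σ; exact congrArg (fun T => T (v.1 σ)) (H.f_mul (σ⁻¹ i) a b)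
  f_comm i j hij p q a b ha hb := by
    ext v σ
    have := congrArg (fun T => T (v.1 σ)) (H.f_comm (σ⁻¹ i) (σ⁻¹ j)
      (fun h => hij (σ⁻¹.injective h)) p q a b ha hb)
    simpa [LinearMap.smul_apply, coindF_apply, -zsmul_eq_mul] using this
  s_one := by ext v σ; simp [coindS_apply]
  s_mul π σ := by ext v ρ; simp [coindS_apply, mul_assoc]
  sf π i a := by
    ext v σ
    simp [coindS_apply, coindF_apply]

theorem coind_preYRep : PreYRep D H.coindY H.coindF (coindS s) :=
  { H.coind_wreathRep with
    fy_same := fun i a => by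
      ext v σ
      simp only [Module.End.mul_apply, coindF_apply, coindY_apply, map_sub]
      have h1 := congrArg (fun T => T (v.1 σ)) (H.fz_same (σ⁻¹ i) a)
      simp only [Module.End.mul_apply] at h1
      rw [h1]
      congr 1
      have h2 : (σ * Equiv.swap (σ⁻¹ i) (Fin.last n))⁻¹ i = Fin.last n := by simp
      rw [h2]
      unfold tLast
      split_ifs with h
      · simp
      · exact LinearMap.congr_fun (H.f_mul_tElt_right D (Ne.symm h) a) _
    fy_ne := fun i j hij a => by
      ext v σ
      simp only [Module.End.mul_apply, coindF_apply, coindY_apply, map_sub]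
      have hij' : σ⁻¹ i ≠ σ⁻¹ j := fun h => hij (σ⁻¹.injective h)
      have h1 := congrArg (fun T => T (v.1 σ)) (H.fz_ne (σ⁻¹ i) (σ⁻¹ j) hij' a)
      simp only [Module.End.mul_apply] at h1
      rw [h1]
      congr 1
      have h2 : (σ * Equiv.swap (σ⁻¹ i) (Fin.last n))⁻¹ j =
        Equiv.swap (σ⁻¹ i) (Fin.last n) (σ⁻¹ j) := by simp
      rw [h2]
      unfold tLast
      split_ifs with h
      · simp
      · by_cases hj : σ⁻¹ j = Fin.last n
        · rw [hj, Equiv.swap_apply_right]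
          exact LinearMap.congr_fun (H.f_mul_tElt_left D a) _
        · rw [Equiv.swap_apply_of_ne_of_ne hij'.symm hj]
          exact LinearMap.congr_fun (H.f_mul_tElt D hj hij'.symm a) _
    sy := fun π i => by
      ext v σ
      simp [coindS_apply, coindY_apply, mul_assoc] }

include H in
-- The relation `zz` on values: equivariance rewrites the action of the transposition of a and b on
-- v(σ) as v(σ (a b)).
theorem zz_apply {a b : Fin (n + 1)} (ha : a ≠ Fin.last n) (hb : b ≠ Fin.last n) (hab : a ≠ b)
    (v : Coind s) (σ : Equiv.Perm (Fin (n + 1))) :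
    z a (z b (v.1 σ)) - z b (z a (v.1 σ)) = z b (tElt D f b a (v.1 (σ * Equiv.swap a b))) -
      z a (tElt D f a b (v.1 (σ * Equiv.swap a b))) := by
  obtain ⟨a, rfl⟩ := Fin.exists_castSucc_eq.2 ha
  obtain ⟨b, rfl⟩ := Fin.exists_castSucc_eq.2 hb
  have h1 := congrArg (fun T => T (v.1 σ)) (H.zz a b (fun h => hab (congrArg _ h)))
  have h2 := v.2 (σ * Equiv.swap a.castSucc b.castSucc) (Equiv.swap a b)
  rw [extPerm_swap, mul_assoc, Equiv.swap_mul_self, mul_one] at h2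
  simpa [Module.End.mul_apply, h2] using h1

theorem coind_yy_of_ne {i j : Fin (n + 1)} (hij : i ≠ j) (v : Coind s)
    (σ : Equiv.Perm (Fin (n + 1))) (hi : σ⁻¹ i ≠ Fin.last n) :
    ((H.coindY i * H.coindY j - H.coindY j * H.coindY i) v).1 σ =
    (((H.coindY j * tElt D H.coindF j i - H.coindY i * tElt D H.coindF i j) *
      coindS s (Equiv.swap i j)) v).1 σ := by
  have hl : ∀ (u u' : Coind s), (u - u').1 σ = u.1 σ - u'.1 σ := fun _ _ => rfl
  rw [LinearMap.sub_apply, hl, Module.End.mul_apply _ (coindS s _), LinearMap.sub_apply, hl]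
  simp only [Module.End.mul_apply, coindY_apply, coindS_apply, tElt_coindF_apply, mul_inv_rev,
    Equiv.swap_inv, Equiv.Perm.mul_apply, map_sub]
  have hs : ∀ ρ, Equiv.swap i j * (σ * ρ) = σ * (Equiv.swap (σ⁻¹ i) (σ⁻¹ j) * ρ) := by
    intro ρ
    rw [← mul_assoc, ← mul_assoc, Equiv.mul_swap_eq_swap_mul]
    simp
  have hs1 : Equiv.swap i j * σ = σ * Equiv.swap (σ⁻¹ i) (σ⁻¹ j) := by simpa using hs 1
  have hab : σ⁻¹ i ≠ σ⁻¹ j := fun h => hij (σ⁻¹.injective h)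
  rw [hs, hs, hs1]
  generalize σ⁻¹ i = a at *
  generalize σ⁻¹ j = b at *
  simp only [Equiv.swap_apply_left, tLast_of_ne f hi, mul_assoc]
  -- If b is the last letter, z_a and z_b commute and both sides come from the correction term for a
  -- alone. Otherwise the relation `zz` accounts for the main terms, and the products of two
  -- transpositions `h4`, `h5` match the corrections.
  by_cases hb : b = Fin.last n
  · subst hb
    simp only [Equiv.swap_apply_right, tLast_last, LinearMap.zero_apply, tLast_of_ne f hi,
      Equiv.swap_mul_self, mul_one, sub_zero]
    have h1 := congrArg (fun T => T (v.1 (σ * Equiv.swap a (Fin.last n)))) (H.tElt_mul_z hi.symm)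
    have hz : z a (z (Fin.last n) (v.1 σ)) = z (Fin.last n) (z a (v.1 σ)) := by
      obtain ⟨a, rfl⟩ := Fin.exists_castSucc_eq.2 hi
      exact congrArg (fun T => T (v.1 σ)) (H.zz_last a)
    simp only [Module.End.mul_apply] at h1
    rw [h1, hz, map_zero]
    abel
  · rw [tLast_of_ne f hb, Equiv.swap_apply_of_ne_of_ne hab hi,
      Equiv.swap_apply_of_ne_of_ne hab.symm hb, tLast_of_ne f hb, tLast_of_ne f hi]
    have h1 := congrArg (fun T => T (v.1 (σ * Equiv.swap a (Fin.last n))))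
      (H.tElt_mul_z_of_ne (i := Fin.last n) (j := a) (l := b) hb hab.symm)
    have h2 := congrArg (fun T => T (v.1 (σ * Equiv.swap b (Fin.last n))))
      (H.tElt_mul_z_of_ne (i := Fin.last n) (j := b) (l := a) hi hab)
    have h3 := H.zz_apply hi hb hab v σ
    simp only [Module.End.mul_apply] at h1 h2
    have h4 : Equiv.swap a b * Equiv.swap a (Fin.last n) =
        Equiv.swap a (Fin.last n) * Equiv.swap b (Fin.last n) := by
      rw [Equiv.mul_swap_eq_swap_mul (Equiv.swap a (Fin.last n)) b,
        Equiv.swap_apply_of_ne_of_ne hab.symm hb, Equiv.swap_apply_right, Equiv.swap_comm b a]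
    have h5 : Equiv.swap a b * Equiv.swap b (Fin.last n) =
        Equiv.swap b (Fin.last n) * Equiv.swap a (Fin.last n) := by
      rw [Equiv.mul_swap_eq_swap_mul (Equiv.swap b (Fin.last n)) a,
        Equiv.swap_apply_of_ne_of_ne hab hi, Equiv.swap_apply_right]
    rw [h1, h2, h4, h5, ← sub_eq_zero]
    rw [← sub_eq_zero] at h3
    rw [← h3]
    abel

theorem coind_yRep : YRep D H.coindY H.coindF (coindS s) :=
  { H.coind_preYRep with
    yy := fun i j hij => by
      ext v σ
      -- The relation is antisymmetric in i and j, and at most one of them is sent to the last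
      -- letter by σ⁻¹.
      by_cases hi : σ⁻¹ i = Fin.last n
      · have hj : σ⁻¹ j ≠ Fin.last n := fun h => hij (σ⁻¹.injective (hi.trans h.symm))
        have h := H.coind_yy_of_ne hij.symm v σ hj
        rw [Equiv.swap_comm, ← neg_sub (H.coindY j * H.coindY i),
          ← neg_sub (H.coindY i * tElt D H.coindF i j)]
        exact congrArg Neg.neg h
      · exact H.coind_yy_of_ne hij v σ hi }

end ExtRep

end Coinduction

/-! ### The submodule spanned by the values of χ in the coinduced module. -/

section CyclotomicCoinduction

variable {k : Type u₁} [CommRing k] {F : Type u₂} [Ring F] [Algebra k F]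
  {𝒻 : Gr → Submodule k F} [GradedAlgebra 𝒻] {D : FrobeniusSuperalgebra 𝒻} {n : ℕ}

theorem extPerm_injective : Function.Injective (extPerm (n := n)) := by
  intro π σ h
  ext i : 1
  have := congrArg (fun ρ => ρ i.castSucc) h
  simp only [extPerm_castSucc] at this
  exact Fin.castSucc_injective n this

theorem exists_extPerm {ρ : Equiv.Perm (Fin (n + 1))} (h : ρ (Fin.last n) = Fin.last n) :
    ∃ τ : Equiv.Perm (Fin n), extPerm τ = ρ := by
  have h' : ρ⁻¹ (Fin.last n) = Fin.last n := by rw [Equiv.Perm.inv_eq_iff_eq, h]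
  have hne : ∀ ρ : Equiv.Perm (Fin (n + 1)), ρ (Fin.last n) = Fin.last n → ∀ i : Fin n,
      ρ i.castSucc ≠ Fin.last n := by
    intro ρ hρ i hi
    rw [← hρ] at hi
    exact (Fin.castSucc_lt_last i).ne (ρ.injective hi)
  refine ⟨⟨fun i => (ρ i.castSucc).castPred (hne ρ h i),
    fun i => (ρ⁻¹ i.castSucc).castPred (hne ρ⁻¹ h' i), fun i => ?_, fun i => ?_⟩, ?_⟩
  · apply Fin.castSucc_injective
    simp
  · apply Fin.castSucc_injective
    simp
  · ext a : 1
    induction a using Fin.lastCases with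
    | last => rw [extPerm_last, h]
    | cast a => rw [extPerm_castSucc]; simp

theorem exists_extPerm_factor (σ : Equiv.Perm (Fin (n + 1))) :
    ∃ τ : Equiv.Perm (Fin n), σ = Equiv.swap (σ (Fin.last n)) (Fin.last n) * extPerm τ := by
  obtain ⟨τ, hτ⟩ := exists_extPerm (ρ := Equiv.swap (σ (Fin.last n)) (Fin.last n) * σ) (by simp)
  exact ⟨τ, by rw [hτ, ← mul_assoc, Equiv.swap_mul_self, one_mul]⟩

/-- The permutation of the first `n` letters that remains after the image of the last letter is
split off. -/
noncomputable def tailPerm (σ : Equiv.Perm (Fin (n + 1))) : Equiv.Perm (Fin n) :=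
  (exists_extPerm_factor σ).choose

theorem tailPerm_spec (σ : Equiv.Perm (Fin (n + 1))) :
    Equiv.swap (σ (Fin.last n)) (Fin.last n) * extPerm (tailPerm σ) = σ :=
  (exists_extPerm_factor σ).choose_spec.symm

theorem tailPerm_mul (σ : Equiv.Perm (Fin (n + 1))) (τ : Equiv.Perm (Fin n)) :
    tailPerm (σ * extPerm τ) = tailPerm σ * τ := by
  apply extPerm_injective
  have h := tailPerm_spec (σ * extPerm τ)
  rw [Equiv.Perm.mul_apply, extPerm_last] at h
  rw [extPerm_mul, ← mul_left_cancel_iff (a := Equiv.swap (σ (Fin.last n)) (Fin.last n)), h,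
    ← mul_assoc, tailPerm_spec]

theorem tailPerm_swap (j : Fin (n + 1)) : tailPerm (Equiv.swap j (Fin.last n)) = 1 := by
  apply extPerm_injective
  have h := tailPerm_spec (Equiv.swap j (Fin.last n))
  rw [Equiv.swap_apply_right] at h
  rw [extPerm_one]
  exact mul_eq_left.1 h

variable {E : Type*} [AddCommGroup E] [Module k E]
  {z : Fin (n + 1) → Module.End k E} {f : Fin (n + 1) → F → Module.End k E}
  {s : Equiv.Perm (Fin n) → Module.End k E}

/-- The transpositions with the last letter represent the cosets of the smaller symmetric group. -/
theorem coind_ext (u v : Coind s)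
    (h : ∀ j, u.1 (Equiv.swap j (Fin.last n)) = v.1 (Equiv.swap j (Fin.last n)))
    (hs : ∀ τ, Function.Injective (s τ)) : u = v := by
  ext σ
  obtain ⟨τ, hτ⟩ := exists_extPerm_factor σ
  apply hs τ
  rw [hτ, u.2, v.2, h]

/-- The functions supported on the permutations sending the last letter to `l`. -/
def suppAt (s : Equiv.Perm (Fin n) → Module.End k E) (l : Fin (n + 1)) :
    Submodule k (Coind s) where
  carrier := {v | ∀ σ : Equiv.Perm (Fin (n + 1)), σ (Fin.last n) ≠ l → v.1 σ = 0}
  add_mem' hu hv σ hσ := by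
    change _ + _ = (0 : E)
    rw [hu σ hσ, hv σ hσ, add_zero]
  zero_mem' σ _ := rfl
  smul_mem' c v hv σ hσ := by
    change c • _ = (0 : E)
    rw [hv σ hσ, smul_zero]

/-- The projection onto the functions supported on the permutations sending the last letter
to `l`. -/
def projAt (s : Equiv.Perm (Fin n) → Module.End k E) (l : Fin (n + 1)) :
    Module.End k (Coind s) where
  toFun v := ⟨fun σ => if σ (Fin.last n) = l then v.1 σ else 0, fun σ τ => by
    simp only [Equiv.Perm.mul_apply, extPerm_last]
    split_ifs
    · exact v.2 σ τ
    · exact map_zero _⟩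
  map_add' u v := by
    ext σ
    change (if _ then u.1 σ + v.1 σ else 0) = (if _ then _ else _) + (if _ then _ else _)
    split_ifs <;> simp
  map_smul' c v := by
    ext σ
    change (if _ then c • v.1 σ else 0) = c • (if _ then _ else _)
    split_ifs <;> simp

theorem projAt_apply (l : Fin (n + 1)) (v : Coind s) (σ : Equiv.Perm (Fin (n + 1))) :
    (projAt s l v).1 σ = if σ (Fin.last n) = l then v.1 σ else 0 := rfl

theorem projAt_mem (l : Fin (n + 1)) (v : Coind s) : projAt s l v ∈ suppAt s l :=
  fun _ hσ => if_neg hσ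

theorem sum_projAt (v : Coind s) : ∑ l, projAt s l v = v := by
  ext σ
  rw [Submodule.coe_sum, Finset.sum_apply]
  simp [projAt_apply]

namespace ExtRep

variable (H : ExtRep D z f s)

/-- The correction term evaluates v at a permutation sending the last letter to i, which is outside
the support. -/
theorem coindY_apply_of_mem {i l : Fin (n + 1)} (hil : i ≠ l) {v : Coind s} (hv : v ∈ suppAt s l)
    (σ : Equiv.Perm (Fin (n + 1))) : (H.coindY i v).1 σ = z (σ⁻¹ i) (v.1 σ) := by
  rw [coindY_apply, hv (σ * _) (by simpa using hil), map_zero, sub_zero]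

variable (C : CycParam D)

/-- On functions supported at l ≠ j the operator y_j acts pointwise, and wherever the value is
nonzero it acts by some z a with a not the last letter. There χ vanishes by hypothesis. -/
theorem chiElt_coindY_of_mem (hχ : ∀ i : Fin n, chiElt C (z i.castSucc) (f i.castSucc) = 0)
    {j l : Fin (n + 1)} (hjl : j ≠ l) {v : Coind s} (hv : v ∈ suppAt s l) :
    chiElt C (H.coindY j) (H.coindF j) v = 0 := by
  ext σ
  -- Pairs of an operator on functions and an operator on E that describes its effect on the value
  -- at σ, for functions supported at l. As these form a subring, χ may be evaluated on both sides
  -- simultaneously.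
  let S : Subring (Module.End k (Coind s) × Module.End k E) :=
    { carrier := {u | ∀ v ∈ suppAt s l, u.1 v ∈ suppAt s l ∧ (u.1 v).1 σ = u.2 (v.1 σ)}
      mul_mem' := fun {u u'} hu hu' v hv => by
        refine ⟨(hu _ (hu' v hv).1).1, ?_⟩
        change (u.1 (u'.1 v)).1 σ = u.2 (u'.2 (v.1 σ))
        rw [(hu _ (hu' v hv).1).2, (hu' v hv).2]
      one_mem' := fun v hv => ⟨hv, rfl⟩
      add_mem' := fun {u u'} hu hu' v hv => by
        refine ⟨add_mem (hu v hv).1 (hu' v hv).1, ?_⟩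
        change (u.1 v).1 σ + (u'.1 v).1 σ = u.2 (v.1 σ) + u'.2 (v.1 σ)
        rw [(hu v hv).2, (hu' v hv).2]
      zero_mem' := fun v hv => ⟨zero_mem _, rfl⟩
      neg_mem' := fun {u} hu v hv => by
        refine ⟨neg_mem (hu v hv).1, ?_⟩
        change -(u.1 v).1 σ = -u.2 (v.1 σ)
        rw [(hu v hv).2] }
  have h := chiElt_mem C S (x := (H.coindY j, z (σ⁻¹ j)))
    (f := fun a => (H.coindF j a, f (σ⁻¹ j) a)) ?_ ?_
  · rw [chiElt_prod] at h
    rw [(h v hv).2]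
    by_cases hσ : σ (Fin.last n) = l
    · have : σ⁻¹ j ≠ Fin.last n := by
        intro h'
        rw [Equiv.Perm.inv_eq_iff_eq, hσ] at h'
        exact hjl h'
      obtain ⟨a, ha⟩ := Fin.exists_castSucc_eq.2 this
      rw [← ha, hχ]
      rfl
    · rw [hv σ hσ, map_zero]
      rfl
  · refine fun v hv => ⟨fun ρ hρ => ?_, H.coindY_apply_of_mem hjl hv σ⟩
    change (H.coindY j v).1 ρ = 0
    rw [H.coindY_apply_of_mem hjl hv, hv ρ hρ, map_zero]
  · refine fun a b v hv => ⟨fun ρ hρ => ?_, rfl⟩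
    change f _ _ (v.1 ρ) = 0
    rw [hv ρ hρ, map_zero]

/-- The map whose image is the submodule generated by the values of `χ`. -/
noncomputable def chiMap : Module.End k (Coind s) :=
  ∑ j, chiElt C (H.coindY j) (H.coindF j) * projAt s j

theorem chiMap_apply (v : Coind s) :
    H.chiMap C v = ∑ j, chiElt C (H.coindY j) (H.coindF j) (projAt s j v) := by
  simp [chiMap, LinearMap.sum_apply]

/-- Only the part of v supported at j contributes to χ(y_j) v, and on that part `chiMap` equals
χ(y_j). Thus the image of one operator contains the values of all the χ(y_j). -/
theorem chiElt_mem_range (hχ : ∀ i : Fin n, chiElt C (z i.castSucc) (f i.castSucc) = 0)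
    (j : Fin (n + 1)) (v : Coind s) :
    chiElt C (H.coindY j) (H.coindF j) v ∈ LinearMap.range (H.chiMap C) := by
  refine ⟨projAt s j v, ?_⟩
  rw [chiMap_apply, Finset.sum_eq_single j]
  · conv_rhs => rw [← sum_projAt v, map_sum]
    rw [Finset.sum_eq_single j]
    · congr 1
      ext σ
      simp only [projAt_apply]
      split_ifs <;> rfl
    · intro l _ hl
      exact H.chiElt_coindY_of_mem C hχ hl.symm (projAt_mem l v)
    · simp
  · intro l _ hl
    have : projAt s l (projAt s j v) = 0 := by
      ext σ
      simp only [projAt_apply]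
      split_ifs with h h'
      · exact absurd (h.symm.trans h') hl
      · rfl
      · rfl
    rw [this, map_zero]
  · simp

theorem map_range_chiMap {T : Module.End k (Coind s)}
    (hT : ∀ j v, T (chiElt C (H.coindY j) (H.coindF j) v) ∈ LinearMap.range (H.chiMap C))
    {v : Coind s} (hv : v ∈ LinearMap.range (H.chiMap C)) : T v ∈ LinearMap.range (H.chiMap C) := by
  obtain ⟨v, rfl⟩ := hv
  rw [chiMap_apply, map_sum]
  exact sum_mem fun j _ => hT j _

variable (hχ : ∀ i : Fin n, chiElt C (z i.castSucc) (f i.castSucc) = 0)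
include hχ

theorem coindS_mem_range (π : Equiv.Perm (Fin (n + 1))) {v : Coind s}
    (hv : v ∈ LinearMap.range (H.chiMap C)) : coindS s π v ∈ LinearMap.range (H.chiMap C) := by
  refine H.map_range_chiMap C (fun j v => ?_) hv
  rw [← Module.End.mul_apply, H.coind_yRep.s_mul_chiElt C]
  exact H.chiElt_mem_range C hχ _ _

theorem coindF_mem_range (i : Fin (n + 1)) (a : F) {v : Coind s}
    (hv : v ∈ LinearMap.range (H.chiMap C)) : H.coindF i a v ∈ LinearMap.range (H.chiMap C) := by
  refine H.map_range_chiMap C (fun j v => ?_) hv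
  rw [← Module.End.mul_apply]
  by_cases h : j = i
  · subst h
    rw [H.coind_yRep.f_mul_chiElt_same C]
    exact H.chiElt_mem_range C hχ _ _
  · rw [H.coind_yRep.f_mul_chiElt_ne C h]
    exact H.chiElt_mem_range C hχ _ _

/-- For i ≠ j, y_i χ(y_j) is χ(y_j) y_i + (χ(y_j) t - t χ(y_i)) s with t in the image of F ⊗ F.
Every term takes its values in the range, which is stable under F. -/
theorem coindY_mem_range (i : Fin (n + 1)) {v : Coind s}
    (hv : v ∈ LinearMap.range (H.chiMap C)) : H.coindY i v ∈ LinearMap.range (H.chiMap C) := by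
  refine H.map_range_chiMap C (fun j v => ?_) hv
  rw [← Module.End.mul_apply]
  by_cases h : i = j
  · subst h
    rw [H.coind_yRep.y_mul_chiElt_same C]
    exact H.chiElt_mem_range C hχ _ _
  · rw [← sub_add_cancel (H.coindY i * _) (chiElt C (H.coindY j) (H.coindF j) * H.coindY i),
      H.coind_yRep.y_mul_chiElt_ne C h, LinearMap.add_apply]
    refine add_mem ?_ (H.chiElt_mem_range C hχ _ _)
    rw [Module.End.mul_apply, LinearMap.sub_apply]
    refine sub_mem (H.chiElt_mem_range C hχ _ _) ?_
    rw [Module.End.mul_apply, tElt, LinearMap.sum_apply]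
    refine sum_mem fun b _ => ?_
    rw [Module.End.mul_apply]
    exact H.coindF_mem_range C hχ _ _
      (H.coindF_mem_range C hχ _ _ (H.chiElt_mem_range C hχ _ _))

end ExtRep

/-! ### Cyclicity of the coinduced module. -/

section Generation

theorem ExtRep.s_injective (H : ExtRep D z f s) (τ : Equiv.Perm (Fin n)) :
    Function.Injective (s τ) := by
  refine Function.LeftInverse.injective (g := s τ⁻¹) fun e => ?_
  rw [← Module.End.mul_apply, ← H.s_mul, inv_mul_cancel, H.s_one]
  rfl

namespace ExtRep

variable (H : ExtRep D z f s)

/-- The equivariant function with given values on the transpositions with the last letter. -/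
noncomputable def coindMk (e : Fin (n + 1) → E) : Coind s :=
  ⟨fun σ => s (tailPerm σ)⁻¹ (e (σ (Fin.last n))), fun σ τ => by
    change s τ (s (tailPerm (σ * extPerm τ))⁻¹ (e ((σ * extPerm τ) (Fin.last n)))) = _
    rw [tailPerm_mul, mul_inv_rev, ← Module.End.mul_apply, ← H.s_mul, ← mul_assoc,
      mul_inv_cancel, one_mul, Equiv.Perm.mul_apply, extPerm_last]⟩

theorem coindMk_apply (e : Fin (n + 1) → E) (σ : Equiv.Perm (Fin (n + 1))) :
    (H.coindMk e).1 σ = s (tailPerm σ)⁻¹ (e (σ (Fin.last n))) := rfl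

theorem coindMk_swap (e : Fin (n + 1) → E) (j : Fin (n + 1)) :
    (H.coindMk e).1 (Equiv.swap j (Fin.last n)) = e j := by
  rw [coindMk_apply, tailPerm_swap, inv_one, H.s_one, Equiv.swap_apply_right]
  rfl

/-- The function supported on the permutations fixing the last letter, with a given value at the
identity. -/
noncomputable def coindOne (e : E) : Coind s := H.coindMk (Pi.single (Fin.last n) e)

theorem coindOne_of_ne (e : E) {σ : Equiv.Perm (Fin (n + 1))} (h : σ (Fin.last n) ≠ Fin.last n) :
    (H.coindOne e).1 σ = 0 := by
  rw [coindOne, coindMk_apply, Pi.single_eq_of_ne h, map_zero]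

theorem coindOne_extPerm (e : E) (τ : Equiv.Perm (Fin n)) :
    (H.coindOne e).1 (extPerm τ) = s τ⁻¹ e := by
  have h := (H.coindOne e).2 1 τ
  have h1 : (H.coindOne e).1 1 = e := by
    have := H.coindMk_swap (Pi.single (Fin.last n) e) (Fin.last n)
    rwa [Equiv.swap_self, Pi.single_eq_same] at this
  rw [one_mul, h1] at h
  conv_rhs => rw [← h, ← Module.End.mul_apply, ← H.s_mul, inv_mul_cancel, H.s_one]
  rfl

theorem coindOne_one (e : E) : (H.coindOne e).1 1 = e := by
  have := H.coindOne_extPerm e 1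
  rwa [extPerm_one, inv_one, H.s_one] at this

theorem coindOne_add (e e' : E) : H.coindOne (e + e') = H.coindOne e + H.coindOne e' := by
  ext σ
  change s _ _ = s _ _ + s _ _
  rw [Pi.single_add, Pi.add_apply, map_add]

theorem coindOne_smul (c : k) (e : E) : H.coindOne (c • e) = c • H.coindOne e := by
  ext σ
  change s _ _ = c • s _ _
  rw [Pi.single_smul, Pi.smul_apply, map_smul]

theorem coindOne_mem (e : E) : H.coindOne e ∈ suppAt s (Fin.last n) :=
  fun _ hσ => H.coindOne_of_ne e hσ

theorem eq_coindOne (v : Coind s) (e : E) (h1 : v.1 1 = e)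
    (h2 : ∀ j, j ≠ Fin.last n → v.1 (Equiv.swap j (Fin.last n)) = 0) : v = H.coindOne e := by
  refine coind_ext _ _ (fun j => ?_) H.s_injective
  by_cases hj : j = Fin.last n
  · rw [hj, Equiv.swap_self]
    exact h1.trans (H.coindOne_one e).symm
  · rw [h2 j hj, H.coindOne_of_ne e (by simpa using hj)]

theorem coindY_coindOne (i : Fin n) (e : E) :
    H.coindY i.castSucc (H.coindOne e) = H.coindOne (z i.castSucc e) := by
  have h := H.coindY_apply_of_mem (Fin.castSucc_lt_last i).ne (H.coindOne_mem e)
  refine H.eq_coindOne _ _ ?_ fun j hj => ?_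
  · rw [h, H.coindOne_one]; rfl
  · rw [h, H.coindOne_of_ne e (by simpa using hj), map_zero]

theorem coindF_coindOne (i : Fin (n + 1)) (a : F) (e : E) :
    H.coindF i a (H.coindOne e) = H.coindOne (f i a e) := by
  refine H.eq_coindOne _ _ ?_ fun j hj => ?_
  · rw [coindF_apply, H.coindOne_one]; rfl
  · rw [coindF_apply, H.coindOne_of_ne e (by simpa using hj), map_zero]

theorem coindS_coindOne (τ : Equiv.Perm (Fin n)) (e : E) :
    coindS s (extPerm τ) (H.coindOne e) = H.coindOne (s τ e) := by
  have h : (extPerm τ)⁻¹ = extPerm τ⁻¹ := by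
    rw [inv_eq_iff_mul_eq_one, ← extPerm_mul, mul_inv_cancel, extPerm_one]
  refine H.eq_coindOne _ _ ?_ fun j hj => ?_
  · rw [coindS_apply, mul_one, h, H.coindOne_extPerm, inv_inv]
  · rw [coindS_apply, H.coindOne_of_ne]
    simpa [h, extPerm_eq_last] using hj

/-- At the transposition of j and the last letter, the correction term of `coindY` is the negative
of the Jucys–Murphy summand with l = j; all other unwanted terms vanish for reasons of support. This
brings the last z within reach of the generators of the affine algebra. -/
theorem coindX_coindOne (e : E) :
    (H.coindY (Fin.last n) + jm D H.coindF (coindS s) (Fin.last n)) (H.coindOne e) =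
      H.coindOne (z (Fin.last n) e) := by
  have h : ∀ σ, ((H.coindY (Fin.last n) + jm D H.coindF (coindS s) (Fin.last n))
      (H.coindOne e)).1 σ = (H.coindY (Fin.last n) (H.coindOne e)).1 σ +
      ∑ l ∈ Finset.Iio (Fin.last n), tElt D f (σ⁻¹ l) (σ⁻¹ (Fin.last n))
        ((H.coindOne e).1 (Equiv.swap l (Fin.last n) * σ)) := by
    intro σ
    rw [jm, LinearMap.add_apply, LinearMap.sum_apply]
    change _ + ((∑ l ∈ _, _ : Coind s)).1 σ = _
    rw [Submodule.coe_sum, Finset.sum_apply]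
    congr 1
    refine Finset.sum_congr rfl fun l _ => ?_
    rw [Module.End.mul_apply, tElt_coindF_apply, coindS_apply, Equiv.swap_inv]
  refine H.eq_coindOne _ _ ?_ fun j hj => ?_
  · rw [h, Finset.sum_eq_zero, add_zero, coindY_apply]
    · simp [tLast_last, H.coindOne_one]
    · intro l hl
      rw [H.coindOne_of_ne, map_zero]
      simpa using (Finset.mem_Iio.1 hl).ne
  · rw [h, Finset.sum_eq_single_of_mem j (Finset.mem_Iio.2 (Fin.lt_last_iff_ne_last.2 hj)),
      coindY_apply]
    · simp only [Equiv.swap_inv, Equiv.swap_apply_right, Equiv.swap_apply_left,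
        Equiv.swap_mul_self, H.coindOne_one, tLast_of_ne f hj]
      rw [H.coindOne_of_ne _ (by simpa using hj), map_zero, zero_sub, neg_add_cancel]
    · intro l hl hlj
      rw [H.coindOne_of_ne, map_zero]
      have := (Finset.mem_Iio.1 hl).ne
      rw [Equiv.Perm.mul_apply, Equiv.swap_apply_right,
        Equiv.swap_apply_of_ne_of_ne (Ne.symm hlj) hj]
      exact hj

theorem sum_coindS_coindOne (v : Coind s) :
    ∑ j, coindS s (Equiv.swap j (Fin.last n))
      (H.coindOne (v.1 (Equiv.swap j (Fin.last n)))) = v := by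
  refine coind_ext _ _ (fun j => ?_) H.s_injective
  rw [Submodule.coe_sum, Finset.sum_apply, Finset.sum_eq_single j]
  · rw [coindS_apply, inv_mul_cancel, H.coindOne_one]
  · intro l _ hl
    rw [coindS_apply, H.coindOne_of_ne]
    rw [Equiv.swap_inv, Equiv.Perm.mul_apply, Equiv.swap_apply_right]
    intro h
    rw [Equiv.swap_apply_eq_iff, Equiv.swap_apply_right] at h
    exact hl h.symm
  · simp

/-- A submodule that is stable under the action is everything if it contains a function supported
on the permutations fixing the last letter whose value generates. -/
theorem eq_top_of_stable (P : Submodule k (Coind s)) (hS : ∀ π, ∀ v ∈ P, coindS s π v ∈ P)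
    (hF : ∀ i a, ∀ v ∈ P, H.coindF i a v ∈ P) (hY : ∀ i, ∀ v ∈ P, H.coindY i v ∈ P) {e₀ : E}
    (h0 : H.coindOne e₀ ∈ P)
    (hgen : ∀ R : Submodule k E, e₀ ∈ R → (∀ i, ∀ e ∈ R, z i e ∈ R) →
      (∀ i a, ∀ e ∈ R, f i a e ∈ R) → (∀ τ, ∀ e ∈ R, s τ e ∈ R) → R = ⊤) : P = ⊤ := by
  let R : Submodule k E :=
    { carrier := {e | H.coindOne e ∈ P}
      add_mem' := fun {e e'} h h' => by
        change H.coindOne (e + e') ∈ P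
        rw [coindOne_add]; exact add_mem h h'
      zero_mem' := by
        have := H.coindOne_smul 0 (0 : E)
        rw [zero_smul, zero_smul] at this
        change H.coindOne 0 ∈ P
        rw [this]; exact zero_mem _
      smul_mem' := fun c e h => by
        change H.coindOne (c • e) ∈ P
        rw [coindOne_smul]; exact P.smul_mem c h }
  have hR : R = ⊤ := by
    refine hgen R h0 (fun i e he => ?_) (fun i a e he => ?_) (fun τ e he => ?_)
    · change H.coindOne _ ∈ P
      induction i using Fin.lastCases with
      | cast i => rw [← coindY_coindOne]; exact hY _ _ he
      | last =>
        rw [← coindX_coindOne, LinearMap.add_apply]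
        refine add_mem (hY _ _ he) ?_
        rw [jm, LinearMap.sum_apply]
        refine sum_mem fun l _ => ?_
        rw [Module.End.mul_apply, tElt, LinearMap.sum_apply]
        exact sum_mem fun b _ => hF _ _ _ (hF _ _ _ (hS _ _ he))
    · change H.coindOne _ ∈ P
      rw [← coindF_coindOne]; exact hF _ _ _ he
    · change H.coindOne _ ∈ P
      rw [← coindS_coindOne]; exact hS _ _ he
  rw [eq_top_iff]
  rintro v -
  rw [← H.sum_coindS_coindOne v]
  refine sum_mem fun j _ => hS _ _ ?_
  have : v.1 (Equiv.swap j (Fin.last n)) ∈ R := by rw [hR]; trivial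
  exact this

end ExtRep

end Generation

end CyclotomicCoinduction

/-! ### Division with remainder in a filtered module. -/

section Division

/-- Division with remainder by an operator that agrees with `X` up to terms of lower degree. -/
theorem isCompl_range_of_filtration {k V : Type*} [CommRing k] [AddCommGroup V] [Module k V]
    {W : ℕ → Submodule k V} (hmono : Monotone W) (h0 : W 0 = ⊥) (hex : ∀ v, ∃ c, v ∈ W c)
    {κ X : Module.End k V} {d : ℕ} (hκ : ∀ c, ∀ v ∈ W (c + 1), κ v - X v ∈ W (c + d))
    (hX : ∀ c v, X v ∈ W (c + d) → v ∈ W c)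
    (hdiv : ∀ c, ∀ v ∈ W (c + d), ∃ u ∈ W c, v - X u ∈ W d) :
    IsCompl (W d) (LinearMap.range κ) := by
  constructor
  · rw [Submodule.disjoint_def]
    rintro _ hv ⟨v, rfl⟩
    -- If κ v lies in W d and v in W (c + 1), then X v differs from κ v by an element of W (c + d),
    -- so X v lies there and v descends to W c.
    have key : ∀ c, v ∈ W c → v ∈ W 0 := by
      intro c
      induction c with
      | zero => exact id
      | succ c ih =>
        intro h
        refine ih (hX c v ?_)
        have := sub_mem (hmono (Nat.le_add_left d c) hv) (hκ c v h)
        rwa [sub_sub_cancel] at this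
    obtain ⟨c, hc⟩ := hex v
    have := key c hc
    rw [h0, Submodule.mem_bot] at this
    rw [this, map_zero]
  · rw [codisjoint_iff, eq_top_iff]
    have key : ∀ c, ∀ v ∈ W (c + d), v ∈ W d ⊔ LinearMap.range κ := by
      intro c
      induction c with
      | zero =>
        intro v hv
        rw [zero_add] at hv
        exact Submodule.mem_sup_left hv
      | succ c ih =>
        intro v hv
        obtain ⟨u, hu, hvu⟩ := hdiv _ v hv
        -- The quotient u removes the leading part of v; replacing X u by κ u costs a term one step
        -- lower, to which the induction applies.
        have h1 : v = (v - X u) - (κ u - X u) + κ u := by abel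
        rw [h1]
        exact add_mem (sub_mem (Submodule.mem_sup_left hvu) (ih _ (hκ c u hu)))
          (Submodule.mem_sup_right ⟨u, rfl⟩)
    rintro v -
    obtain ⟨c, hc⟩ := hex v
    exact key c v (hmono (Nat.le_add_right c d) hc)

end Division

/-! ### The degree filtration of the coinduced module. -/

section FilteredCoinduction

variable {k : Type u₁} [CommRing k] {F : Type u₂} [Ring F] [Algebra k F]
  {𝒻 : Gr → Submodule k F} [GradedAlgebra 𝒻] {D : FrobeniusSuperalgebra 𝒻} {n : ℕ}
  {E : Type*} [AddCommGroup E] [Module k E]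
  {z : Fin (n + 1) → Module.End k E} {f : Fin (n + 1) → F → Module.End k E}
  {s : Equiv.Perm (Fin n) → Module.End k E}

/-- A filtration by degree for which the last of the elements `z i` behaves like a variable, with
`X'` the removal of the constant term followed by the division by that variable. -/
structure DegFiltration (z : Fin (n + 1) → Module.End k E) (f : Fin (n + 1) → F → Module.End k E)
    (s : Equiv.Perm (Fin n) → Module.End k E) (G : ℕ → Submodule k E) (X' : Module.End k E) :
    Prop where
  mono : Monotone G
  zero : G 0 = ⊥
  exhaust : ∀ e, ∃ c, e ∈ G c
  z_mem : ∀ (i : Fin n) c, ∀ e ∈ G c, z i.castSucc e ∈ G c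
  f_mem : ∀ i a c, ∀ e ∈ G c, f i a e ∈ G c
  s_mem : ∀ τ c, ∀ e ∈ G c, s τ e ∈ G c
  X_mem : ∀ c, ∀ e ∈ G c, z (Fin.last n) e ∈ G (c + 1)
  X'_mem : ∀ c, ∀ e ∈ G (c + 1), X' e ∈ G c
  X'_X : X' * z (Fin.last n) = 1
  X_X' : ∀ e, e - z (Fin.last n) (X' e) ∈ G 1
  s_X' : ∀ τ, s τ * X' = X' * s τ

/-- The action of an endomorphism commuting with the permutations on the values. -/
def coindMap (T : Module.End k E) (hT : ∀ τ, s τ * T = T * s τ) : Module.End k (Coind s) where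
  toFun v := ⟨fun σ => T (v.1 σ), fun σ τ => by
    have h := LinearMap.congr_fun (hT τ) (v.1 (σ * extPerm τ))
    rw [Module.End.mul_apply, Module.End.mul_apply, v.2] at h
    exact h⟩
  map_add' u v := Subtype.ext (funext fun σ => map_add T (u.1 σ) (v.1 σ))
  map_smul' c v := Subtype.ext (funext fun σ => map_smul T c (v.1 σ))

theorem coindMap_pow_apply (T : Module.End k E) (hT : ∀ τ, s τ * T = T * s τ) (m : ℕ)
    (v : Coind s) (σ : Equiv.Perm (Fin (n + 1))) :
    ((coindMap T hT ^ m) v).1 σ = (T ^ m) (v.1 σ) := by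
  induction m with
  | zero => simp
  | succ m ih =>
    rw [pow_succ', pow_succ', Module.End.mul_apply, Module.End.mul_apply, ← ih]
    rfl

/-- The functions with values of bounded degree. -/
def coindDeg (s : Equiv.Perm (Fin n) → Module.End k E) (G : ℕ → Submodule k E) (c : ℕ) :
    Submodule k (Coind s) where
  carrier := {v | ∀ σ, v.1 σ ∈ G c}
  add_mem' hu hv σ := add_mem (hu σ) (hv σ)
  zero_mem' _ := zero_mem _
  smul_mem' r _ hv σ := Submodule.smul_mem _ r (hv σ)

namespace DegFiltration

variable {G : ℕ → Submodule k E} {X' : Module.End k E} (HG : DegFiltration z f s G X')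
include HG

theorem X'_pow_mem (m c : ℕ) : ∀ e ∈ G (c + m), (X' ^ m) e ∈ G c := by
  induction m with
  | zero => intro e he; simpa using he
  | succ m ih =>
    intro e he
    rw [pow_succ]
    exact ih _ (HG.X'_mem _ _ (by rwa [← add_assoc] at he))

theorem X_pow_mem (m c : ℕ) : ∀ e ∈ G c, (z (Fin.last n) ^ m) e ∈ G (c + m) := by
  induction m with
  | zero => intro e he; simpa using he
  | succ m ih =>
    intro e he
    rw [pow_succ']
    exact HG.X_mem _ _ (ih e he)

theorem X'_pow_X_pow (m : ℕ) : X' ^ m * z (Fin.last n) ^ m = 1 := by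
  induction m with
  | zero => simp
  | succ m ih => rw [pow_succ, pow_succ', mul_assoc, ← mul_assoc X', HG.X'_X, one_mul, ih]

theorem X_pow_X'_pow (m : ℕ) (e : E) : e - (z (Fin.last n) ^ m) ((X' ^ m) e) ∈ G m := by
  induction m with
  | zero => simp
  | succ m ih =>
    have h := HG.X_pow_mem m 1 _ (HG.X_X' ((X' ^ m) e))
    rw [map_sub, add_comm 1 m] at h
    have h' := add_mem (HG.mono (Nat.le_succ m) ih) h
    rw [sub_add_sub_cancel] at h'
    rw [pow_succ, pow_succ']
    exact h'

theorem coindDeg_exhaust (v : Coind s) : ∃ c, v ∈ coindDeg s G c := by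
  choose c hc using fun σ => HG.exhaust (v.1 σ)
  exact ⟨Finset.univ.sup c, fun σ => HG.mono (Finset.le_sup (Finset.mem_univ σ)) (hc σ)⟩

theorem tLast_mem (a : Fin (n + 1)) {c : ℕ} {e : E} (he : e ∈ G c) : tLast D f a e ∈ G c := by
  unfold tLast
  split_ifs
  · exact zero_mem _
  · rw [tElt, LinearMap.sum_apply]
    exact sum_mem fun b _ => HG.f_mem _ _ _ _ (HG.f_mem _ _ _ _ he)

variable (H : ExtRep D z f s) (C : CycParam D)

theorem coindY_mem (i : Fin (n + 1)) (c : ℕ) {v : Coind s} (hv : v ∈ coindDeg s G c) :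
    H.coindY i v ∈ coindDeg s G (c + 1) := by
  intro σ
  rw [ExtRep.coindY_apply]
  refine sub_mem ?_ (HG.mono c.le_succ (HG.tLast_mem _ (hv _)))
  generalize σ⁻¹ i = a
  induction a using Fin.lastCases with
  | last => exact HG.X_mem _ _ (hv σ)
  | cast a => exact HG.mono c.le_succ (HG.z_mem _ _ _ (hv σ))

/-- Where v can be nonzero, σ⁻¹ j is the last letter and y_j is exactly the variable. Elsewhere only
the correction term remains, and it does not raise the degree. -/
theorem coindY_sub_mem (hX : ∀ τ, s τ * z (Fin.last n) = z (Fin.last n) * s τ) (j : Fin (n + 1))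
    (c : ℕ) {v : Coind s} (hv : v ∈ coindDeg s G c) (hj : v ∈ suppAt s j) :
    H.coindY j v - coindMap (z (Fin.last n)) hX v ∈ coindDeg s G c := by
  intro σ
  change (H.coindY j v).1 σ - z (Fin.last n) (v.1 σ) ∈ G c
  rw [ExtRep.coindY_apply]
  by_cases h : σ (Fin.last n) = j
  · have : σ⁻¹ j = Fin.last n := by rw [Equiv.Perm.inv_eq_iff_eq, h]
    rw [this, tLast_last, LinearMap.zero_apply, sub_zero, sub_self]
    exact zero_mem _
  · rw [hj σ h, map_zero, map_zero, zero_sub, sub_zero]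
    exact neg_mem (HG.tLast_mem _ (hv _))

/-- On the functions supported at j the leading term of χ(y_j) is the power of the variable whose
exponent is the level; the projections reassemble v. -/
theorem chiMap_sub_mem (hX : ∀ τ, s τ * z (Fin.last n) = z (Fin.last n) * s τ)
    (c : ℕ) {v : Coind s} (hv : v ∈ coindDeg s G (c + 1)) :
    H.chiMap C v - (coindMap (z (Fin.last n)) hX ^ C.level) v ∈ coindDeg s G (c + C.level) := by
  rw [ExtRep.chiMap_apply]
  conv in (coindMap _ _ ^ _) v => rw [← sum_projAt v, map_sum]
  rw [← Finset.sum_sub_distrib]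
  refine sum_mem fun j _ => ?_
  have hmono : Monotone (coindDeg s G) := fun a b hab v hv σ => HG.mono hab (hv σ)
  -- Multiplication by the variable keeps the support at j, whereas the corrections in y_j leave it;
  -- hence `E` carries the support condition and `W` does not. The shift by one in `E` records that
  -- errors are one degree below the leading term.
  refine chiElt_sub_pow_mem C (E := fun c => suppAt s j ⊓ coindDeg s G (c + 1))
    (W := coindDeg s G) (fun c => inf_le_right) hmono ?_ ?_ ?_ ?_ ?_
  · exact fun c e he => ⟨fun σ hσ => (congrArg (z (Fin.last n)) (he.1 σ hσ)).trans (map_zero _),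
      fun σ => HG.X_mem _ _ (he.2 σ)⟩
  · exact fun c e he => HG.coindY_sub_mem H hX j _ he.2 he.1
  · exact fun c e he => HG.coindY_mem H j c he
  · exact fun l m c e he σ => HG.f_mem _ _ _ _ (he σ)
  · refine ⟨projAt_mem j v, fun σ => ?_⟩
    rw [projAt_apply]
    split_ifs
    · exact hv σ
    · exact zero_mem _

/-- Division by an operator whose leading term is a power of the variable: the remainders are the
functions with values of degree below the level, and the values of `X'` provide the quotients. -/
theorem isCompl_range_chiMap (hX : ∀ τ, s τ * z (Fin.last n) = z (Fin.last n) * s τ) :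
    IsCompl (coindDeg s G C.level) (LinearMap.range (H.chiMap C)) := by
  refine isCompl_range_of_filtration (W := coindDeg s G) (fun a b hab v hv σ => HG.mono hab (hv σ)) ?_
    HG.coindDeg_exhaust (X := coindMap (z (Fin.last n)) hX ^ C.level)
    (fun c v hv => HG.chiMap_sub_mem H C hX c hv) (fun c v hv σ => ?_) (fun c v hv => ?_)
  · rw [eq_bot_iff]
    intro v hv
    rw [Submodule.mem_bot]
    ext σ
    have := hv σ
    rw [HG.zero, Submodule.mem_bot] at this
    exact this
  · have h := HG.X'_pow_mem C.level c _ (hv σ)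
    rwa [coindMap_pow_apply, ← Module.End.mul_apply, HG.X'_pow_X_pow] at h
  · refine ⟨(coindMap X' HG.s_X' ^ C.level) v, fun σ => ?_, fun σ => ?_⟩
    · rw [coindMap_pow_apply]
      exact HG.X'_pow_mem _ _ _ (hv σ)
    · change v.1 σ - _ ∈ _
      rw [coindMap_pow_apply, coindMap_pow_apply]
      exact HG.X_pow_X'_pow _ _

theorem coindMk_mem {c : ℕ} {e : Fin (n + 1) → E} (he : ∀ j, e j ∈ G c) :
    H.coindMk e ∈ coindDeg s G c := fun _ => HG.s_mem _ _ _ (he _)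

end DegFiltration

end FilteredCoinduction

/-! ### Polynomials with coefficients in F ⊗ A_n. -/

section CyclotomicModel

variable {k : Type u₁} [CommRing k] {F : Type u₂} [Ring F] [Algebra k F]
  {𝒻 : Gr → Submodule k F} [GradedAlgebra 𝒻]

section Coefficientwise

variable {U : Type*} [AddCommGroup U] [Module k U]

/-- Endomorphisms acting on the coefficients of polynomials. -/
noncomputable def coeffwise : Module.End k U →ₐ[k] Module.End k (ℕ →₀ U) :=
  AlgHom.ofLinearMap
    { toFun := fun T => Finsupp.mapRange.linearMap T
      map_add' := fun S T => by ext; simp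
      map_smul' := fun c T => by ext; simp }
    (by ext; simp) (fun S T => by ext; simp)

theorem coeffwise_apply (T : Module.End k U) (e : ℕ →₀ U) (a : ℕ) : coeffwise T e a = T (e a) := rfl

theorem coeffwise_single (T : Module.End k U) (a : ℕ) (u : U) :
    coeffwise T (Finsupp.single a u) = Finsupp.single a (T u) :=
  Finsupp.mapRange_single (hf := map_zero T)

variable (k U) in
/-- The multiplication by the variable. -/
noncomputable def shiftUp : Module.End k (ℕ →₀ U) := Finsupp.lmapDomain U k Nat.succ

variable (k U) in
/-- The removal of the constant term followed by the division by the variable. -/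
noncomputable def shiftDown : Module.End k (ℕ →₀ U) :=
  Finsupp.lcomapDomain Nat.succ Nat.succ_injective

theorem shiftUp_single (a : ℕ) (u : U) :
    shiftUp k U (Finsupp.single a u) = Finsupp.single (a + 1) u :=
  Finsupp.mapDomain_single

theorem shiftUp_apply_succ (e : ℕ →₀ U) (a : ℕ) : shiftUp k U e (a + 1) = e a :=
  Finsupp.mapDomain_apply Nat.succ_injective e a

theorem shiftDown_apply (e : ℕ →₀ U) (a : ℕ) : shiftDown k U e a = e (a + 1) := rfl

theorem coeffwise_shiftUp (T : Module.End k U) :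
    coeffwise T * shiftUp k U = shiftUp k U * coeffwise T := by
  ext a u : 2
  simp [shiftUp_single, coeffwise_single]

theorem coeffwise_shiftDown (T : Module.End k U) :
    coeffwise T * shiftDown k U = shiftDown k U * coeffwise T := by
  refine LinearMap.ext fun e => Finsupp.ext fun a => ?_
  rfl

/-- The polynomials of degree less than `c`. -/
def polyDeg (k : Type*) [CommRing k] (U : Type*) [AddCommGroup U] [Module k U] (c : ℕ) :
    Submodule k (ℕ →₀ U) where
  carrier := {e | ∀ a, c ≤ a → e a = 0}
  add_mem' hu hv a ha := by rw [Finsupp.add_apply, hu a ha, hv a ha, add_zero]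
  zero_mem' _ _ := rfl
  smul_mem' r _ hv a ha := by rw [Finsupp.smul_apply, hv a ha, smul_zero]

theorem coeffwise_mem (T : Module.End k U) (c : ℕ) :
    ∀ e ∈ polyDeg k U c, coeffwise T e ∈ polyDeg k U c :=
  fun e he a ha => by rw [coeffwise_apply, he a ha, map_zero]

end Coefficientwise

namespace FrobeniusSuperalgebra

variable (D : FrobeniusSuperalgebra 𝒻)

theorem repr_eq_tr (a : F) (b : Fin D.dim) : D.B.repr a b = D.tr (D.dual b * a) := by
  conv_rhs => rw [← D.B.sum_repr a]
  simp only [Finset.mul_sum, mul_smul_comm, map_sum, map_smul, D.tr_dual, smul_eq_mul,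
    mul_ite, mul_one, mul_zero, Finset.sum_ite_eq, Finset.mem_univ, if_true]

theorem repr_eq_zero {p : Gr} {a : F} (ha : a ∈ 𝒻 p) {b : Fin D.dim} (hb : D.deg b ≠ p) :
    D.B.repr a b = 0 := by
  rw [repr_eq_tr]
  refine D.tr_homogeneous _ _ (SetLike.mul_mem_graded (D.dual_mem b) ha) fun h => hb ?_
  rw [sub_add_eq_add_sub, sub_eq_iff_eq_add] at h
  exact (add_left_cancel h).symm

/-- The projection to the elements of a given parity. -/
noncomputable def parityProj (ε : ZMod 2) : Module.End k F :=
  D.B.constr k fun b => if (D.deg b).2 = ε then D.B b else 0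

theorem parityProj_of_mem (ε : ZMod 2) {p : Gr} {a : F} (ha : a ∈ 𝒻 p) :
    D.parityProj ε a = if p.2 = ε then a else 0 := by
  rw [parityProj, Module.Basis.constr_apply_fintype]
  have h : ∀ b, D.B.equivFun a b • (if (D.deg b).2 = ε then D.B b else 0) =
      if p.2 = ε then D.B.equivFun a b • D.B b else 0 := by
    intro b
    by_cases hb : D.deg b = p
    · rw [hb]; split_ifs <;> simp
    · simp [Module.Basis.equivFun_apply, D.repr_eq_zero ha hb]
  simp only [h]
  split_ifs
  · exact D.B.sum_equivFun a
  · simp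

end FrobeniusSuperalgebra

variable {D : FrobeniusSuperalgebra 𝒻} (C : CycParam D) (n : ℕ)

theorem parityInv_algebraMap (r : k) :
    parityInv (cycPiece n C) (algebraMap k (Cyc n C) r) = algebraMap k (Cyc n C) r := by
  rw [parityInv_of_mem (p := 0) (SetLike.algebraMap_mem_graded (cycPiece n C) r)]
  exact one_smul _ _

/-- The parity involution as an algebra homomorphism. -/
noncomputable def parityHom : Cyc n C →ₐ[k] Cyc n C :=
  { parityInv (cycPiece n C) with commutes' := parityInv_algebraMap C n }

theorem parityHom_of_mem {p : Gr} {a : Cyc n C} (ha : a ∈ cycPiece n C p) :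
    parityHom C n a = sgn p.2 • a := parityInv_of_mem ha

/-- The coefficients of the polynomials on which the affine wreath product algebra of one more
letter acts. -/
abbrev Coeff : Type _ := F ⊗[k] Cyc n C

variable {C n}

theorem coeff_ext {M : Type*} [AddCommGroup M] [Module k M] {S T : Coeff C n →ₗ[k] M}
    (h : ∀ p, ∀ x ∈ 𝒻 p, ∀ m, S (x ⊗ₜ m) = T (x ⊗ₜ m)) : S = T := by
  refine TensorProduct.ext (LinearMap.ext fun x => LinearMap.ext fun m => ?_)
  exact FRep.ext_homogeneous (𝒻 := 𝒻) (φ := S ∘ₗ (TensorProduct.mk k F (Cyc n C)).flip m)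
    (χ := T ∘ₗ (TensorProduct.mk k F (Cyc n C)).flip m) (fun p x hx => h p x hx m) x

variable (C n)

/-- The map `x ⊗ m ↦ (-1) ^ (ā x̄) x ⊗ a m`. -/
noncomputable def actFun (a : Cyc n C) : Module.End k (Coeff C n) :=
  TensorProduct.map (D.parityProj 0) (LinearMap.mulLeft k a) +
    TensorProduct.map (D.parityProj 1) (LinearMap.mulLeft k (parityHom C n a))

theorem actFun_tmul_of_mem {q : Gr} {x : F} (hx : x ∈ 𝒻 q) (a m : Cyc n C) :
    actFun C n a (x ⊗ₜ m) = x ⊗ₜ ((if q.2 = 0 then a else parityHom C n a) * m) := by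
  rw [actFun, LinearMap.add_apply, TensorProduct.map_tmul, TensorProduct.map_tmul,
    D.parityProj_of_mem _ hx, D.parityProj_of_mem _ hx]
  have h : ∀ ε : ZMod 2, ε = 0 ∨ ε = 1 := by decide
  rcases h q.2 with h | h
  · simp [h]
  · simp [h]

/-- The action of the cyclotomic wreath product algebra on the coefficients. -/
noncomputable def act : Cyc n C →ₐ[k] Module.End k (Coeff C n) :=
  AlgHom.ofLinearMap
    { toFun := actFun C n
      map_add' := fun a b => coeff_ext fun p x hx m => by
        rw [LinearMap.add_apply]
        simp only [actFun_tmul_of_mem C n hx, map_add, ← TensorProduct.tmul_add, ← add_mul]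
        split_ifs <;> rfl
      map_smul' := fun c a => coeff_ext fun p x hx m => by
        rw [RingHom.id_apply, LinearMap.smul_apply]
        simp only [actFun_tmul_of_mem C n hx, map_smul, ← TensorProduct.tmul_smul,
          ← smul_mul_assoc]
        split_ifs <;> rfl }
    (coeff_ext fun p x hx m => by
      change actFun C n 1 _ = _
      simp [actFun_tmul_of_mem C n hx])
    (fun a b => coeff_ext fun p x hx m => by
      change actFun C n (a * b) _ = actFun C n a (actFun C n b _)
      simp only [actFun_tmul_of_mem C n hx, map_mul, ← mul_assoc]
      split_ifs <;> rfl)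

variable {C n}

theorem act_tmul_of_mem {q : Gr} {x : F} (hx : x ∈ 𝒻 q) (a m : Cyc n C) :
    act C n a (x ⊗ₜ m) = x ⊗ₜ ((if q.2 = 0 then a else parityHom C n a) * m) :=
  actFun_tmul_of_mem C n hx a m

theorem act_tmul {p q : Gr} {x : F} (hx : x ∈ 𝒻 q) {a : Cyc n C} (ha : a ∈ cycPiece n C p)
    (m : Cyc n C) : act C n a (x ⊗ₜ m) = sgn (p.2 * q.2) • (x ⊗ₜ[k] (a * m)) := by
  rw [act_tmul_of_mem hx, parityHom_of_mem C n ha]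
  have h : ∀ ε : ZMod 2, ε = 0 ∨ ε = 1 := by decide
  rcases h q.2 with h | h
  · simp [h, sgn_zero]
  · simp only [h, mul_one, one_ne_zero, if_false, smul_mul_assoc]
    exact map_zsmul (TensorProduct.mk k F (Cyc n C) x) (sgn p.2) (a * m)

/-- For even elements the sign disappears, so the formula holds for all x, homogeneous or not. -/
theorem act_even {r : ℤ} {a : Cyc n C} (ha : a ∈ cycPiece n C (r, 0)) (x : F) (m : Cyc n C) :
    act C n a (x ⊗ₜ m) = x ⊗ₜ[k] (a * m) :=
  FRep.ext_homogeneous (𝒻 := 𝒻) (φ := act C n a ∘ₗ (TensorProduct.mk k F (Cyc n C)).flip m)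
    (χ := (TensorProduct.mk k F (Cyc n C)).flip (a * m)) (fun p x hx => by
      change act C n a (x ⊗ₜ m) = x ⊗ₜ[k] (a * m)
      rw [act_tmul hx ha, zero_mul, sgn_zero, one_smul]) x

theorem act_one_tmul (a m : Cyc n C) : act C n a (1 ⊗ₜ m) = 1 ⊗ₜ[k] (a * m) := by
  rw [act_tmul_of_mem (SetLike.one_mem_graded 𝒻)]
  simp

variable (C n)

/-- The action of `F` on the coefficients. -/
noncomputable def lmulF : F →ₐ[k] Module.End k (Coeff C n) :=
  AlgHom.ofLinearMap
    { toFun := fun a => LinearMap.rTensor (Cyc n C) (LinearMap.mulLeft k a)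
      map_add' := fun a b => TensorProduct.ext' fun x m => by
        simp [add_mul, TensorProduct.add_tmul]
      map_smul' := fun c a => TensorProduct.ext' fun x m => by
        simp [TensorProduct.smul_tmul'] }
    (TensorProduct.ext' fun x m => by simp)
    (fun a b => TensorProduct.ext' fun x m => by simp)

variable {C n}

theorem lmulF_tmul (a x : F) (m : Cyc n C) : lmulF C n a (x ⊗ₜ m) = (a * x) ⊗ₜ[k] m := rfl

theorem act_mul_lmulF {p q : Gr} {a : Cyc n C} (ha : a ∈ cycPiece n C p) {b : F} (hb : b ∈ 𝒻 q) :
    act C n a * lmulF C n b = sgn (p.2 * q.2) • (lmulF C n b * act C n a) := by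
  refine coeff_ext fun r x hx m => ?_
  rw [LinearMap.smul_apply, Module.End.mul_apply, Module.End.mul_apply, lmulF_tmul,
    act_tmul (SetLike.mul_mem_graded hb hx) ha, act_tmul hx ha, map_zsmul, lmulF_tmul, smul_smul,
    ← sgn_add, ← mul_add]
  rfl

theorem act_mul_lmulF_even {r : ℤ} {a : Cyc n C} (ha : a ∈ cycPiece n C (r, 0)) (b : F) :
    act C n a * lmulF C n b = lmulF C n b * act C n a := by
  refine TensorProduct.ext' fun x m => ?_
  rw [Module.End.mul_apply, Module.End.mul_apply, lmulF_tmul, act_even ha, act_even ha, lmulF_tmul]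

variable (C n)

/-- The action of the inverse of the Nakayama automorphism on the coefficients. -/
noncomputable def psiInv : Module.End k (Coeff C n) :=
  LinearMap.rTensor (Cyc n C) D.ψ.symm.toLinearMap

/-- The action of the Nakayama automorphism on the coefficients. -/
noncomputable def psiMap : Module.End k (Coeff C n) :=
  LinearMap.rTensor (Cyc n C) D.ψ.toLinearMap

variable {C n}

theorem psiInv_tmul (x : F) (m : Cyc n C) : psiInv C n (x ⊗ₜ m) = D.ψ.symm x ⊗ₜ[k] m := rfl

theorem psiMap_tmul (x : F) (m : Cyc n C) : psiMap C n (x ⊗ₜ m) = D.ψ x ⊗ₜ[k] m := rfl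

theorem psiMap_mul_psiInv : psiMap C n * psiInv C n = 1 :=
  TensorProduct.ext' fun x m => by simp [psiMap_tmul, psiInv_tmul]

theorem psiInv_mul_psiMap : psiInv C n * psiMap C n = 1 :=
  TensorProduct.ext' fun x m => by simp [psiMap_tmul, psiInv_tmul]

/-- This is the relation f x = x ψ(f), and the reason why the variable has to act as the shift
combined with the inverse of ψ. -/
theorem lmulF_mul_psiInv (a : F) : lmulF C n a * psiInv C n = psiInv C n * lmulF C n (D.ψ a) :=
  TensorProduct.ext' fun x m => by simp [lmulF_tmul, psiInv_tmul]

theorem act_mul_psiMap (a : Cyc n C) : act C n a * psiMap C n = psiMap C n * act C n a := by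
  refine coeff_ext fun p x hx m => ?_
  rw [Module.End.mul_apply, Module.End.mul_apply, psiMap_tmul, act_tmul_of_mem (D.ψ_mem _ _ hx),
    act_tmul_of_mem hx, psiMap_tmul]

theorem act_mul_psiInv (a : Cyc n C) : act C n a * psiInv C n = psiInv C n * act C n a := by
  calc act C n a * psiInv C n
      = psiInv C n * psiMap C n * (act C n a * psiInv C n) := by rw [psiInv_mul_psiMap, one_mul]
    _ = psiInv C n * (act C n a * psiMap C n) * psiInv C n := by
      rw [act_mul_psiMap]; simp only [mul_assoc]
    _ = _ := by rw [mul_assoc, mul_assoc, psiMap_mul_psiInv, mul_one]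

theorem cyc_mem_of_gen (S : Subalgebra k (Cyc n C)) (h : ∀ u, gen n C u ∈ S) (y : Cyc n C) :
    y ∈ S := by
  obtain ⟨y, rfl⟩ : ∃ z, cycMk n C z = y := RingQuot.mkAlgHom_surjective k (CycRel n C) y
  obtain ⟨y, rfl⟩ : ∃ z, affMk D n z = y := RingQuot.mkAlgHom_surjective k (AffRel D n) y
  induction y using FreeAlgebra.induction with
  | grade0 r => rw [AlgHom.commutes, AlgHom.commutes]; exact S.algebraMap_mem r
  | grade1 u => exact h u
  | mul a b ha hb => rw [map_mul, map_mul]; exact S.mul_mem ha hb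
  | add a b ha hb => rw [map_add, map_add]; exact S.add_mem ha hb

theorem tElt_gen_mem (i j : Fin n) :
    tElt D (fun i a => gen n C (.f i a)) i j ∈ cycPiece n C ((D.δ : ℤ), 0) := by
  refine sum_mem fun b _ => ?_
  have := cycPiece_mul C (gen_hom_mem C (.f i _ _ (D.B_mem b)))
    (gen_hom_mem C (.f j _ _ (D.dual_mem b)))
  rwa [add_sub_cancel] at this

theorem yElt_gen_mem (i : Fin n) : yElt D (gen n C) i ∈ cycPiece n C ((D.δ : ℤ), 0) := by
  refine sub_mem (gen_hom_mem C (.x i)) (sum_mem fun l _ => ?_)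
  have := cycPiece_mul C (tElt_gen_mem (C := C) l i) (gen_hom_mem C (.s (Equiv.swap l i)))
  rwa [add_zero] at this

/-- The first Jucys–Murphy element is an empty sum, so χ vanishes at the first y, and the values at
the other letters are conjugate to it. -/
theorem chiElt_yElt (i : Fin n) :
    chiElt C (yElt D (gen n C) i) (fun a => gen n C (.f i a)) = 0 := by
  have h0 : 0 < n := i.pos
  refine (isRep_gen C).yRep.chiElt_eq_zero C ⟨0, h0⟩ ?_ i
  have : yElt D (gen n C) ⟨0, h0⟩ = gen n C (.x ⟨0, h0⟩) := by
    rw [yElt, jm, Finset.sum_eq_zero, sub_zero]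
    intro l hl
    exact absurd (Finset.mem_Iio.1 hl) (by simp [Fin.lt_def])
  rw [this]
  exact chi_gen C h0

end CyclotomicModel

/-! ### The module over A_n and the affine algebra of one letter. -/

section CyclotomicModule

variable {k : Type u₁} [CommRing k] {F : Type u₂} [Ring F] [Algebra k F]
  {𝒻 : Gr → Submodule k F} [GradedAlgebra 𝒻] {D : FrobeniusSuperalgebra 𝒻} (C : CycParam D) (n : ℕ)

/-- The elements `y i` and the variable, acting on polynomials. -/
noncomputable def modelZ : Fin (n + 1) → Module.End k (ℕ →₀ Coeff C n) :=
  Fin.lastCases (shiftUp k (Coeff C n) * coeffwise (psiInv C n))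
    (fun i => coeffwise (act C n (yElt D (gen n C) i)))

/-- The elements of `F` acting on the coefficients. -/
noncomputable def coeffF (i : Fin (n + 1)) (a : F) : Module.End k (Coeff C n) :=
  Fin.lastCases (motive := fun _ => Module.End k (Coeff C n)) (lmulF C n a)
    (fun i => act C n (gen n C (.f i a))) i

/-- The elements of `F` acting on polynomials. -/
noncomputable def modelF (i : Fin (n + 1)) (a : F) : Module.End k (ℕ →₀ Coeff C n) :=
  coeffwise (coeffF C n i a)

/-- The permutations acting on polynomials. -/
noncomputable def modelS (τ : Equiv.Perm (Fin n)) : Module.End k (ℕ →₀ Coeff C n) :=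
  coeffwise (act C n (gen n C (.s τ)))

variable {C n}

theorem modelZ_last :
    modelZ C n (Fin.last n) = shiftUp k (Coeff C n) * coeffwise (psiInv C n) := by
  rw [modelZ, Fin.lastCases_last]

theorem modelZ_castSucc (i : Fin n) :
    modelZ C n i.castSucc = coeffwise (act C n (yElt D (gen n C) i)) := by
  rw [modelZ, Fin.lastCases_castSucc]

theorem coeffF_last (a : F) : coeffF C n (Fin.last n) a = lmulF C n a := by
  rw [coeffF, Fin.lastCases_last]

theorem coeffF_castSucc (i : Fin n) (a : F) :
    coeffF C n i.castSucc a = act C n (gen n C (.f i a)) := by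
  rw [coeffF, Fin.lastCases_castSucc]

theorem coeffF_fRep : FRep 𝒻 (coeffF C n) := by
  have H := isRep_gen (n := n) C
  refine ⟨fun i a b => ?_, fun i c a => ?_, fun i => ?_, fun i a b => ?_,
    fun i j hij p q a b ha hb => ?_⟩
  · induction i using Fin.lastCases with
    | last => simp only [coeffF_last, map_add]
    | cast i => simp only [coeffF_castSucc, H.f_add, map_add]
  · induction i using Fin.lastCases with
    | last => simp only [coeffF_last, map_smul]
    | cast i => simp only [coeffF_castSucc, H.f_smul, map_smul]
  · induction i using Fin.lastCases with
    | last => simp only [coeffF_last, map_one]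
    | cast i => simp only [coeffF_castSucc, H.f_one, map_one]
  · induction i using Fin.lastCases with
    | last => simp only [coeffF_last, map_mul]
    | cast i => simp only [coeffF_castSucc, H.f_mul, map_mul]
  · induction i using Fin.lastCases with
    | last =>
      induction j using Fin.lastCases with
      | last => exact absurd rfl hij
      | cast j =>
        rw [coeffF_last, coeffF_castSucc, act_mul_lmulF (gen_hom_mem C (.f j _ _ hb)) ha,
          smul_smul, mul_comm q.2, sgn_mul_self, one_smul]
    | cast i =>
      induction j using Fin.lastCases with
      | last =>
        rw [coeffF_last, coeffF_castSucc, act_mul_lmulF (gen_hom_mem C (.f i _ _ ha)) hb]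
      | cast j =>
        rw [coeffF_castSucc, coeffF_castSucc, ← map_mul,
          H.f_comm i j (fun h => hij (congrArg _ h)) p q a b ha hb, map_zsmul, map_mul]

theorem coeffwise_act_mul_modelZ_last (a : Cyc n C) :
    coeffwise (act C n a) * modelZ C n (Fin.last n) =
      modelZ C n (Fin.last n) * coeffwise (act C n a) := by
  rw [modelZ_last, ← mul_assoc, coeffwise_shiftUp, mul_assoc, mul_assoc, ← map_mul,
    act_mul_psiInv, map_mul]

theorem tElt_modelF (i j : Fin n) : tElt D (modelF C n) i.castSucc j.castSucc =
    coeffwise (act C n (tElt D (fun i a => gen n C (.f i a)) i j)) := by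
  simp only [tElt, modelF, coeffF_castSucc, map_sum, map_mul]

/-- The first n letters act through A_n on the right tensor factor of the coefficients, the last
letter acts through F and the twisted shift. The sign in `act` makes the two actions supercommute;
the y_i and the permutations are even and commute with the last letter. -/
theorem model_extRep : ExtRep D (modelZ C n) (modelF C n) (modelS C n) := by
  have H := isRep_gen (n := n) C
  have Y := H.yRep
  have hF := coeffF_fRep (C := C) (n := n)
  exact
  { f_add := fun i a b => by simp only [modelF, hF.f_add, map_add]
    f_smul := fun i c a => by simp only [modelF, hF.f_smul, map_smul]
    f_one := fun i => by simp only [modelF, hF.f_one, map_one]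
    f_mul := fun i a b => by simp only [modelF, hF.f_mul, map_mul]
    f_comm := fun i j hij p q a b ha hb => by
      simp only [modelF, ← map_mul]
      rw [hF.f_comm i j hij p q a b ha hb, map_zsmul]
    s_one := by simp only [modelS, H.s_one, map_one]
    s_mul := fun π σ => by simp only [modelS, H.s_mul, map_mul]
    sf := fun π i a => by
      simp only [modelS, modelF, ← map_mul]
      congr 1
      induction i using Fin.lastCases with
      | last =>
        rw [extPerm_last, coeffF_last]
        exact act_mul_lmulF_even (gen_hom_mem C (.s π)) a
      | cast i => rw [extPerm_castSucc, coeffF_castSucc, coeffF_castSucc, ← map_mul, ← map_mul, H.sf]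
    fz_same := fun i a => by
      induction i using Fin.lastCases with
      | last =>
        rw [modelZ_last]
        simp only [modelF, coeffF_last]
        rw [← mul_assoc, coeffwise_shiftUp, mul_assoc, mul_assoc, ← map_mul, lmulF_mul_psiInv,
          map_mul]
      | cast i =>
        simp only [modelF, coeffF_castSucc, modelZ_castSucc, ← map_mul]
        rw [Y.fy_same]
    fz_ne := fun i j hij a => by
      induction i using Fin.lastCases with
      | last =>
        induction j using Fin.lastCases with
        | last => exact absurd rfl hij
        | cast j =>
          simp only [modelF, coeffF_castSucc]
          exact coeffwise_act_mul_modelZ_last _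
      | cast i =>
        simp only [modelZ_castSucc, modelF, ← map_mul]
        congr 1
        induction j using Fin.lastCases with
        | last => rw [coeffF_last, act_mul_lmulF_even (yElt_gen_mem i)]
        | cast j =>
          rw [coeffF_castSucc, ← map_mul, ← map_mul, Y.fy_ne i j (fun h => hij (congrArg _ h))]
    sz := fun π i => by
      induction i using Fin.lastCases with
      | last =>
        rw [extPerm_last]
        exact coeffwise_act_mul_modelZ_last _
      | cast i =>
        rw [extPerm_castSucc]
        simp only [modelZ_castSucc, modelS, ← map_mul]
        rw [Y.sy]
    zz := fun i j hij => by
      have h := congrArg (fun a => coeffwise (act C n a)) (Y.yy i j hij)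
      simpa only [map_sub, map_mul, modelZ_castSucc, modelS, tElt_modelF] using h
    zz_last := fun i => by
      rw [modelZ_castSucc]
      exact coeffwise_act_mul_modelZ_last _ }

theorem chiElt_model (i : Fin n) :
    chiElt C (modelZ C n i.castSucc) (modelF C n i.castSucc) = 0 := by
  have h := map_chiElt C (A' := Module.End k (ℕ →₀ Coeff C n)) (((coeffwise (U := Coeff C n)).comp (act C n) :
    Cyc n C →ₐ[k] Module.End k (ℕ →₀ Coeff C n)) : Cyc n C →+* Module.End k (ℕ →₀ Coeff C n)) (yElt D (gen n C) i) (fun a => gen n C (.f i a))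
  rw [chiElt_yElt, map_zero] at h
  rw [h, modelZ_castSucc]
  congr 1
  funext a
  simp only [modelF, coeffF_castSucc]
  rfl

theorem shiftDown_mul_shiftUp {U : Type*} [AddCommGroup U] [Module k U] :
    shiftDown k U * shiftUp k U = 1 :=
  LinearMap.ext fun e => Finsupp.ext fun a => shiftUp_apply_succ e a

theorem model_degFiltration : DegFiltration (modelZ C n) (modelF C n) (modelS C n)
    (polyDeg k (Coeff C n)) (coeffwise (psiMap C n) * shiftDown k (Coeff C n)) where
  mono a b hab e he i hi := he i (hab.trans hi)
  zero := by
    rw [eq_bot_iff]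
    intro e he
    rw [Submodule.mem_bot]
    ext i
    rw [he i (Nat.zero_le i)]
    rfl
  exhaust e := by
    refine ⟨e.support.sup id + 1, fun a ha => ?_⟩
    by_contra h
    have := Finset.le_sup (f := id) (Finsupp.mem_support_iff.2 h)
    rw [id] at this
    omega
  z_mem i c := by
    rw [modelZ_castSucc]
    exact coeffwise_mem _ c
  f_mem i a c := coeffwise_mem _ c
  s_mem τ c := coeffwise_mem _ c
  X_mem c e he a ha := by
    rw [modelZ_last, Module.End.mul_apply]
    obtain ⟨a, rfl⟩ : ∃ b, a = b + 1 := ⟨a - 1, by omega⟩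
    rw [shiftUp_apply_succ, coeffwise_apply, he a (by omega), map_zero]
  X'_mem c e he a ha := by
    rw [Module.End.mul_apply, coeffwise_apply, shiftDown_apply, he _ (by omega), map_zero]
  X'_X := by
    rw [modelZ_last, mul_assoc, ← mul_assoc (shiftDown k _), shiftDown_mul_shiftUp, one_mul,
      ← map_mul, psiMap_mul_psiInv, map_one]
  X_X' e a ha := by
    obtain ⟨a, rfl⟩ : ∃ b, a = b + 1 := ⟨a - 1, by omega⟩
    rw [modelZ_last, Finsupp.sub_apply, Module.End.mul_apply, shiftUp_apply_succ,
      Module.End.mul_apply, ← Module.End.mul_apply, ← map_mul, psiInv_mul_psiMap, map_one]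
    exact sub_self _
  s_X' τ := by
    rw [modelS, ← mul_assoc, ← map_mul, act_mul_psiMap, map_mul, mul_assoc, mul_assoc,
      coeffwise_shiftDown]

theorem model_generated (R : Submodule k (ℕ →₀ Coeff C n))
    (h0 : Finsupp.single 0 (1 ⊗ₜ 1) ∈ R) (hz : ∀ i, ∀ e ∈ R, modelZ C n i e ∈ R)
    (hf : ∀ i a, ∀ e ∈ R, modelF C n i a e ∈ R) (hs : ∀ τ, ∀ e ∈ R, modelS C n τ e ∈ R) :
    R = ⊤ := by
  let S : Subalgebra k (Cyc n C) :=
    { carrier := {a | ∀ e ∈ R, coeffwise (act C n a) e ∈ R}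
      mul_mem' := fun {a b} ha hb e he => by
        rw [map_mul, map_mul]; exact ha _ (hb e he)
      add_mem' := fun {a b} ha hb e he => by
        rw [map_add, map_add]; exact add_mem (ha e he) (hb e he)
      algebraMap_mem' := fun r e he => by
        rw [AlgHom.commutes, AlgHom.commutes, Module.algebraMap_end_apply]
        exact R.smul_mem r he }
  have hS : ∀ a, a ∈ S := by
    have hsS : ∀ τ, gen n C (.s τ) ∈ S := hs
    have hfS : ∀ i a, gen n C (.f i a) ∈ S := fun i a e he => by
      have := hf i.castSucc a e he
      rwa [modelF, coeffF_castSucc] at this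
    refine cyc_mem_of_gen S fun u => ?_
    cases u with
    | x i =>
      have hy : yElt D (gen n C) i ∈ S := fun e he => by
        have := hz i.castSucc e he
        rwa [modelZ_castSucc] at this
      rw [← sub_add_cancel (gen n C (.x i)) (jm D (fun i a => gen n C (.f i a))
        (fun π => gen n C (.s π)) i)]
      refine add_mem hy (sum_mem fun l _ => mul_mem (sum_mem fun b _ => ?_) (hsS _))
      exact mul_mem (hfS _ _) (hfS _ _)
    | f i a => exact hfS i a
    | s π => exact hsS π
  have h1 : ∀ (x : F) (m : Cyc n C), Finsupp.single 0 (x ⊗ₜ m) ∈ R := by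
    intro x m
    have h2 := hf (Fin.last n) x _ (hS m _ h0)
    rwa [coeffwise_single, act_one_tmul, mul_one, modelF, coeffF_last, coeffwise_single, lmulF_tmul,
      mul_one] at h2
  have h2 : ∀ u : Coeff C n, Finsupp.single 0 u ∈ R := by
    intro u
    induction u using TensorProduct.induction_on with
    | zero => rw [Finsupp.single_zero]; exact zero_mem _
    | tmul x m => exact h1 x m
    | add u v hu hv => rw [Finsupp.single_add]; exact add_mem hu hv
  have h3 : ∀ (c : ℕ) (u : Coeff C n), Finsupp.single c u ∈ R := by
    intro c
    induction c with
    | zero => exact h2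
    | succ c ih =>
      intro u
      -- ψ is applied to the coefficient beforehand in order to undo the twist in the last z.
      have h4 := hz (Fin.last n) _ (ih (psiMap C n u))
      rwa [modelZ_last, Module.End.mul_apply, coeffwise_single, shiftUp_single,
        ← Module.End.mul_apply, psiInv_mul_psiMap] at h4
  rw [eq_top_iff]
  rintro e -
  induction e using Finsupp.induction_linear with
  | zero => exact zero_mem _
  | add u v hu hv => exact add_mem hu hv
  | single c u => exact h3 c u

end CyclotomicModule

/-! ### From stable submodules to modules over the cyclotomic algebra. -/

section Quotient

variable {k : Type u₁} [CommRing k] {F : Type u₂} [Ring F] [Algebra k F]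
  {𝒻 : Gr → Submodule k F} [GradedAlgebra 𝒻] {D : FrobeniusSuperalgebra 𝒻}

theorem IsRep.of_injective {A A' : Type*} [Ring A] [Algebra k A] [Ring A'] [Algebra k A']
    {Φ : A →ₐ[k] A'} (hΦ : Function.Injective Φ) {n : ℕ} {g : Gen F n → A}
    (h : IsRep D fun u => Φ (g u)) : IsRep D g where
  x_comm i j := hΦ (by simpa only [map_mul] using h.x_comm i j)
  f_add i a b := hΦ (by simpa only [map_add] using h.f_add i a b)
  f_smul i c a := hΦ (by simpa only [map_smul] using h.f_smul i c a)
  f_one i := hΦ (by simpa only [map_one] using h.f_one i)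
  f_mul i a b := hΦ (by simpa only [map_mul] using h.f_mul i a b)
  f_comm i j hij p q a b ha hb := hΦ (by
    simpa only [map_zsmul, map_mul] using h.f_comm i j hij p q a b ha hb)
  s_one := hΦ (by simpa only [map_one] using h.s_one)
  s_mul π σ := hΦ (by simpa only [map_mul] using h.s_mul π σ)
  fx_same i a := hΦ (by simpa only [map_mul] using h.fx_same i a)
  fx_ne i j hij a := hΦ (by simpa only [map_mul] using h.fx_ne i j hij a)
  sx_ne i i' j hi hj hj' := hΦ (by simpa only [map_mul] using h.sx_ne i i' j hi hj hj')
  sx i i' hi := hΦ (by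
    have ht : Φ (tElt D (fun j a => g (.f j a)) i i') = tElt D (fun j a => Φ (g (.f j a))) i i' :=
      map_tElt (Φ : A →+* A') _ i i'
    simpa only [map_mul, map_sub, ht] using h.sx i i' hi)
  sf π i a := hΦ (by simpa only [map_mul] using h.sf π i a)

variable {V : Type*} [AddCommGroup V] [Module k V]

/-- The endomorphisms preserving a submodule. -/
def endStable (K : Submodule k V) : Subalgebra k (Module.End k V) where
  carrier := {T | ∀ v ∈ K, T v ∈ K}
  mul_mem' hS hT v hv := hS _ (hT v hv)
  add_mem' hS hT v hv := add_mem (hS v hv) (hT v hv)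
  algebraMap_mem' r v hv := by
    rw [Module.algebraMap_end_apply]
    exact K.smul_mem r hv

/-- The action of the endomorphisms preserving a submodule on the quotient. -/
def endQuot (K : Submodule k V) : endStable K →ₐ[k] Module.End k (V ⧸ K) :=
  AlgHom.ofLinearMap
    { toFun := fun T => K.mapQ K T.1 T.2
      map_add' := fun _ _ => Submodule.linearMap_qext _ (LinearMap.ext fun _ => rfl)
      map_smul' := fun _ _ => Submodule.linearMap_qext _ (LinearMap.ext fun _ => rfl) }
    (Submodule.linearMap_qext _ (LinearMap.ext fun _ => rfl))
    (fun _ _ => Submodule.linearMap_qext _ (LinearMap.ext fun _ => rfl))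

variable (C : CycParam D) {n : ℕ}

/-- A cyclic module of the affine wreath product algebra gives rise to a quotient of the cyclotomic
wreath product algebra. -/
theorem exists_surjective_of_stable {g : Gen F n → Module.End k V} (H : IsRep D g)
    (K : Submodule k V) (hK : ∀ u, ∀ v ∈ K, g u v ∈ K)
    (hχ : ∀ h : 0 < n, ∀ v, chiElt C (g (.x ⟨0, h⟩)) (fun a => g (.f ⟨0, h⟩ a)) v ∈ K) (v₀ : V)
    (hgen : ∀ P : Submodule k V, v₀ ∈ P → (∀ u, ∀ v ∈ P, g u v ∈ P) → P = ⊤) :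
    ∃ Λ : Cyc n C →ₗ[k] V ⧸ K, Function.Surjective Λ := by
  let g' : Gen F n → endStable K := fun u => ⟨g u, hK u⟩
  have H' : IsRep D g' := IsRep.of_injective (Φ := (endStable K).val) Subtype.val_injective H
  have hχ' : ∀ h : 0 < n, chiElt C (endQuot K (g' (.x ⟨0, h⟩)))
      (fun y => endQuot K (g' (.f ⟨0, h⟩ y))) = 0 := by
    intro h
    have h1 := map_chiElt C (A' := Module.End k (V ⧸ K)) (endQuot K : endStable K →+* _) (g' (.x ⟨0, h⟩))
      (fun y => g' (.f ⟨0, h⟩ y))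
    refine h1.symm.trans (Submodule.linearMap_qext _ (LinearMap.ext fun v => ?_))
    refine (Submodule.Quotient.mk_eq_zero K).2 ?_
    have h2 := map_chiElt C (A' := Module.End k V) ((endStable K).val : endStable K →+* _) (g' (.x ⟨0, h⟩))
      (fun y => g' (.f ⟨0, h⟩ y))
    have h3 := hχ h v
    exact (congrArg (fun T : Module.End k V => T v) h2) ▸ h3
  let Φ : Cyc n C →ₐ[k] Module.End k (V ⧸ K) :=
    cycLift C (fun u => endQuot K (g' u)) (isRep_map (endQuot K) H') hχ'
  have hΦ : ∀ u v, Φ (gen n C u) (K.mkQ v) = K.mkQ (g u v) := by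
    intro u v
    rw [cycLift_gen]
    rfl
  let Λ : Cyc n C →ₗ[k] V ⧸ K := (LinearMap.applyₗ (K.mkQ v₀)) ∘ₗ Φ.toLinearMap
  have hΛ : ∀ a, Λ a = Φ a (K.mkQ v₀) := fun _ => rfl
  refine ⟨Λ, ?_⟩
  -- The vectors whose classes lie in the orbit of v₀ form a submodule that contains v₀ and is
  -- stable under the generators.
  have htop := hgen ((LinearMap.range Λ).comap K.mkQ) ⟨1, by rw [hΛ, map_one]; rfl⟩ ?_
  · intro q
    obtain ⟨v, rfl⟩ := K.mkQ_surjective q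
    have : v ∈ (LinearMap.range Λ).comap K.mkQ := by rw [htop]; trivial
    exact this
  · rintro u v ⟨a, ha⟩
    refine ⟨gen n C u * a, ?_⟩
    rw [hΛ, map_mul, Module.End.mul_apply, ← hΛ, ha, hΦ]

end Quotient

/-! ### Lower bound for the size of A_{n+1}. -/

section LowerBound

variable {k : Type u₁} [CommRing k] {F : Type u₂} [Ring F] [Algebra k F]
  {𝒻 : Gr → Submodule k F} [GradedAlgebra 𝒻] {D : FrobeniusSuperalgebra 𝒻} (C : CycParam D) {n : ℕ}

/-- The coinduced module, modulo the image of `χ`, is a quotient of the cyclotomic wreath product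
algebra. -/
theorem ExtRep.exists_surjective_cyc {E : Type*} [AddCommGroup E] [Module k E]
    {z : Fin (n + 1) → Module.End k E} {f : Fin (n + 1) → F → Module.End k E}
    {s : Equiv.Perm (Fin n) → Module.End k E} (H : ExtRep D z f s)
    (hχ : ∀ i : Fin n, chiElt C (z i.castSucc) (f i.castSucc) = 0) {e₀ : E}
    (hgen : ∀ R : Submodule k E, e₀ ∈ R → (∀ i, ∀ e ∈ R, z i e ∈ R) →
      (∀ i a, ∀ e ∈ R, f i a e ∈ R) → (∀ τ, ∀ e ∈ R, s τ e ∈ R) → R = ⊤) :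
    ∃ Λ : Cyc (n + 1) C →ₗ[k] Coind s ⧸ LinearMap.range (H.chiMap C),
      Function.Surjective Λ := by
  have hjm0 : ∀ h : 0 < n + 1, jm D H.coindF (coindS s) ⟨0, h⟩ = 0 := by
    intro h
    rw [jm, Finset.sum_eq_zero]
    intro l hl
    exact absurd (Finset.mem_Iio.1 hl) (by simp)
  have hjm : ∀ (P : Submodule k (Coind s)) i,
      (∀ π, ∀ v ∈ P, coindS s π v ∈ P) → (∀ i a, ∀ v ∈ P, H.coindF i a v ∈ P) →
      ∀ v ∈ P, jm D H.coindF (coindS s) i v ∈ P := by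
    intro P i hS hF v hv
    rw [jm, LinearMap.sum_apply]
    refine sum_mem fun l _ => ?_
    rw [Module.End.mul_apply, tElt, LinearMap.sum_apply]
    exact sum_mem fun b _ => hF _ _ _ (hF _ _ _ (hS _ _ hv))
  refine exists_surjective_of_stable C H.coind_yRep.isRep
    (LinearMap.range (H.chiMap C)) ?_ ?_ (H.coindOne e₀) ?_
  · intro u v hv
    cases u with
    | x i =>
      exact add_mem (H.coindY_mem_range C hχ i hv)
        (hjm _ i (fun π v hv => H.coindS_mem_range C hχ π hv)
          (fun i a v hv => H.coindF_mem_range C hχ i a hv) v hv)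
    | f i a => exact H.coindF_mem_range C hχ i a hv
    | s π => exact H.coindS_mem_range C hχ π hv
  · intro h v
    have h1 := H.chiElt_mem_range C hχ ⟨0, h⟩ v
    change chiElt C (H.coindY ⟨0, h⟩ + jm D H.coindF (coindS s) ⟨0, h⟩) _ v ∈ _
    rw [hjm0, add_zero]
    exact h1
  · intro P h0 hP
    have hS : ∀ π, ∀ v ∈ P, coindS s π v ∈ P := fun π => hP (.s π)
    have hF : ∀ i a, ∀ v ∈ P, H.coindF i a v ∈ P := fun i a => hP (.f i a)
    refine H.eq_top_of_stable P hS hF (fun i v hv => ?_) h0 hgen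
    have h1 : H.coindY i v + jm D H.coindF (coindS s) i v ∈ P := hP (.x i) v hv
    exact (add_mem_cancel_right (hjm P i hS hF v hv)).1 h1

/-- The values of a function in the coinduced module at the coset representatives. -/
def coindEval {E : Type*} [AddCommGroup E] [Module k E] (s : Equiv.Perm (Fin n) → Module.End k E) :
    Coind s →ₗ[k] (Fin (n + 1) → E) where
  toFun v j := v.1 (Equiv.swap j (Fin.last n))
  map_add' _ _ := rfl
  map_smul' _ _ := rfl

/-- The complement of the range of `chiMap` represents the quotient module, and a function in this
complement may take arbitrary values of degree below the level at the coset representatives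
(`coindMk`). -/
theorem DegFiltration.exists_surjective_cyc {E : Type*} [AddCommGroup E] [Module k E]
    {z : Fin (n + 1) → Module.End k E} {f : Fin (n + 1) → F → Module.End k E}
    {s : Equiv.Perm (Fin n) → Module.End k E} (H : ExtRep D z f s) {G : ℕ → Submodule k E}
    {X' : Module.End k E} (HG : DegFiltration z f s G X')
    (hX : ∀ τ, s τ * z (Fin.last n) = z (Fin.last n) * s τ)
    (hχ : ∀ i : Fin n, chiElt C (z i.castSucc) (f i.castSucc) = 0) {e₀ : E}
    (hgen : ∀ R : Submodule k E, e₀ ∈ R → (∀ i, ∀ e ∈ R, z i e ∈ R) →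
      (∀ i a, ∀ e ∈ R, f i a e ∈ R) → (∀ τ, ∀ e ∈ R, s τ e ∈ R) → R = ⊤) :
    ∃ Λ : Cyc (n + 1) C →ₗ[k] (Fin (n + 1) → E),
      ∀ e : Fin (n + 1) → E, (∀ j, e j ∈ G C.level) → e ∈ LinearMap.range Λ := by
  obtain ⟨Λ, hΛ⟩ := H.exists_surjective_cyc C hχ hgen
  have hcompl := HG.isCompl_range_chiMap H C hX
  refine ⟨coindEval s ∘ₗ Submodule.subtype _ ∘ₗ
    (Submodule.quotientEquivOfIsCompl _ _ hcompl.symm).toLinearMap ∘ₗ Λ, fun e he => ?_⟩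
  obtain ⟨q, hq⟩ := (Submodule.quotientEquivOfIsCompl _ _ hcompl.symm).surjective
    ⟨H.coindMk e, HG.coindMk_mem H he⟩
  obtain ⟨a, rfl⟩ := hΛ q
  refine ⟨a, ?_⟩
  have h1 : coindEval s (H.coindMk e) = e := funext fun j => H.coindMk_swap e j
  exact (congrArg (fun v => coindEval s v.1) hq).trans h1

variable (n) in
/-- A lower bound for the size of the cyclotomic wreath product algebra. -/
theorem exists_surjective_cyc :
    ∃ Λ : Cyc (n + 1) C →ₗ[k] (Fin C.level → Fin (n + 1) → F ⊗[k] Cyc n C),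
      Function.Surjective Λ := by
  obtain ⟨Λ, hΛ⟩ := model_degFiltration.exists_surjective_cyc C (model_extRep (C := C) (n := n))
    (fun τ => coeffwise_act_mul_modelZ_last _) chiElt_model
    (fun R h0 hz hf hs => model_generated R h0 hz hf hs)
  let ev : (Fin (n + 1) → (ℕ →₀ Coeff C n)) →ₗ[k]
      (Fin C.level → Fin (n + 1) → F ⊗[k] Cyc n C) :=
    { toFun := fun v c j => v j c
      map_add' := fun _ _ => rfl
      map_smul' := fun _ _ => rfl }
  refine ⟨ev ∘ₗ Λ, fun w => ?_⟩
  obtain ⟨a, ha⟩ := hΛ (fun j => ∑ c : Fin C.level, Finsupp.single (c : ℕ) (w c j))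
    (fun j => sum_mem fun c _ a ha => Finsupp.single_eq_of_ne (by have := c.2; omega))
  refine ⟨a, funext fun c => funext fun j => ?_⟩
  change Λ a j c = w c j
  rw [ha, Finsupp.finsetSum_apply, Finset.sum_eq_single c]
  · exact Finsupp.single_eq_same
  · intro c' _ hc
    exact Finsupp.single_eq_of_ne (fun h => hc (Fin.ext h.symm))
  · simp

end LowerBound

/-! ### Upper bound for the size of A_{n+1}: a spanning set. -/

section UpperBound

variable {k : Type u₁} [CommRing k] {F : Type u₂} [Ring F] [Algebra k F]
  {𝒻 : Gr → Submodule k F} [GradedAlgebra 𝒻] {D : FrobeniusSuperalgebra 𝒻} (C : CycParam D) (n : ℕ)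

/-- The polynomial generator with the largest index. -/
noncomputable abbrev xLast : Cyc (n + 1) C := gen (n + 1) C (.x (Fin.last n))

/-- The element `a` in the last tensor factor. -/
noncomputable abbrev fLast (a : F) : Cyc (n + 1) C := gen (n + 1) C (.f (Fin.last n) a)

/-- The transposition of `j` and the largest index. -/
noncomputable abbrev swapLast (j : Fin (n + 1)) : Cyc (n + 1) C :=
  gen (n + 1) C (.s (Equiv.swap j (Fin.last n)))

variable {n}

theorem f_smul_gen (i : Fin n) (c : k) (a : F) :
    gen n C (.f i (c • a)) = c • gen n C (.f i a) := (isRep_gen C).f_smul i c a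

theorem inclAlg_x (i : Fin n) : inclAlg n C (gen n C (.x i)) = gen (n + 1) C (.x i.castSucc) :=
  inclAlg_gen C _

theorem inclAlg_f (i : Fin n) (a : F) :
    inclAlg n C (gen n C (.f i a)) = gen (n + 1) C (.f i.castSucc a) := inclAlg_gen C _

theorem inclAlg_s (π : Equiv.Perm (Fin n)) :
    inclAlg n C (gen n C (.s π)) = gen (n + 1) C (.s (extPerm π)) := inclAlg_gen C _

theorem s_extPerm_mul_xLast (π : Equiv.Perm (Fin n)) :
    gen (n + 1) C (.s (extPerm π)) * xLast C n = xLast C n * gen (n + 1) C (.s (extPerm π)) := by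
  have H := isRep_gen (n := n + 1) C
  cases n with
  | zero => rw [Subsingleton.elim π 1, extPerm_one, H.s_one, one_mul, mul_one]
  | succ n =>
    have hπ : π ∈ Submonoid.closure (Set.range fun i : Fin n => Equiv.swap i.castSucc i.succ) := by
      rw [Equiv.Perm.mclosure_swap_castSucc_succ]; trivial
    induction hπ using Submonoid.closure_induction with
    | mem π hπ =>
      obtain ⟨i, rfl⟩ := hπ
      rw [extPerm_swap]
      exact H.sx_ne _ _ _ (by simp) (Fin.castSucc_lt_last _).ne' (Fin.castSucc_lt_last _).ne'
    | one => rw [extPerm_one, H.s_one, one_mul, mul_one]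
    | mul π σ _ _ h1 h2 =>
      rw [extPerm_mul, H.s_mul, mul_assoc, h2, ← mul_assoc, h1, mul_assoc]

theorem inclAlg_mul_xLast (m : Cyc n C) :
    inclAlg n C m * xLast C n = xLast C n * inclAlg n C m := by
  have H := isRep_gen (n := n + 1) C
  have h := cyc_mem_of_gen ((Subalgebra.centralizer k {xLast C n}).comap (inclAlg n C)) (fun u => ?_) m
  · exact ((Subalgebra.mem_centralizer_iff k).1 h _ rfl).symm
  · refine (Subalgebra.mem_centralizer_iff k).2 fun g hg => ?_
    rw [Set.mem_singleton_iff.1 hg]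
    symm
    change inclAlg n C (gen n C u) * _ = _ * inclAlg n C (gen n C u)
    cases u with
    | x i => rw [inclAlg_x]; exact H.x_comm _ _
    | f i a => rw [inclAlg_f]; exact H.fx_ne _ _ (Fin.castSucc_lt_last i).ne' a
    | s π => rw [inclAlg_s]; exact s_extPerm_mul_xLast C π

theorem inclAlg_mul_xLast_pow (m : Cyc n C) (a : ℕ) :
    inclAlg n C m * xLast C n ^ a = xLast C n ^ a * inclAlg n C m :=
  Commute.pow_right (inclAlg_mul_xLast C m) a

theorem fLast_mul_xLast_pow (x : F) (a : ℕ) :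
    fLast C n x * xLast C n ^ a = xLast C n ^ a * fLast C n ((D.ψ ^ a) x) := by
  induction a generalizing x with
  | zero => simp
  | succ m ih =>
    rw [pow_succ', ← mul_assoc, (isRep_gen C).fx_same, mul_assoc, ih, ← mul_assoc, pow_succ]
    rfl

theorem inclAlg_mul_fLast {p q : Gr} {m : Cyc n C} (hm : m ∈ cycPiece n C p) {x : F}
    (hx : x ∈ 𝒻 q) :
    inclAlg n C m * fLast C n x = sgn (p.2 * q.2) • (fLast C n x * inclAlg n C m) := by
  have H := isRep_gen (n := n + 1) C
  induction hm using Submodule.span_induction with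
  | zero => rw [map_zero, zero_mul, mul_zero, smul_zero]
  | add y z _ _ hy hz => rw [map_add, add_mul, hy, hz, mul_add, smul_add]
  | smul r y _ hy => rw [map_smul, smul_mul_assoc, hy, mul_smul_comm, smul_comm]
  | mem y hy =>
    induction hy with
    | one => simp [sgn_zero]
    | @mul u p' q' y hu hy ih =>
      have hu' : inclAlg n C (gen n C u) * fLast C n x =
          sgn (p'.2 * q.2) • (fLast C n x * inclAlg n C (gen n C u)) := by
        cases hu with
        | x i =>
          rw [inclAlg_x, zero_mul, sgn_zero, one_smul]
          exact (H.fx_ne _ _ (Fin.castSucc_lt_last i).ne x).symm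
        | f i p a ha =>
          rw [inclAlg_f]
          exact H.f_comm _ _ (Fin.castSucc_lt_last i).ne _ _ _ _ ha hx
        | s π =>
          rw [inclAlg_s, Prod.snd_zero, zero_mul, sgn_zero, one_smul, H.sf, extPerm_last]
      rw [map_mul, mul_assoc, ih, mul_smul_comm, ← mul_assoc, hu', smul_mul_assoc, smul_smul,
        mul_assoc, Prod.snd_add, add_mul, sgn_add, mul_comm (sgn _)]

variable (n) in
/-- The span of the elements `x ^ a * f * m` with `a < c`, where `x` and `f` have the largest index
and `m` comes from the preceding level. -/
noncomputable def lowDeg (c : ℕ) : Submodule k (Cyc (n + 1) C) :=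
  Submodule.span k {z | ∃ a < c, ∃ (x : F) (m : Cyc n C),
    z = xLast C n ^ a * (fLast C n x * inclAlg n C m)}

theorem mem_lowDeg {a c : ℕ} (h : a < c) (x : F) (m : Cyc n C) :
    xLast C n ^ a * (fLast C n x * inclAlg n C m) ∈ lowDeg C n c :=
  Submodule.subset_span ⟨a, h, x, m, rfl⟩

theorem lowDeg_mono : Monotone (lowDeg C n) := fun _ _ h =>
  Submodule.span_mono fun _ ⟨a, ha, z⟩ => ⟨a, ha.trans_le h, z⟩

theorem mul_mem_of_lowDeg {c : ℕ} {g : Cyc (n + 1) C} {Q : Submodule k (Cyc (n + 1) C)}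
    (h : ∀ a < c, ∀ x m, g * (xLast C n ^ a * (fLast C n x * inclAlg n C m)) ∈ Q)
    {e : Cyc (n + 1) C} (he : e ∈ lowDeg C n c) : g * e ∈ Q := by
  have : lowDeg C n c ≤ Q.comap (LinearMap.mulLeft k g) := by
    refine Submodule.span_le.2 ?_
    rintro _ ⟨a, ha, x, m, rfl⟩
    exact h a ha x m
  exact this he

theorem one_mem_lowDeg {c : ℕ} (h : 0 < c) : 1 ∈ lowDeg C n c := by
  have := mem_lowDeg C h 1 (1 : Cyc n C)
  rwa [map_one, mul_one, fLast, (isRep_gen C).f_one, mul_one, pow_zero] at this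

theorem xLast_mul_mem {c : ℕ} {e : Cyc (n + 1) C} (he : e ∈ lowDeg C n c) :
    xLast C n * e ∈ lowDeg C n (c + 1) :=
  mul_mem_of_lowDeg C (fun a ha x m => by
    rw [← mul_assoc, ← pow_succ']; exact mem_lowDeg C (Nat.succ_lt_succ ha) x m) he

theorem fLast_mul_mem {c : ℕ} (y : F) {e : Cyc (n + 1) C} (he : e ∈ lowDeg C n c) :
    fLast C n y * e ∈ lowDeg C n c :=
  mul_mem_of_lowDeg C (fun a ha x m => by
    rw [← mul_assoc, fLast_mul_xLast_pow, mul_assoc, ← mul_assoc (fLast C n _),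
      ← (isRep_gen C).f_mul]
    exact mem_lowDeg C ha _ m) he

theorem inclAlg_mul_mem {c : ℕ} (y : Cyc n C) {e : Cyc (n + 1) C} (he : e ∈ lowDeg C n c) :
    inclAlg n C y * e ∈ lowDeg C n c :=
  mul_mem_of_lowDeg C (fun a ha x m => by
    rw [← mul_assoc, inclAlg_mul_xLast_pow, mul_assoc, ← mul_assoc (inclAlg n C y)]
    induction y using cycPiece_induction C with
    | zero => rw [map_zero]; simp
    | add y z hy hz => rw [map_add, add_mul, add_mul, mul_add]; exact add_mem hy hz
    | hom p y hy =>
      induction x using DirectSum.Decomposition.inductionOn 𝒻 with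
      | zero => rw [fLast, gen_f_zero]; simp
      | add x z hx hz =>
        rw [fLast, (isRep_gen C).f_add, mul_add, add_mul, mul_add]; exact add_mem hx hz
      | homogeneous x =>
        rw [inclAlg_mul_fLast C hy x.2, smul_mul_assoc, mul_smul_comm, mul_assoc, ← map_mul]
        exact zsmul_mem (mem_lowDeg C ha _ _) _) he

variable (n) in
/-- The span of the translates of `lowDeg` by transpositions. -/
noncomputable def swapDeg (c : ℕ) : Submodule k (Cyc (n + 1) C) :=
  Submodule.span k {z | ∃ j, ∃ e ∈ lowDeg C n c, z = swapLast C n j * e}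

theorem mem_swapDeg {c : ℕ} (j : Fin (n + 1)) {e : Cyc (n + 1) C} (he : e ∈ lowDeg C n c) :
    swapLast C n j * e ∈ swapDeg C n c :=
  Submodule.subset_span ⟨j, e, he, rfl⟩

theorem swapDeg_mono : Monotone (swapDeg C n) := fun _ _ h =>
  Submodule.span_mono fun _ ⟨j, e, he, z⟩ => ⟨j, e, lowDeg_mono C h he, z⟩

theorem mul_mem_of_swapDeg {c : ℕ} {g : Cyc (n + 1) C} {Q : Submodule k (Cyc (n + 1) C)}
    (h : ∀ j, ∀ e ∈ lowDeg C n c, g * (swapLast C n j * e) ∈ Q)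
    {e : Cyc (n + 1) C} (he : e ∈ swapDeg C n c) : g * e ∈ Q := by
  have : swapDeg C n c ≤ Q.comap (LinearMap.mulLeft k g) := by
    refine Submodule.span_le.2 ?_
    rintro _ ⟨j, e, he, rfl⟩
    exact h j e he
  exact this he

theorem swapLast_last : swapLast C n (Fin.last n) = 1 := by
  rw [swapLast, Equiv.swap_self]
  exact (isRep_gen C).s_one

theorem lowDeg_le_swapDeg (c : ℕ) : lowDeg C n c ≤ swapDeg C n c := fun e he => by
  have := mem_swapDeg C (Fin.last n) he
  rwa [swapLast_last, one_mul] at this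

/-- The product of π with a transposition is another transposition with the last letter times a
permutation of the first n letters, and `lowDeg` absorbs the latter. -/
theorem s_mul_mem_swapDeg {c : ℕ} (π : Equiv.Perm (Fin (n + 1))) {e : Cyc (n + 1) C}
    (he : e ∈ swapDeg C n c) : gen (n + 1) C (.s π) * e ∈ swapDeg C n c :=
  mul_mem_of_swapDeg C (fun j e he => by
    obtain ⟨τ, hτ⟩ := exists_extPerm_factor (π * Equiv.swap j (Fin.last n))
    rw [← mul_assoc, ← (isRep_gen C).s_mul, hτ, (isRep_gen C).s_mul, mul_assoc, ← inclAlg_s]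
    exact mem_swapDeg C _ (inclAlg_mul_mem C _ he)) he

theorem f_mul_mem_swapDeg {c : ℕ} (i : Fin (n + 1)) (x : F) {e : Cyc (n + 1) C}
    (he : e ∈ swapDeg C n c) : gen (n + 1) C (.f i x) * e ∈ swapDeg C n c :=
  mul_mem_of_swapDeg C (fun j e he => by
    have h : gen (n + 1) C (.f i x) * swapLast C n j = swapLast C n j *
        gen (n + 1) C (.f (Equiv.swap j (Fin.last n) i) x) := by
      rw [(isRep_gen C).sf, Equiv.swap_apply_self]
    rw [← mul_assoc, h, mul_assoc]
    refine mem_swapDeg C _ ?_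
    generalize Equiv.swap j (Fin.last n) i = l
    induction l using Fin.lastCases with
    | last => exact fLast_mul_mem C x he
    | cast l => rw [← inclAlg_f]; exact inclAlg_mul_mem C _ he) he

theorem jm_mul_mem_swapDeg {c : ℕ} (i : Fin (n + 1)) {e : Cyc (n + 1) C}
    (he : e ∈ swapDeg C n c) :
    jm D (fun i a => gen (n + 1) C (.f i a)) (fun π => gen (n + 1) C (.s π)) i * e ∈
      swapDeg C n c := by
  rw [jm, Finset.sum_mul]
  refine sum_mem fun l _ => ?_
  rw [mul_assoc, tElt, Finset.sum_mul]
  refine sum_mem fun b _ => ?_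
  rw [mul_assoc]
  exact f_mul_mem_swapDeg C _ _ (f_mul_mem_swapDeg C _ _ (s_mul_mem_swapDeg C _ he))

/-- A Jucys–Murphy element involves no letters above its own, so the y_i are compatible with the
inclusions. -/
theorem inclAlg_yElt (i : Fin n) :
    inclAlg n C (yElt D (gen n C) i) = yElt D (gen (n + 1) C) i.castSucc := by
  rw [yElt, yElt, map_sub, inclAlg_x, jm, jm, map_sum, Fin.Iio_castSucc, Finset.sum_map]
  congr 1
  refine Finset.sum_congr rfl fun l _ => ?_
  rw [map_mul, inclAlg_s, extPerm_swap]
  congr 1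
  refine (map_tElt (inclAlg n C : Cyc n C →+* Cyc (n + 1) C) _ _ _).trans ?_
  simp [tElt, inclAlg_f]

/-- Moving the last y past the transposition of j gives y_j. For j not the last letter this comes
from the preceding level and keeps the degree, so the hypothesis `hx` on the variable is needed for
the last letter only. It is used once with c' = c + 1 and once with c' = c equal to the level. -/
theorem yElt_last_mul_mem {c c' : ℕ} (hc : c ≤ c')
    (hx : ∀ e ∈ lowDeg C n c, xLast C n * e ∈ swapDeg C n c') {e : Cyc (n + 1) C}
    (he : e ∈ swapDeg C n c) : yElt D (gen (n + 1) C) (Fin.last n) * e ∈ swapDeg C n c' :=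
  mul_mem_of_swapDeg C (fun j e he => by
    have h : yElt D (gen (n + 1) C) (Fin.last n) * swapLast C n j =
        swapLast C n j * yElt D (gen (n + 1) C) j := by
      rw [(isRep_gen C).yRep.sy, Equiv.swap_apply_left]
    rw [← mul_assoc, h, mul_assoc]
    refine s_mul_mem_swapDeg C _ ?_
    induction j using Fin.lastCases with
    | last =>
      rw [yElt, sub_mul]
      exact sub_mem (hx e he) (swapDeg_mono C hc (jm_mul_mem_swapDeg C _ (lowDeg_le_swapDeg C c he)))
    | cast j =>
      rw [← inclAlg_yElt]
      exact swapDeg_mono C hc (lowDeg_le_swapDeg C c (inclAlg_mul_mem C _ he))) he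

/-- χ vanishes at the last y, which differs from the last x by a Jucys–Murphy element that does not
raise the degree. Comparing leading terms expresses the power of x by terms of lower degree. -/
theorem xLast_pow_level_mem {e : Cyc (n + 1) C} (he : e ∈ lowDeg C n 1) :
    xLast C n ^ C.level * e ∈ swapDeg C n C.level := by
  have h := chiElt_sub_pow_mem C (X := LinearMap.mulLeft k (xLast C n))
    (Y := LinearMap.mulLeft k (yElt D (gen (n + 1) C) (Fin.last n)))
    (f := fun a => LinearMap.mulLeft k (fLast C n a))
    (E := fun c => lowDeg C n (c + 1)) (W := swapDeg C n) (c := 0) (e := e)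
    (fun c => lowDeg_le_swapDeg C _) (swapDeg_mono C) (fun c e he => xLast_mul_mem C he)
    (fun c e he => ?_)
    (fun c e he => yElt_last_mul_mem C c.le_succ
      (fun e he => lowDeg_le_swapDeg C _ (xLast_mul_mem C he)) he)
    (fun l j c e he => f_mul_mem_swapDeg C _ _ he) he
  · have hχ : chiElt C (LinearMap.mulLeft k (yElt D (gen (n + 1) C) (Fin.last n)))
        (fun a => LinearMap.mulLeft k (fLast C n a)) = 0 := by
      have := map_chiElt C (A' := Module.End k (Cyc (n + 1) C))
        (Algebra.lmul k (Cyc (n + 1) C) : Cyc (n + 1) C →+* Module.End k (Cyc (n + 1) C))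
        (yElt D (gen (n + 1) C) (Fin.last n)) (fun a => fLast C n a)
      rw [chiElt_yElt, map_zero] at this
      exact this.symm
    rw [hχ, LinearMap.zero_apply, zero_sub, neg_mem_iff, zero_add, LinearMap.pow_mulLeft] at h
    exact h
  · rw [LinearMap.mulLeft_apply, LinearMap.mulLeft_apply, ← sub_mul, yElt, sub_sub_cancel_left,
      neg_mul, neg_mem_iff]
    exact jm_mul_mem_swapDeg C _ (lowDeg_le_swapDeg C _ he)

theorem lowDeg_succ_level_le : lowDeg C n (C.level + 1) ≤ swapDeg C n C.level := by
  refine Submodule.span_le.2 ?_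
  rintro _ ⟨a, ha, x, m, rfl⟩
  rcases (Nat.lt_succ_iff.1 ha).lt_or_eq with h | rfl
  · exact lowDeg_le_swapDeg C _ (mem_lowDeg C h x m)
  · have := mem_lowDeg C Nat.zero_lt_one x m
    rw [pow_zero, one_mul] at this
    exact xLast_pow_level_mem C this

variable (n) in
-- The span contains 1 and is stable under left multiplication by all generators. For the y_i,
-- stability reduces by conjugation to the last one, where `xLast_pow_level_mem` bounds the degree.
theorem swapDeg_level_eq_top : swapDeg C n C.level = ⊤ := by
  have hy : ∀ i, ∀ e ∈ swapDeg C n C.level, yElt D (gen (n + 1) C) i * e ∈ swapDeg C n C.level := by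
    intro i e he
    have h1 : yElt D (gen (n + 1) C) i =
        swapLast C n i * (yElt D (gen (n + 1) C) (Fin.last n) * swapLast C n i) := by
      have h2 := (isRep_gen (n := n + 1) C).yRep.sy (Equiv.swap i (Fin.last n)) (Fin.last n)
      rw [Equiv.swap_apply_right] at h2
      rw [← mul_assoc, h2, mul_assoc, (isRep_gen C).wreathRep.s_swap_mul_self, mul_one]
    rw [h1, mul_assoc, mul_assoc]
    exact s_mul_mem_swapDeg C _ (yElt_last_mul_mem C le_rfl
      (fun e he => lowDeg_succ_level_le C (xLast_mul_mem C he)) (s_mul_mem_swapDeg C _ he))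
  let S : Subalgebra k (Cyc (n + 1) C) :=
    { carrier := {a | ∀ e ∈ swapDeg C n C.level, a * e ∈ swapDeg C n C.level}
      mul_mem' := fun {a b} ha hb e he => by rw [mul_assoc]; exact ha _ (hb e he)
      add_mem' := fun {a b} ha hb e he => by rw [add_mul]; exact add_mem (ha e he) (hb e he)
      algebraMap_mem' := fun r e he => by
        rw [← Algebra.smul_def]
        exact Submodule.smul_mem _ r he }
  have hS : ∀ a, a ∈ S := cyc_mem_of_gen S fun u => by
    cases u with
    | x i =>
      have : gen (n + 1) C (.x i) = yElt D (gen (n + 1) C) i +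
          jm D (fun i a => gen (n + 1) C (.f i a)) (fun π => gen (n + 1) C (.s π)) i := by
        rw [yElt, sub_add_cancel]
      rw [this]
      exact S.add_mem (hy i) fun e he => jm_mul_mem_swapDeg C i he
    | f i a => exact fun e he => f_mul_mem_swapDeg C i a he
    | s π => exact fun e he => s_mul_mem_swapDeg C π he
  rw [eq_top_iff]
  rintro a -
  -- The detour through level + 1 covers level zero, where `lowDeg` at the level is zero and does
  -- not visibly contain 1.
  have := hS a _ (lowDeg_succ_level_le C (one_mem_lowDeg C (Nat.succ_pos _)))
  rwa [mul_one] at this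

end UpperBound

/-! ### Freeness of A_{n+1} as a right module over A_n. -/

section Freeness

section RightCombinations

variable {k : Type*} [CommRing k] {A A' : Type*} [Ring A] [Algebra k A] [Ring A'] [Algebra k A']
  (φ : A →ₐ[k] A') {I : Type*} [Fintype I]

/-- The right linear combinations of a finite family. -/
def rightComb (G : I → A') : (I → A) →ₗ[k] A' :=
  ∑ i, LinearMap.mulLeft k (G i) ∘ₗ φ.toLinearMap ∘ₗ LinearMap.proj i

theorem rightComb_apply (G : I → A') (m : I → A) : rightComb φ G m = ∑ i, G i * φ (m i) := by
  simp [rightComb]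

theorem mul_mem_range_rightComb (G : I → A') (i : I) (m : A) :
    G i * φ m ∈ LinearMap.range (rightComb φ G) := by
  classical
  refine ⟨Pi.single i m, ?_⟩
  rw [rightComb_apply, Finset.sum_eq_single i]
  · rw [Pi.single_eq_same]
  · intro j _ hj
    rw [Pi.single_eq_of_ne hj, map_zero, mul_zero]
  · simp

end RightCombinations

variable {k : Type u₁} [CommRing k] {F : Type u₂} [Ring F] [Algebra k F]
  {𝒻 : Gr → Submodule k F} [GradedAlgebra 𝒻] {D : FrobeniusSuperalgebra 𝒻} (C : CycParam D) (n : ℕ)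

/-- The monomials in the elements of largest index. -/
noncomputable def lastElt (i : Fin C.level × Fin D.dim) : Cyc (n + 1) C :=
  xLast C n ^ (i.1 : ℕ) * fLast C n (D.B i.2)

/-- A generating family of the right module given by the inclusion of the preceding level. -/
noncomputable def basisElt (i : Fin (n + 1) × Fin C.level × Fin D.dim) : Cyc (n + 1) C :=
  swapLast C n i.1 * lastElt C n i.2

/-- A generating family of the right module given by the inclusion of the preceding level, adapted
to the bimodule structure. -/
noncomputable def mackeyElt :
    (Fin C.level × Fin D.dim) ⊕ (Fin (n + 1) × Fin C.level × Fin D.dim) → Cyc (n + 2) C :=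
  Sum.elim (lastElt C (n + 1)) fun i =>
    inclAlg (n + 1) C (basisElt C n i) * swapLast C (n + 1) (Fin.last n).castSucc

variable {n}

theorem lowDeg_le_of_lastElt {R : Submodule k (Cyc (n + 1) C)}
    (hR : ∀ i m, lastElt C n i * inclAlg n C m ∈ R) : lowDeg C n C.level ≤ R := by
  refine Submodule.span_le.2 ?_
  rintro _ ⟨a, ha, x, m, rfl⟩
  rw [← D.B.sum_repr x, fLast, (isRep_gen C).wreathRep.f_sum, Finset.sum_mul, Finset.mul_sum]
  refine sum_mem fun b _ => ?_
  rw [f_smul_gen, smul_mul_assoc, mul_smul_comm, ← mul_assoc]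
  exact R.smul_mem _ (hR (⟨a, ha⟩, b) m)

variable (n) in
theorem rightComb_basisElt_surjective :
    Function.Surjective (rightComb (inclAlg n C) (basisElt C n)) := by
  rw [← LinearMap.range_eq_top, eq_top_iff, ← swapDeg_level_eq_top]
  refine Submodule.span_le.2 ?_
  rintro _ ⟨j, e, he, rfl⟩
  have h := lowDeg_le_of_lastElt C (R := (LinearMap.range
    (rightComb (inclAlg n C) (basisElt C n))).comap (LinearMap.mulLeft k (swapLast C n j)))
    (fun i m => ?_) he
  · exact h
  · change swapLast C n j * (lastElt C n i * inclAlg n C m) ∈ LinearMap.range _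
    rw [← mul_assoc]
    exact mul_mem_range_rightComb _ (basisElt C n) (j, i) m

/-- Level zero is a quotient of k, and each level is finitely generated over the preceding one.
Finiteness over k is what the counting argument for independence requires. -/
instance cyc_finite : ∀ n, Module.Finite k (Cyc n C)
  | 0 => by
    refine Module.Finite.of_surjective (Algebra.linearMap k (Cyc 0 C)) fun y => ?_
    refine cyc_mem_of_gen (⊥ : Subalgebra k (Cyc 0 C)) (fun u => ?_) y
    cases u with
    | x i => exact i.elim0
    | f i a => exact i.elim0
    | s π =>
      rw [Subsingleton.elim π 1, (isRep_gen C).s_one]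
      exact one_mem _
  | n + 1 => by
    have := cyc_finite n
    exact Module.Finite.of_surjective _ (rightComb_basisElt_surjective C n)

/-- The last simple transposition moves only the two last letters, and neither occurs in the image
of level n. Hence u ⊗ m ↦ u s ⊗ m is well defined on the module induced from level n. -/
theorem swap_castSucc_mul_inclAlg (m : Cyc n C) :
    swapLast C (n + 1) (Fin.last n).castSucc * inclAlg (n + 1) C (inclAlg n C m) =
      inclAlg (n + 1) C (inclAlg n C m) * swapLast C (n + 1) (Fin.last n).castSucc := by
  have H := isRep_gen (n := n + 2) C
  have hne : ∀ i : Fin n, i.castSucc.castSucc ≠ (Fin.last n).castSucc := fun i h =>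
    (Fin.castSucc_lt_last i).ne (Fin.castSucc_injective _ h)
  have hne' : ∀ i : Fin n, i.castSucc.castSucc ≠ Fin.last (n + 1) := fun i =>
    (Fin.castSucc_lt_last _).ne
  have h := cyc_mem_of_gen
    ((Subalgebra.centralizer k {swapLast C (n + 1) (Fin.last n).castSucc}).comap
      ((inclAlg (n + 1) C).comp (inclAlg n C))) (fun u => ?_) m
  · exact (Subalgebra.mem_centralizer_iff k).1 h _ rfl
  · refine (Subalgebra.mem_centralizer_iff k).2 fun g hg => ?_
    rw [Set.mem_singleton_iff.1 hg]
    change _ * inclAlg (n + 1) C (inclAlg n C (gen n C u)) =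
      inclAlg (n + 1) C (inclAlg n C (gen n C u)) * _
    cases u with
    | x i =>
      rw [inclAlg_x, inclAlg_x]
      exact H.sx_ne _ _ _ (by simp) (hne i) (hne' i)
    | f i a =>
      rw [inclAlg_f, inclAlg_f, H.sf, Equiv.swap_apply_of_ne_of_ne (hne i) (hne' i)]
    | s π =>
      rw [inclAlg_s, inclAlg_s, ← H.s_mul, ← H.s_mul, Equiv.swap_mul_eq_mul_swap,
        Equiv.Perm.inv_eq_iff_eq.2, Equiv.Perm.inv_eq_iff_eq.2]
      · rw [extPerm_last]
      · rw [extPerm_castSucc, extPerm_last]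

variable (n) in
/-- The span of `lowDeg` and the double coset of the last simple transposition. -/
noncomputable def cosetSpan : Submodule k (Cyc (n + 2) C) :=
  lowDeg C (n + 1) C.level ⊔ Submodule.span k {z | ∃ m m', z = inclAlg (n + 1) C m *
    (swapLast C (n + 1) (Fin.last n).castSucc * inclAlg (n + 1) C m')}

theorem mem_cosetSpan (m m' : Cyc (n + 1) C) : inclAlg (n + 1) C m *
    (swapLast C (n + 1) (Fin.last n).castSucc * inclAlg (n + 1) C m') ∈ cosetSpan C n :=
  Submodule.mem_sup_right (Submodule.subset_span ⟨m, m', rfl⟩)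

theorem inclAlg_mul_mem_cosetSpan (y : Cyc (n + 1) C) {e : Cyc (n + 2) C}
    (he : e ∈ cosetSpan C n) : inclAlg (n + 1) C y * e ∈ cosetSpan C n := by
  have : cosetSpan C n ≤ (cosetSpan C n).comap (LinearMap.mulLeft k (inclAlg (n + 1) C y)) := by
    refine sup_le (fun e he => Submodule.mem_sup_left (inclAlg_mul_mem C y he))
      (Submodule.span_le.2 ?_)
    rintro _ ⟨m, m', rfl⟩
    change inclAlg (n + 1) C y * (inclAlg (n + 1) C m * _) ∈ cosetSpan C n
    rw [← mul_assoc, ← map_mul]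
    exact mem_cosetSpan C _ _
  exact this he

theorem swap_mul_xLast : swapLast C (n + 1) (Fin.last n).castSucc * xLast C (n + 1) =
    inclAlg (n + 1) C (xLast C n) * swapLast C (n + 1) (Fin.last n).castSucc +
      tElt D (fun i a => gen (n + 2) C (.f i a)) (Fin.last (n + 1)) (Fin.last n).castSucc := by
  have H := isRep_gen (n := n + 2) C
  have h1 := H.sx (Fin.last n).castSucc (Fin.last (n + 1)) (by simp)
  have h2 := H.wreathRep.s_swap_mul_self (Fin.last n).castSucc (Fin.last (n + 1))
  have h3 := H.wreathRep.s_mul_tElt D (Equiv.swap (Fin.last n).castSucc (Fin.last (n + 1)))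
    (Fin.last n).castSucc (Fin.last (n + 1))
  rw [Equiv.swap_apply_left, Equiv.swap_apply_right] at h3
  rw [inclAlg_x]
  set s := gen (n + 2) C (.s (Equiv.swap (Fin.last n).castSucc (Fin.last (n + 1)))) with hs
  -- Multiplying the relation `sx` by s on both sides moves s past the other variable; conjugation
  -- exchanges the indices of t.
  have h4 := congrArg (fun u => s * u * s) h1
  simp only [mul_sub, sub_mul] at h4
  rw [h3] at h4
  simp only [mul_assoc, h2, mul_one] at h4
  rw [← mul_assoc, h2, one_mul] at h4
  rw [h4, sub_add_cancel]

/-- The transposition is moved across one x at a time. Each correction replaces one x by an element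
t, so its exponent stays below the level and it lies in `lowDeg`. -/
theorem swap_mul_mem_cosetSpan (a : ℕ) (ha : a < C.level) (x : F) (m : Cyc (n + 1) C) :
    swapLast C (n + 1) (Fin.last n).castSucc *
      (xLast C (n + 1) ^ a * (fLast C (n + 1) x * inclAlg (n + 1) C m)) ∈ cosetSpan C n := by
  induction a with
  | zero =>
    have h : swapLast C (n + 1) (Fin.last n).castSucc * fLast C (n + 1) x =
        inclAlg (n + 1) C (fLast C n x) * swapLast C (n + 1) (Fin.last n).castSucc := by
      rw [(isRep_gen C).sf, Equiv.swap_apply_right, inclAlg_f]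
    rw [pow_zero, one_mul, ← mul_assoc, h, mul_assoc]
    exact mem_cosetSpan C _ _
  | succ a ih =>
    rw [pow_succ', mul_assoc, ← mul_assoc, swap_mul_xLast, add_mul, mul_assoc]
    refine add_mem (inclAlg_mul_mem_cosetSpan C _ (ih (Nat.lt_of_succ_lt ha)))
      (Submodule.mem_sup_left ?_)
    rw [tElt, Finset.sum_mul]
    refine sum_mem fun b _ => ?_
    rw [mul_assoc, ← inclAlg_f]
    exact fLast_mul_mem C _ (inclAlg_mul_mem C _ (mem_lowDeg C (Nat.lt_of_succ_lt ha) x m))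

variable (n) in
theorem cosetSpan_eq_top : cosetSpan C n = ⊤ := by
  rw [eq_top_iff, ← swapDeg_level_eq_top]
  refine Submodule.span_le.2 ?_
  rintro _ ⟨j, e, he, rfl⟩
  induction j using Fin.lastCases with
  | last => rw [swapLast_last, one_mul]; exact Submodule.mem_sup_left he
  -- The transposition of j and the last letter is the conjugate of the last simple transposition by
  -- a permutation from the preceding level.
  | cast j =>
    have hj : swapLast C (n + 1) j.castSucc = inclAlg (n + 1) C (swapLast C n j) *
        (swapLast C (n + 1) (Fin.last n).castSucc * inclAlg (n + 1) C (swapLast C n j)) := by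
      have H := isRep_gen (n := n + 2) C
      rw [inclAlg_s, extPerm_swap, ← H.s_mul, ← H.s_mul, swapLast]
      congr 2
      by_cases h : j = Fin.last n
      · rw [h, Equiv.swap_self]; rfl
      · have h1 := Equiv.swap_mul_swap_mul_swap (x := Fin.last (n + 1)) (y := (Fin.last n).castSucc)
          (z := j.castSucc) (Fin.castSucc_lt_last _).ne' (Fin.castSucc_lt_last _).ne'
        rw [Equiv.swap_comm _ (Fin.last n).castSucc, Equiv.swap_comm _ j.castSucc] at h1
        rw [← h1, ← mul_assoc]
    rw [SetLike.mem_coe, hj, mul_assoc, mul_assoc]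
    exact inclAlg_mul_mem_cosetSpan C _ (mul_mem_of_lowDeg C
      (fun a ha x m => swap_mul_mem_cosetSpan C a ha x m) (inclAlg_mul_mem C _ he))

variable (n) in
-- In a product m s m' the left factor m is expanded over the level below; the coefficients commute
-- with s and are absorbed by m'.
theorem rightComb_mackeyElt_surjective :
    Function.Surjective (rightComb (inclAlg (n + 1) C) (mackeyElt C n)) := by
  rw [← LinearMap.range_eq_top, eq_top_iff, ← cosetSpan_eq_top]
  refine sup_le (lowDeg_le_of_lastElt C fun i m =>
    mul_mem_range_rightComb _ (mackeyElt C n) (.inl i) m) (Submodule.span_le.2 ?_)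
  rintro _ ⟨m, m', rfl⟩
  obtain ⟨c, rfl⟩ := rightComb_basisElt_surjective C n m
  rw [SetLike.mem_coe, rightComb_apply, map_sum, Finset.sum_mul]
  refine sum_mem fun i _ => ?_
  rw [map_mul, mul_assoc, ← mul_assoc (inclAlg (n + 1) C (inclAlg n C _)),
    ← swap_castSucc_mul_inclAlg, mul_assoc, ← map_mul, ← mul_assoc]
  exact mul_mem_range_rightComb _ (mackeyElt C n) (.inr i) _

variable (n) in
/-- The cyclotomic wreath product algebra is a free right module over the one of one letter less. -/
theorem rightComb_mackeyElt_bijective :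
    Function.Bijective (rightComb (inclAlg (n + 1) C) (mackeyElt C n)) := by
  refine ⟨?_, rightComb_mackeyElt_surjective C n⟩
  obtain ⟨Λ, hΛ⟩ := exists_surjective_cyc C (n + 1)
  have e₁ : (F ⊗[k] Cyc (n + 1) C) ≃ₗ[k] (Fin D.dim → Cyc (n + 1) C) :=
    (D.B.equivFun.rTensor (Cyc (n + 1) C)).trans
      ((TensorProduct.comm k _ _).trans (TensorProduct.piScalarRight k k _ _))
  -- Both sides count (n + 2) d dim F: the monomials in the last letter contribute one share of d
  -- dim F, the double coset n + 1 further shares.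
  have e₂ : (Fin C.level × Fin (n + 2)) × Fin D.dim ≃
      (Fin C.level × Fin D.dim) ⊕ (Fin (n + 1) × Fin C.level × Fin D.dim) :=
    Fintype.equivOfCardEq (by simp only [Fintype.card_prod, Fintype.card_sum, Fintype.card_fin]; ring)
  let T : (Fin C.level → Fin (n + 2) → F ⊗[k] Cyc (n + 1) C) →
      ((Fin C.level × Fin D.dim) ⊕ (Fin (n + 1) × Fin C.level × Fin D.dim) → Cyc (n + 1) C) :=
    fun w i => e₁ (w (e₂.symm i).1.1 (e₂.symm i).1.2) (e₂.symm i).2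
  let T' : (Fin C.level → Fin (n + 2) → F ⊗[k] Cyc (n + 1) C) →ₗ[k]
      ((Fin C.level × Fin D.dim) ⊕ (Fin (n + 1) × Fin C.level × Fin D.dim) → Cyc (n + 1) C) :=
    { toFun := T
      map_add' := fun v w => funext fun i => by simp [T]
      map_smul' := fun c w => funext fun i => by simp [T] }
  have hT : Function.Surjective T' := fun v => by
    refine ⟨fun c j => e₁.symm fun b => v (e₂ ((c, j), b)), funext fun i => ?_⟩
    change e₁ (e₁.symm _) _ = _
    rw [LinearEquiv.apply_symm_apply]
    exact congrArg v (e₂.apply_symm_apply i)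
  -- Coefficients map onto the algebra, which maps onto equally many copies of the coefficients. The
  -- composite is a surjective endomorphism of a finite k-module, hence injective.
  have hinj := OrzechProperty.injective_of_surjective_endomorphism
    (T' ∘ₗ Λ ∘ₗ rightComb (inclAlg (n + 1) C) (mackeyElt C n))
    (hT.comp (hΛ.comp (rightComb_mackeyElt_surjective C n)))
  exact Function.Injective.of_comp (f := T' ∘ₗ Λ) hinj

end Freeness

/-! ### Inverses of sums of homogeneous maps. -/

section GradedInverse

variable {k : Type*} [CommRing k] {A : Type w} [Ring A] [Algebra k A] {𝒜 : Gr → Submodule k A}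
  [GradedAlgebra 𝒜]

theorem comps_map {M N : GrSMod.{w, v} 𝒜} {α : M.carrier →+ N.carrier} {r : Gr}
    (hα : ∀ q m, m ∈ M.piece q → α m ∈ N.piece (r + q)) (m : M.carrier) (q : Gr) :
    comps N.internal (α m) (r + q) = α (comps M.internal m q) := by
  induction m using internal_induction M.internal with
  | zero => simp
  | add x y hx hy => simp only [map_add, Finsupp.add_apply, hx, hy]
  | hom p x hx =>
    rw [comps_of_mem _ hx, comps_of_mem _ (hα p x hx), Finsupp.single_apply, Finsupp.single_apply]
    by_cases h : p = q
    · rw [if_pos h, if_pos (congrArg _ h)]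
    · rw [if_neg h, if_neg (fun h' => h (add_left_cancel h')), map_zero]

variable {ι : Type} [Fintype ι] {N : ι → GrSMod.{w, v} 𝒜} {L : GrSMod.{w, v} 𝒜}

/-- The homomorphism from a direct sum with given components. -/
noncomputable def sumHom (α : ∀ i, (N i).carrier →+ L.carrier) : (dsum N).carrier →+ L.carrier :=
  ∑ i, (α i).comp (Pi.evalAddMonoidHom (fun i => (N i).carrier) i)

theorem sumHom_apply (α : ∀ i, (N i).carrier →+ L.carrier) (x : (dsum N).carrier) :
    sumHom α x = ∑ i, α i (x i) :=
  AddMonoidHom.finsetSum_apply _ _ _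

theorem HOM_le_evenHOM (M M' : GrSMod.{w, v} 𝒜) (i : ℤ) : HOM M M' i 0 ≤ evenHOM M M' :=
  le_iSup (fun i => HOM M M' i 0) i

variable {d : ι → ℤ} {α : ∀ i, (N i).carrier →+ L.carrier} (hα : ∀ i, α i ∈ HOM (N i) L (d i) 0)
include hα

theorem sumHom_mem : sumHom α ∈ evenHOM (dsum N) L :=
  sum_mem fun i _ => HOM_le_evenHOM _ _ (d i)
    ⟨fun p a m ha => (hα i).1 p a (m i) ha, fun q m hm => (hα i).2 q (m i) (hm i trivial)⟩

theorem sumHom_smul {p : Gr} {a : A} (ha : a ∈ 𝒜 p) (x : (dsum N).carrier) :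
    sumHom α (a • x) = a • sumHom α x := by
  rw [sumHom_apply, sumHom_apply, Finset.smul_sum]
  refine Finset.sum_congr rfl fun i _ => ?_
  have h := (hα i).1 p a (x i) ha
  rwa [zero_mul, sgn_zero, one_smul] at h

/-- Replacing each x i by its component of the expected bidegree gives a preimage of the same
homogeneous element, and injectivity forces it to be x. -/
theorem inverse_mem_piece (hbij : Function.Bijective (sumHom α)) {q : Gr} {x : (dsum N).carrier}
    (hx : sumHom α x ∈ L.piece q) (i : ι) : x i ∈ (N i).piece ((-d i, 0) + q) := by
  let x' : (dsum N).carrier := fun i => comps (N i).internal (x i) ((-d i, 0) + q)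
  have key : x' = x := by
    apply hbij.1
    have h1 : comps L.internal (sumHom α x) q = sumHom α x := by
      rw [comps_of_mem _ hx, Finsupp.single_eq_same]
    rw [← h1, sumHom_apply, sumHom_apply, map_sum, Finsupp.finsetSum_apply]
    refine Finset.sum_congr rfl fun i _ => ?_
    refine (comps_map (hα i).2 (x i) _).symm.trans ?_
    congr 1
    rw [← add_assoc]
    have : ((d i, 0) + (-d i, 0) : Gr) = 0 := by ext <;> simp
    rw [this, zero_add]
  rw [← key]
  exact comps_mem _ _ _

/-- The inverse is the sum of its coordinates in the summands, and the coordinate i is homogeneous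
of degree -d i. -/
theorem exists_inverse_evenHOM (hbij : Function.Bijective (sumHom α)) :
    ∃ η ∈ evenHOM L (dsum N), (∀ y, sumHom α (η y) = y) ∧ ∀ x, η (sumHom α x) = x := by
  classical
  let e : (∀ i, (N i).carrier) ≃+ L.carrier := AddEquiv.ofBijective (sumHom α) hbij
  refine ⟨e.symm.toAddMonoidHom, ?_, e.apply_symm_apply, e.symm_apply_apply⟩
  have hlin : ∀ p a y, a ∈ 𝒜 p → e.symm (a • y) = a • e.symm y := by
    intro p a y ha
    refine hbij.1 ((e.apply_symm_apply _).trans (Eq.trans ?_ (sumHom_smul hα ha (e.symm y)).symm))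
    exact congrArg (a • ·) (e.apply_symm_apply y).symm
  have hsum : e.symm.toAddMonoidHom = ∑ i, ((AddMonoidHom.single (fun i => (N i).carrier) i).comp
      (Pi.evalAddMonoidHom (fun i => (N i).carrier) i)).comp e.symm.toAddMonoidHom := by
    refine AddMonoidHom.ext fun y => ?_
    rw [AddMonoidHom.finsetSum_apply]
    exact (Finset.univ_sum_single (e.symm y)).symm
  change e.symm.toAddMonoidHom ∈ _
  rw [hsum]
  refine sum_mem fun i _ => HOM_le_evenHOM _ _ (-d i) ⟨fun p a y ha => ?_, fun q y hy j _ => ?_⟩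
  · rw [zero_mul, sgn_zero, one_smul]
    change (Pi.single i (e.symm (a • y) i) : ∀ i, (N i).carrier) =
      a • (Pi.single i (e.symm y i) : ∀ i, (N i).carrier)
    rw [hlin p a y ha, ← Pi.single_smul]
    rfl
  · change (Pi.single i (e.symm y i) : ∀ i, (N i).carrier) j ∈ (N j).piece _
    by_cases h : j = i
    · subst h
      rw [Pi.single_eq_same]
      refine inverse_mem_piece hα hbij ?_ j
      exact (e.apply_symm_apply y).symm ▸ hy
    · rw [Pi.single_eq_of_ne h]
      exact zero_mem _

end GradedInverse

/-! ### Induction along an extension with a right basis; finite generation. -/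

section InducedModules

variable {k : Type*} [CommRing k] {A B : Type w} [Ring A] [Algebra k A] [Ring B] [Algebra k B]
  {𝒜 : Gr → Submodule k A} {ℬ : Gr → Submodule k B} [GradedAlgebra 𝒜] [GradedAlgebra ℬ]
  (φ : 𝒜 →+*ᵍ ℬ) (M : GrSMod.{w, v} 𝒜)

/-- The submodule `balanced` is a span over B, whereas h is merely additive; the extra factor c
makes the induction over the span work. -/
theorem lift_balanced {Q : Type*} [AddCommGroup Q] (h : B →+ M.carrier →+ Q)
    (hb : ∀ b a m, h (b * φ a) m = h b (a • m)) {x : B ⊗[ℤ] M.carrier} (hx : x ∈ balanced φ M)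
    (c : B) : TensorProduct.liftAddHom (R := ℤ) h
      (fun r b m => by rw [map_zsmul, map_zsmul, AddMonoidHom.smul_apply]) (c • x) = 0 := by
  induction hx using Submodule.span_induction generalizing c with
  | mem x hx =>
    obtain ⟨b, a, m, rfl⟩ := hx
    rw [smul_sub, map_sub, TensorProduct.smul_tmul', TensorProduct.smul_tmul', smul_eq_mul,
      smul_eq_mul, ← mul_assoc]
    exact sub_eq_zero.2 (hb (c * b) a m)
  | zero => simp
  | add x y _ _ hx hy => rw [smul_add, map_add, hx, hy, add_zero]
  | smul d x _ hx => rw [smul_smul]; exact hx _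

/-- The additive map out of the induced module given by a balanced map. -/
noncomputable def indLift {Q : Type*} [AddCommGroup Q] (h : B →+ M.carrier →+ Q)
    (hb : ∀ b a m, h (b * φ a) m = h b (a • m)) : IndCarrier φ M →+ Q :=
  QuotientAddGroup.lift (balanced φ M).toAddSubgroup
    (TensorProduct.liftAddHom (R := ℤ) h
      (fun r b m => by rw [map_zsmul, map_zsmul, AddMonoidHom.smul_apply]))
    (fun x hx => by simpa using lift_balanced φ M h hb hx 1)

theorem indLift_mk {Q : Type*} [AddCommGroup Q] (h : B →+ M.carrier →+ Q)
    (hb : ∀ b a m, h (b * φ a) m = h b (a • m)) (b : B) (m : M.carrier) :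
    indLift φ M h hb (indMk φ M b m) = h b m := rfl

theorem ind_induction_mk {motive : IndCarrier φ M → Prop} (zero : motive 0)
    (mk : ∀ b m, motive (indMk φ M b m)) (add : ∀ x y, motive x → motive y → motive (x + y))
    (x : IndCarrier φ M) : motive x :=
  ind_induction φ M zero (fun _ _ b m _ _ => mk b m) add x

theorem indMk_mem {p q : Gr} {b : B} {m : M.carrier} (hb : b ∈ ℬ p) (hm : m ∈ M.piece q) :
    indMk φ M b m ∈ indPiece φ M (p + q) :=
  AddSubgroup.subset_closure ⟨p, q, b, m, rfl, hb, hm, rfl⟩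

variable {I : Type*} [Fintype I] (G : I → B)

/-- The combinations of a family of elements of `B` with coefficients in a module. -/
noncomputable def indComb : (I → M.carrier) →+ IndCarrier φ M :=
  ∑ i, (indMkHom φ M (G i)).comp (Pi.evalAddMonoidHom (fun _ => M.carrier) i)

theorem indComb_apply (v : I → M.carrier) : indComb φ M G v = ∑ i, indMk φ M (G i) (v i) :=
  AddMonoidHom.finsetSum_apply _ _ _

variable {G}

theorem indMk_sum (c : I → A) (m : M.carrier) :
    indMk φ M (∑ i, G i * φ (c i)) m = indComb φ M G fun i => c i • m := by
  rw [indComb_apply]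
  simp only [← indMk_mul]
  exact (congrArg (fun g => g m) (map_sum (indMkHom φ M) _ _)).trans
    (AddMonoidHom.finsetSum_apply _ _ _)

theorem indComb_surjective (hG : Function.Surjective fun c : I → A => ∑ i, G i * φ (c i)) :
    Function.Surjective (indComb φ M G) := by
  rw [← AddMonoidHom.range_eq_top, eq_top_iff]
  rintro x -
  induction x using ind_induction_mk φ M with
  | zero => exact zero_mem _
  | add x y hx hy => exact add_mem hx hy
  | mk b m =>
    obtain ⟨c, rfl⟩ := hG b
    exact ⟨_, (indMk_sum φ M c m).symm⟩

/-- The coordinates γ with respect to the right basis are right A-linear, so b ⊗ m ↦ γ(b) m is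
balanced. It is a left inverse. -/
theorem indComb_bijective (hG : Function.Bijective fun c : I → A => ∑ i, G i * φ (c i)) :
    Function.Bijective (indComb φ M G) := by
  classical
  refine ⟨?_, indComb_surjective φ M hG.2⟩
  let T : (I → A) →+ B :=
    { toFun := fun c => ∑ i, G i * φ (c i)
      map_zero' := by simp
      map_add' := fun c c' => by simp [mul_add, Finset.sum_add_distrib] }
  let γ : B ≃+ (I → A) := (AddEquiv.ofBijective T hG).symm
  have hγ : ∀ c : I → A, γ (∑ i, G i * φ (c i)) = c := (AddEquiv.ofBijective T hG).symm_apply_apply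
  have hγ_mul : ∀ b a, γ (b * φ a) = fun i => γ b i * a := by
    intro b a
    obtain ⟨c, rfl⟩ := hG.2 b
    simp only [hγ]
    rw [← hγ fun i => c i * a]
    simp only [map_mul, Finset.sum_mul, mul_assoc]
  let h : B →+ M.carrier →+ (I → M.carrier) :=
    AddMonoidHom.mk' (fun b => AddMonoidHom.mk' (fun m i => γ b i • m)
      (fun m m' => funext fun i => smul_add _ _ _))
      (fun b b' => AddMonoidHom.ext fun m => funext fun i =>
        (congrArg (fun c : I → A => c i • m) (map_add γ b b')).trans (add_smul _ _ _))
  have hb : ∀ b a m, h (b * φ a) m = h b (a • m) := fun b a m => funext fun i => by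
    change γ (b * φ a) i • m = γ b i • a • m
    rw [hγ_mul, mul_smul]
  refine Function.LeftInverse.injective (g := indLift φ M h hb) fun v => ?_
  rw [indComb_apply, map_sum]
  funext j
  rw [Finset.sum_apply, Finset.sum_eq_single j]
  · rw [indLift_mk]
    change γ (G j) j • v j = v j
    have : γ (G j) = Pi.single j 1 := by
      rw [← hγ (Pi.single j 1), Finset.sum_eq_single j]
      · simp
      · intro i _ hi; simp [Pi.single_eq_of_ne hi]
      · simp
    rw [this, Pi.single_eq_same, one_smul]
  · intro i _ hi
    rw [indLift_mk]
    change γ (G i) j • v i = 0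
    have : γ (G i) = Pi.single i 1 := by
      rw [← hγ (Pi.single i 1), Finset.sum_eq_single i]
      · simp
      · intro i' _ hi; simp [Pi.single_eq_of_ne hi]
      · simp
    rw [this, Pi.single_eq_of_ne hi.symm, zero_smul]
  · simp

theorem indObj_finite [Module.Finite A M.carrier] : Module.Finite B (indObj φ M).carrier := by
  classical
  obtain ⟨s, hs⟩ := Module.Finite.fg_top (R := A) (M := M.carrier)
  refine ⟨⟨s.image fun m => indMk φ M 1 m, ?_⟩⟩
  rw [eq_top_iff]
  rintro x -
  set P := Submodule.span B ((s.image fun m => indMk φ M 1 m : Finset (IndCarrier φ M)) :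
    Set (IndCarrier φ M)) with hP
  have key : ∀ m ∈ Submodule.span A (s : Set M.carrier), ∀ b, indMk φ M b m ∈ P := by
    intro m hm
    induction hm using Submodule.span_induction with
    | mem m hm =>
      intro b
      have : indMk φ M b m = b • indMk φ M 1 m := by rw [smul_indMk, mul_one]
      rw [this]
      exact P.smul_mem _ (Submodule.subset_span (Finset.mem_coe.2 (Finset.mem_image_of_mem _ hm)))
    | zero => intro b; rw [show indMk φ M b 0 = 0 from map_zero (indMkHom φ M b)]; exact zero_mem _
    | add m m' _ _ h h' => intro b; rw [indMk_add_right]; exact add_mem (h b) (h' b)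
    | smul a m _ h => intro b; rw [← indMk_mul]; exact h _
  change x ∈ P
  induction x using ind_induction_mk φ M with
  | zero => exact zero_mem _
  | add x y hx hy => exact add_mem hx hy
  | mk b m => exact key m (by rw [hs]; trivial) b

/-- Products of k-module generators of B with generators of N generate over k, hence over A;
compatibility of φ with scalars turns the k-action into part of the A-action. -/
theorem resObj_finite [Module.Finite k B] (hφ : ∀ r, φ (algebraMap k A r) = algebraMap k B r)
    (N : GrSMod.{w, v} ℬ) [Module.Finite B N.carrier] :
    Module.Finite A (resObj φ N).carrier := by
  classical
  obtain ⟨s, hs⟩ := Module.Finite.fg_top (R := B) (M := N.carrier)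
  obtain ⟨t, ht⟩ := Module.Finite.fg_top (R := k) (M := B)
  let u : Finset N.carrier := Finset.image₂ (fun b m => b • m) t s
  let P : Submodule A (resObj φ N).carrier := Submodule.span A (u : Set N.carrier)
  refine ⟨⟨u, ?_⟩⟩
  rw [eq_top_iff]
  rintro x -
  have h1 : ∀ m ∈ s, ∀ b ∈ Submodule.span k (t : Set B), (b • m : N.carrier) ∈ P := by
    intro m hm b hb
    induction hb using Submodule.span_induction with
    | mem b hb => exact Submodule.subset_span (Finset.mem_coe.2 (Finset.mem_image₂_of_mem hb hm))
    | zero => rw [zero_smul]; exact P.zero_mem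
    | add b b' _ _ h h' => rw [add_smul]; exact P.add_mem h h'
    | smul r b _ h =>
      rw [Algebra.smul_def, mul_smul, ← hφ]
      exact P.smul_mem (algebraMap k A r) h
  have h2 : ∀ m ∈ Submodule.span B (s : Set N.carrier), ∀ b : B, (b • m : N.carrier) ∈ P := by
    intro m hm
    induction hm using Submodule.span_induction with
    | mem m hm => exact fun b => h1 m hm b (by rw [ht]; trivial)
    | zero => intro b; rw [smul_zero]; exact P.zero_mem
    | add m m' _ _ h h' => intro b; rw [smul_add]; exact P.add_mem (h b) (h' b)
    | smul c m _ h => intro b; rw [smul_smul]; exact h _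
  have h3 : ∀ x : N.carrier, x ∈ P := fun x => by
    have := h2 x (by rw [hs]; trivial) 1
    rwa [one_smul] at this
  exact h3 x

end InducedModules

/-! ### The components of the Mackey isomorphism. -/

section Mackey

variable {k : Type u₁} [CommRing k] {F : Type u₂} [Ring F] [Algebra k F]
  {𝒻 : Gr → Submodule k F} [GradedAlgebra 𝒻] {D : FrobeniusSuperalgebra 𝒻} (C : CycParam D)

theorem iSup_piece_eq_span (D : FrobeniusSuperalgebra 𝒻) (ε : ZMod 2) :
    (⨆ i : ℤ, 𝒻 (i, ε)) =
      Submodule.span k (Set.range fun b : {b : Fin D.dim // (D.deg b).2 = ε} => D.B b) := by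
  apply le_antisymm
  · refine iSup_le fun i a ha => ?_
    rw [← D.B.sum_repr a]
    refine sum_mem fun b _ => ?_
    by_cases h : (D.deg b).2 = ε
    · exact Submodule.smul_mem _ _ (Submodule.subset_span ⟨⟨b, h⟩, rfl⟩)
    · rw [D.repr_eq_zero ha (fun h' => h (congrArg Prod.snd h')), zero_smul]
      exact zero_mem _
  · refine Submodule.span_le.2 ?_
    rintro _ ⟨⟨b, rfl⟩, rfl⟩
    exact Submodule.mem_iSup_of_mem (p := fun i : ℤ => 𝒻 (i, (D.deg b).2)) (D.deg b).1 (D.B_mem b)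

theorem finrank_iSup_piece [Nontrivial k] (D : FrobeniusSuperalgebra 𝒻) (ε : ZMod 2) :
    Module.finrank k (⨆ i : ℤ, 𝒻 (i, ε) : Submodule k F) =
      Fintype.card {b : Fin D.dim // (D.deg b).2 = ε} := by
  rw [iSup_piece_eq_span]
  exact finrank_span_eq_card (D.B.linearIndependent.comp _ Subtype.val_injective)

/-- The monomials in the elements of largest index, enumerated according to their parities. -/
theorem exists_parity_equiv [Nontrivial k] :
    ∃ e : Fin (C.level * Module.finrank k (⨆ i : ℤ, 𝒻 (i, 0) : Submodule k F)) ⊕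
        Fin (C.level * Module.finrank k (⨆ i : ℤ, 𝒻 (i, 1) : Submodule k F)) ≃
        Fin C.level × Fin D.dim,
      (∀ i, (D.deg (e (.inl i)).2).2 = 0) ∧ ∀ i, (D.deg (e (.inr i)).2).2 = 1 := by
  have h : ∀ ε : ZMod 2, Nonempty
      (Fin (C.level * Module.finrank k (⨆ i : ℤ, 𝒻 (i, ε) : Submodule k F)) ≃
        Fin C.level × {b : Fin D.dim // (D.deg b).2 = ε}) := fun ε =>
    ⟨Fintype.equivOfCardEq (by
      rw [Fintype.card_fin, Fintype.card_prod, Fintype.card_fin, finrank_iSup_piece])⟩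
  obtain ⟨e₀⟩ := h 0
  obtain ⟨e₁⟩ := h 1
  have h01 : ∀ ε : ZMod 2, ε = 1 ↔ ¬ ε = 0 := by decide
  let e₂ : {b : Fin D.dim // (D.deg b).2 = 1} ≃ {b : Fin D.dim // ¬ (D.deg b).2 = 0} :=
    Equiv.subtypeEquivRight fun b => h01 _
  refine ⟨(e₀.sumCongr e₁).trans ((Equiv.prodSumDistrib _ _ _).symm.trans
    ((Equiv.refl _).prodCongr (((Equiv.refl _).sumCongr e₂).trans (Equiv.sumCompl _)))), ?_, ?_⟩
  · exact fun i => (e₀ i).2.2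
  · exact fun i => (e₁ i).2.2

variable (n : ℕ)

theorem lastElt_mem (i : Fin C.level × Fin D.dim) :
    lastElt C n i ∈ cycPiece (n + 1) C
      ((((i.1 : ℕ) * D.δ : ℕ) : ℤ) + (D.deg i.2).1, (D.deg i.2).2) := by
  have h1 := SetLike.pow_mem_graded (i.1 : ℕ) (gen_hom_mem C (.x (Fin.last n)))
  have h2 := cycPiece_mul C h1 (gen_hom_mem C (.f (Fin.last n) _ _ (D.B_mem i.2)))
  have h3 : (i.1 : ℕ) • ((D.δ : ℤ), (0 : ZMod 2)) + D.deg i.2 =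
      ((((i.1 : ℕ) * D.δ : ℕ) : ℤ) + (D.deg i.2).1, (D.deg i.2).2) := by
    ext <;> simp
  rw [h3] at h2
  exact h2

variable {n}

/-- The variable commutes with the preceding level, so the only sign comes from the element of F in
the last factor. -/
theorem inclAlg_mul_lastElt {p : Gr} {u : Cyc n C} (hu : u ∈ cycPiece n C p)
    (i : Fin C.level × Fin D.dim) : inclAlg n C u * lastElt C n i =
      sgn (p.2 * (D.deg i.2).2) • (lastElt C n i * inclAlg n C u) := by
  rw [lastElt, ← mul_assoc, inclAlg_mul_xLast_pow, mul_assoc, inclAlg_mul_fLast C hu (D.B_mem _),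
    mul_smul_comm, mul_assoc]

theorem smul_indMk_lastElt (M : CycMod.{u₁, u₂, v} n C) {p : Gr} {u : Cyc n C}
    (hu : u ∈ cycPiece n C p) (i : Fin C.level × Fin D.dim) (m : M.carrier) :
    indMk (incl n C) M (lastElt C n i) (u • m) = sgn (p.2 * (D.deg i.2).2) •
      (incl n C u • indMk (incl n C) M (lastElt C n i) m) := by
  rw [smul_indMk, ← indMk_mul]
  change indMk _ _ (lastElt C n i * inclAlg n C u) m = _ • indMk _ _ (inclAlg n C u * _) m
  rw [inclAlg_mul_lastElt C hu]
  have h := map_zsmul (AddMonoidHom.flip (indMkHom (incl n C) M) m) (sgn (p.2 * (D.deg i.2).2))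
    (lastElt C n i * inclAlg n C u)
  refine Eq.trans ?_ (congrArg (sgn (p.2 * (D.deg i.2).2) • ·) h.symm)
  rw [smul_smul, sgn_mul_self, one_smul]
  rfl

/-- The degree of a monomial in the elements of largest index. -/
noncomputable def lastDeg (i : Fin C.level × Fin D.dim) : ℤ :=
  (((i.1 : ℕ) * D.δ : ℕ) : ℤ) + (D.deg i.2).1

theorem indMkHom_mem_HOM_of_even (M : CycMod.{u₁, u₂, v} n C) {i : Fin C.level × Fin D.dim}
    (hi : (D.deg i.2).2 = 0) : indMkHom (incl n C) M (lastElt C n i) ∈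
      HOM M ((cycInd.{u₁, u₂, v} n C ⋙ cycRes.{u₁, u₂, v} n C).obj M) (lastDeg C i) 0 := by
  refine ⟨fun p a m ha => ?_, fun q m hm => ?_⟩
  · have h := smul_indMk_lastElt C M ha i m
    rw [hi, mul_zero] at h
    rw [zero_mul]
    exact h
  · have h := lastElt_mem C n i
    rw [hi] at h
    exact indMk_mem _ M h hm

/-- The sign for moving an odd monomial past an element of the algebra is the sign built into the
action on the parity shift, so the resulting map is an even homomorphism. -/
theorem indMkHom_mem_HOM_of_odd (M : CycMod.{u₁, u₂, v} n C) {i : Fin C.level × Fin D.dim}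
    (hi : (D.deg i.2).2 = 1) : indMkHom (incl n C) M (lastElt C n i) ∈
      HOM (parityShiftObj M) ((cycInd.{u₁, u₂, v} n C ⋙ cycRes.{u₁, u₂, v} n C).obj M)
        (lastDeg C i) 0 := by
  refine ⟨fun p a (m : M.carrier) ha => ?_, fun q m hm => ?_⟩
  · have h := smul_indMk_lastElt C M ha i m
    rw [hi, mul_one] at h
    rw [zero_mul, sgn_zero, one_smul]
    change indMkHom (incl n C) M (lastElt C n i) (parityInv (cycPiece n C) a • m) = _
    rw [parityInv_of_mem ha, smul_assoc, map_zsmul]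
    refine (congrArg (sgn p.2 • ·) h).trans ?_
    rw [smul_smul, sgn_mul_self, one_smul]
    rfl
  · have h := lastElt_mem C n i
    rw [hi] at h
    have h2 := indMk_mem (incl n C) M h hm
    -- The odd parity of the monomial and the parity shift of the module add up to zero.
    have h3 : ((lastDeg C i, 1) + (q + (0, 1)) : Gr) = (lastDeg C i, 0) + q := by
      have : ∀ a : ZMod 2, 1 + (a + 1) = 0 + a := by decide
      ext
      · simp
      · exact this _
    exact h3 ▸ h2

/-- The map `u ⊗ m ↦ u s ⊗ m`, where `s` is the last simple transposition. -/
noncomputable def cosetHom (M : CycMod.{u₁, u₂, v} (n + 1) C) :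
    IndCarrier (incl n C) ((cycRes.{u₁, u₂, v} n C).obj M) →+ IndCarrier (incl (n + 1) C) M :=
  indLift (incl n C) ((cycRes.{u₁, u₂, v} n C).obj M)
    ((indMkHom (incl (n + 1) C) M).comp
      ((AddMonoidHom.mulRight (swapLast C (n + 1) (Fin.last n).castSucc)).comp
        (inclAlg (n + 1) C : Cyc (n + 1) C →+* Cyc (n + 2) C).toAddMonoidHom))
    (fun b a (m : M.carrier) => by
      change indMk _ M (inclAlg (n + 1) C (b * inclAlg n C a) *
        swapLast C (n + 1) (Fin.last n).castSucc) m = indMk _ M (inclAlg (n + 1) C b *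
          swapLast C (n + 1) (Fin.last n).castSucc) (inclAlg n C a • m)
      rw [map_mul, mul_assoc, ← swap_castSucc_mul_inclAlg, ← mul_assoc]
      exact indMk_mul (incl (n + 1) C) M _ _ _)

/-- Right multiplication by s commutes with the left action, and s is even of degree zero. -/
theorem cosetHom_mem_HOM (M : CycMod.{u₁, u₂, v} (n + 1) C) : cosetHom C M ∈
    HOM ((cycRes.{u₁, u₂, v} n C ⋙ cycInd.{u₁, u₂, v} n C).obj M)
      ((cycInd.{u₁, u₂, v} (n + 1) C ⋙ cycRes.{u₁, u₂, v} (n + 1) C).obj M) 0 0 := by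
  refine ⟨fun p a (x : IndCarrier (incl n C) ((cycRes.{u₁, u₂, v} n C).obj M)) _ => ?_,
    fun q (x : IndCarrier (incl n C) ((cycRes.{u₁, u₂, v} n C).obj M))
      (hx : x ∈ indPiece (incl n C) ((cycRes.{u₁, u₂, v} n C).obj M) q) => ?_⟩
  · rw [zero_mul, sgn_zero, one_smul]
    change cosetHom C M (a • x) = incl (n + 1) C a • cosetHom C M x
    induction x using ind_induction_mk (incl n C) ((cycRes.{u₁, u₂, v} n C).obj M) with
    | zero => rw [smul_zero, map_zero, smul_zero]
    | add x y hx hy => rw [smul_add, map_add, hx, hy, map_add, smul_add]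
    | mk b m =>
      refine (congrArg (cosetHom C M) (smul_indMk _ _ a b m)).trans ?_
      have h : ∀ m : M.carrier, indMk (incl (n + 1) C) M
          (inclAlg (n + 1) C (a * b) * swapLast C (n + 1) (Fin.last n).castSucc) m =
          incl (n + 1) C a • indMk (incl (n + 1) C) M
            (inclAlg (n + 1) C b * swapLast C (n + 1) (Fin.last n).castSucc) m := fun m => by
        rw [smul_indMk, map_mul, mul_assoc]
        rfl
      exact h m
  · have h0 : (((0 : ℤ), (0 : ZMod 2)) + q : Gr) = q := zero_add q
    rw [h0]
    change cosetHom C M x ∈ indPiece (incl (n + 1) C) M q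
    induction hx using AddSubgroup.closure_induction with
    | mem x hx =>
      obtain ⟨p', q', b, m, rfl, hb, hm, rfl⟩ := hx
      have h1 := cycPiece_mul C (inclAlg_mem C hb)
        (gen_hom_mem C (.s (Equiv.swap (Fin.last n).castSucc (Fin.last (n + 1)))))
      rw [add_zero] at h1
      exact indMk_mem _ M h1 hm
    | zero => rw [map_zero]; exact zero_mem _
    | add x y _ _ hx hy => rw [map_add]; exact add_mem hx hy
    | neg x _ hx => rw [map_neg]; exact neg_mem hx

section Components

variable {a b : ℕ} (e : Fin a ⊕ Fin b → Fin C.level × Fin D.dim)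

/-- The functors of which the right side of the Mackey decomposition is the direct sum. -/
noncomputable abbrev mackeySummand (n : ℕ) (C : CycParam D) (a b : ℕ) :
    Fin a ⊕ Fin b ⊕ Unit → (CycMod.{u₁, u₂, v} (n + 1) C ⥤ CycMod.{u₁, u₂, v} (n + 1) C) :=
  Sum.elim (fun _ : Fin a => 𝟭 _) (Sum.elim (fun _ : Fin b => parityShift)
    (fun _ : Unit => cycRes.{u₁, u₂, v} n C ⋙ cycInd.{u₁, u₂, v} n C))

/-- The components of the Mackey isomorphism. -/
noncomputable def mackeyComp (M : CycMod.{u₁, u₂, v} (n + 1) C) :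
    ∀ i : Fin a ⊕ Fin b ⊕ Unit, ((mackeySummand.{u₁, u₂, v} n C a b i).obj M).carrier →+
      ((cycInd.{u₁, u₂, v} (n + 1) C ⋙ cycRes.{u₁, u₂, v} (n + 1) C).obj M).carrier
  | .inl i => indMkHom (incl (n + 1) C) M (lastElt C (n + 1) (e (.inl i)))
  | .inr (.inl i) => indMkHom (incl (n + 1) C) M (lastElt C (n + 1) (e (.inr i)))
  | .inr (.inr _) => cosetHom C M

/-- The degrees of the components of the Mackey isomorphism. -/
noncomputable def mackeyDeg : Fin a ⊕ Fin b ⊕ Unit → ℤ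
  | .inl i => lastDeg C (e (.inl i))
  | .inr (.inl i) => lastDeg C (e (.inr i))
  | .inr (.inr _) => 0

theorem mackeyComp_mem (h0 : ∀ i, (D.deg (e (.inl i)).2).2 = 0)
    (h1 : ∀ i, (D.deg (e (.inr i)).2).2 = 1) (M : CycMod.{u₁, u₂, v} (n + 1) C) :
    ∀ i, mackeyComp C e M i ∈ HOM ((mackeySummand.{u₁, u₂, v} n C a b i).obj M)
      ((cycInd.{u₁, u₂, v} (n + 1) C ⋙ cycRes.{u₁, u₂, v} (n + 1) C).obj M) (mackeyDeg C e i) 0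
  | .inl i => indMkHom_mem_HOM_of_even C M (h0 i)
  | .inr (.inl i) => indMkHom_mem_HOM_of_odd C M (h1 i)
  | .inr (.inr _) => cosetHom_mem_HOM C M

theorem sumHom_mackeyComp (M : CycMod.{u₁, u₂, v} (n + 1) C)
    (x : ∀ i, ((mackeySummand.{u₁, u₂, v} n C a b i).obj M).carrier) :
    sumHom (N := fun i => (mackeySummand.{u₁, u₂, v} n C a b i).obj M) (mackeyComp C e M) x =
      ∑ i, mackeyComp C e M (.inl i) (x (.inl i)) +
        (∑ i, mackeyComp C e M (.inr (.inl i)) (x (.inr (.inl i))) +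
          mackeyComp C e M (.inr (.inr ())) (x (.inr (.inr ())))) := by
  refine (sumHom_apply _ x).trans ?_
  rw [Fintype.sum_sum_type, Fintype.sum_sum_type, Fintype.sum_unique (ι := Unit)]

theorem sumHom_mackeyComp_natural {M N : CycMod.{u₁, u₂, v} (n + 1) C} (f : M ⟶ N)
    (i : Fin a ⊕ Fin b ⊕ Unit) (x : ((mackeySummand.{u₁, u₂, v} n C a b i).obj M).carrier) :
    mackeyComp C e N i (((mackeySummand.{u₁, u₂, v} n C a b i).map f).1 x) =
      ((cycInd.{u₁, u₂, v} (n + 1) C ⋙ cycRes.{u₁, u₂, v} (n + 1) C).map f).1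
        (mackeyComp C e M i x) := by
  match i, x with
  | .inl i, x => rfl
  | .inr (.inl i), x => rfl
  | .inr (.inr _), x =>
    change cosetHom C N (indMap (incl n C) ((cycRes.{u₁, u₂, v} n C).map f) x) =
      indMap (incl (n + 1) C) f (cosetHom C M x)
    induction x using ind_induction_mk (incl n C) ((cycRes.{u₁, u₂, v} n C).obj M) with
    | zero => simp only [map_zero]
    | add x y hx hy => simp only [map_add, hx, hy]
    | mk b m => rfl

end Components

end Mackey

/-! ### Assembly of the Mackey isomorphism. -/

section MackeyTheorem

variable {k : Type u₁} [CommRing k] {F : Type u₂} [Ring F] [Algebra k F]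
  {𝒻 : Gr → Submodule k F} [GradedAlgebra 𝒻] {D : FrobeniusSuperalgebra 𝒻} (C : CycParam D)
  {n : ℕ} {a b : ℕ}

theorem mackeyElt_bijective : Function.Bijective
    fun c : (Fin C.level × Fin D.dim) ⊕ (Fin (n + 1) × Fin C.level × Fin D.dim) →
      Cyc (n + 1) C => ∑ i, mackeyElt C n i * incl (n + 1) C (c i) := by
  have h := rightComb_mackeyElt_bijective C n
  have h2 : (rightComb (inclAlg (n + 1) C) (mackeyElt C n) : _ → Cyc (n + 2) C) =
      fun c => ∑ i, mackeyElt C n i * incl (n + 1) C (c i) :=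
    funext fun c => rightComb_apply _ _ c
  rwa [h2] at h

theorem basisElt_surjective : Function.Surjective
    fun c : Fin (n + 1) × Fin C.level × Fin D.dim → Cyc n C =>
      ∑ i, basisElt C n i * incl n C (c i) := by
  have h := rightComb_basisElt_surjective C n
  have h2 : (rightComb (inclAlg n C) (basisElt C n) : _ → Cyc (n + 1) C) =
      fun c => ∑ i, basisElt C n i * incl n C (c i) :=
    funext fun c => rightComb_apply _ _ c
  rwa [h2] at h

/-- Coefficients of the elements of an induced module as an element of the right side of the Mackey
decomposition. -/
noncomputable def mackeyCoeff (e : Fin a ⊕ Fin b ≃ Fin C.level × Fin D.dim)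
    (M : CycMod.{u₁, u₂, v} (n + 1) C)
    (c : (Fin C.level × Fin D.dim) ⊕ (Fin (n + 1) × Fin C.level × Fin D.dim) → M.carrier) :
    ∀ i, ((mackeySummand.{u₁, u₂, v} n C a b i).obj M).carrier
  | .inl i => c (.inl (e (.inl i)))
  | .inr (.inl i) => c (.inl (e (.inr i)))
  | .inr (.inr _) => indComb (incl n C) ((cycRes.{u₁, u₂, v} n C).obj M) (basisElt C n)
      fun i => c (.inr i)

theorem mackeyCoeff_surjective (e : Fin a ⊕ Fin b ≃ Fin C.level × Fin D.dim)
    (M : CycMod.{u₁, u₂, v} (n + 1) C) : Function.Surjective (mackeyCoeff C e M) := by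
  intro x
  obtain ⟨c, hc⟩ := indComb_surjective (incl n C) ((cycRes.{u₁, u₂, v} n C).obj M)
    (basisElt_surjective C) (x (.inr (.inr ())))
  let x₀ : Fin a → M.carrier := fun i => x (.inl i)
  let x₁ : Fin b → M.carrier := fun i => x (.inr (.inl i))
  let c₀ : Fin C.level × Fin D.dim → M.carrier := fun j => Sum.elim x₀ x₁ (e.symm j)
  refine ⟨Sum.elim c₀ c, funext fun i => ?_⟩
  match i with
  | .inl i => exact congrArg (Sum.elim x₀ x₁) (e.symm_apply_apply (.inl i))
  | .inr (.inl i) => exact congrArg (Sum.elim x₀ x₁) (e.symm_apply_apply (.inr i))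
  | .inr (.inr ()) => exact hc

theorem sumHom_mackeyCoeff (e : Fin a ⊕ Fin b ≃ Fin C.level × Fin D.dim)
    (M : CycMod.{u₁, u₂, v} (n + 1) C)
    (c : (Fin C.level × Fin D.dim) ⊕ (Fin (n + 1) × Fin C.level × Fin D.dim) → M.carrier) :
    sumHom (N := fun i => (mackeySummand.{u₁, u₂, v} n C a b i).obj M) (mackeyComp C e M)
      (mackeyCoeff C e M c) = indComb (incl (n + 1) C) M (mackeyElt C n) c := by
  refine (sumHom_mackeyComp C e M _).trans ?_
  rw [indComb_apply, Fintype.sum_sum_type, ← e.sum_comp, Fintype.sum_sum_type]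
  refine (add_assoc _ _ _).symm.trans (congrArg₂ (· + ·) rfl ?_)
  exact (congrArg (cosetHom C M) (indComb_apply (incl n C) ((cycRes.{u₁, u₂, v} n C).obj M)
    (basisElt C n) fun i => c (.inr i))).trans (map_sum (cosetHom C M) _ _)

/-- The bijection given by the right basis factors as `mackeyCoeff` followed by the sum of the
components. Since the first map is surjective, the second one is bijective; independence of the
family `basisElt` is not required. -/
theorem sumHom_mackeyComp_bijective (e : Fin a ⊕ Fin b ≃ Fin C.level × Fin D.dim)
    (M : CycMod.{u₁, u₂, v} (n + 1) C) : Function.Bijective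
      (sumHom (N := fun i => (mackeySummand.{u₁, u₂, v} n C a b i).obj M) (mackeyComp C e M)) := by
  have h := indComb_bijective (incl (n + 1) C) M (mackeyElt_bijective C)
  have h1 : (indComb (incl (n + 1) C) M (mackeyElt C n) : _ → _) =
      (sumHom (N := fun i => (mackeySummand.{u₁, u₂, v} n C a b i).obj M) (mackeyComp C e M)) ∘
        mackeyCoeff C e M := funext fun c => (sumHom_mackeyCoeff C e M c).symm
  rw [h1] at h
  exact ⟨Function.Injective.of_comp_right h.1 (mackeyCoeff_surjective C e M),
    Function.Surjective.of_comp h.2⟩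

variable (n) in
/-- The Mackey decomposition of induction followed by restriction. -/
theorem natIsoHOM_mackeySum [Nontrivial k] :
    NatIsoHOM (cycInd.{u₁, u₂, v} (n + 1) C ⋙ cycRes.{u₁, u₂, v} (n + 1) C)
      (mackeySum (C.level * Module.finrank k (⨆ i : ℤ, 𝒻 (i, 0) : Submodule k F))
        (C.level * Module.finrank k (⨆ i : ℤ, 𝒻 (i, 1) : Submodule k F))
        (cycRes.{u₁, u₂, v} n C ⋙ cycInd.{u₁, u₂, v} n C)) := by
  obtain ⟨e, h0, h1⟩ := exists_parity_equiv C
  have hα := mackeyComp_mem.{u₁, u₂, v} C (n := n) e h0 h1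
  choose η hη hθη hηθ using fun M => exists_inverse_evenHOM (hα M)
    (sumHom_mackeyComp_bijective C e M)
  refine ⟨η, fun M => sumHom (mackeyComp C e M), hη, fun M => sumHom_mem (hα M), hθη, hηθ, ?_⟩
  intro M N f x
  -- The components are natural in the direction out of the direct sum. Naturality of the inverse is
  -- checked after applying the bijection.
  refine (sumHom_mackeyComp_bijective C e N).1 ?_
  refine Eq.trans ?_ (hθη N _).symm
  let T := ((cycInd.{u₁, u₂, v} (n + 1) C ⋙ cycRes.{u₁, u₂, v} (n + 1) C).map f).1
  refine Eq.trans ?_ (congrArg T (hθη M x))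
  refine (sumHom_apply (mackeyComp C e N) _).trans (Eq.trans ?_ ((congrArg T
    (sumHom_apply (mackeyComp C e M) (η M x))).trans (map_sum T _ _)).symm)
  exact Finset.sum_congr rfl fun i _ => sumHom_mackeyComp_natural C e f i (η M x i)

theorem cycInd_finite (M : CycMod.{u₁, u₂, v} n C) (_ : Module.Finite (Cyc n C) M.carrier) :
    Module.Finite (Cyc (n + 1) C) ((cycInd.{u₁, u₂, v} n C).obj M).carrier :=
  indObj_finite (incl n C) M

theorem cycRes_finite (M : CycMod.{u₁, u₂, v} (n + 1) C)
    (_ : Module.Finite (Cyc (n + 1) C) M.carrier) :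
    Module.Finite (Cyc n C) ((cycRes.{u₁, u₂, v} n C).obj M).carrier :=
  resObj_finite (incl n C) (inclAlg n C).commutes M

end MackeyTheorem

end AWP

theorem mainTheorem9 {k : Type u₁} [CommRing k] {F : Type u₂} [Ring F] [Algebra k F]
    (𝒻 : Gr → Submodule k F) [GradedAlgebra 𝒻] (D : FrobeniusSuperalgebra 𝒻)
    (hchar : ringChar k ≠ 2) (hfin : 0 < orderOf D.ψ) (hdvd : ¬ ringChar k ∣ orderOf D.ψ)
    (hdiag : ∃ b : Module.Basis (Fin D.dim) k F, ∀ i, ∃ z : k, D.ψ (b i) = z • b i)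
    (C : CycParam D) :
    (∀ n : ℕ, NatIsoHOM (cycInd.{u₁, u₂, v} (n + 1) C ⋙ cycRes.{u₁, u₂, v} (n + 1) C)
      (mackeySum (C.level * Module.finrank k (⨆ i : ℤ, 𝒻 (i, 0) : Submodule k F))
        (C.level * Module.finrank k (⨆ i : ℤ, 𝒻 (i, 1) : Submodule k F))
        (cycRes.{u₁, u₂, v} n C ⋙ cycInd.{u₁, u₂, v} n C))) ∧
    (∀ (n : ℕ) (M : CycMod.{u₁, u₂, v} n C), Module.Finite (Cyc n C) M.carrier →
      Module.Finite (Cyc (n + 1) C) ((cycInd.{u₁, u₂, v} n C).obj M).carrier) ∧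
    (∀ (n : ℕ) (M : CycMod.{u₁, u₂, v} (n + 1) C), Module.Finite (Cyc (n + 1) C) M.carrier →
      Module.Finite (Cyc n C) ((cycRes.{u₁, u₂, v} n C).obj M).carrier) := by
  -- In the zero ring the image of θ vanishes, so the characteristic would divide θ. Nontriviality
  -- is what identifies the ranks of the parity components of F with numbers of basis elements.
  have : Nontrivial k := by
    rw [← not_subsingleton_iff_nontrivial]
    intro h
    exact hdvd ((ringChar.spec k _).1 (Subsingleton.elim _ _))
  exact ⟨fun n => natIsoHOM_mackeySum C n, fun _ M hM => cycInd_finite C M hM,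
    fun _ M hM => cycRes_finite C M hM⟩
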